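/- **Tropical covers.** A tropical curve $C$ is a finite connected metric graph without $2$-valent vertices. Its $1$-valent vertices are called leaves, the other vertices inner vertices; edges adjacent to a leaf are called ends and have infinite length, all other (inner) edges have finite length. The genus of $C$ is its first Betti number. A tropical cover is a continuous map $\varphi:C\to\mathbb R\cup\{\pm\infty\}$ such that inner vertices are mapped to $\mathbb R$, $\varphi^{-1}(+\infty)$ and $\varphi^{-1}(-\infty)$ are non-empty and their union is the set of leaves, $\varphi$ is affine on each edge $e$ with slope $\pm\omega(e)$ for a positive integer $\omega(e)$ (the weight of $e$), and at every inner vertex the sum of the weights of the adjacent edges on its left equals that on its right. Covers are considered up to isometries of the curves compatible with the maps to $\mathbb R\cup\{\pm\infty\}$. Let $g\ge 0$, let $\lambda,\mu$ be partitions with $|\lambda|=|\mu|$, with numbers of parts $l(\lambda),l(\mu)$, let $r=l(\lambda)+l(\mu)+2g-2$ and $x_1<\dots<x_r$ real numbers. A tropical cover is of type $(g,\lambda,\mu,\underline x)$ if $C$ has genus $g$, the weights of the ends over $-\infty$ (over $+\infty$) form the partition $\lambda$ (respectively $\mu$), and every $x_i$ is the image of an inner vertex. (All inner vertices are then $3$-valent,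 with exactly one over each $x_i$.) **Effective non-zigzag covers.** An edge is even or odd according to its weight. A symmetric cycle is a pair of inner edges of equal weight with the same two endpoints; a symmetric fork is a pair of ends of equal weight adjacent to the same inner vertex and pointing in the same direction. A string is a non-empty connected subgraph of $C$ which, away from the leaves, is a closed one-dimensional submanifold. It is bent at one of its inner vertices if both its edges there lie on the same side of that vertex. A tail is a chain attached at one of its endpoints and running in one direction (left or right), of one of the following forms: (i) a chain of even edges and any number $\ge 0$ of symmetric odd cycles, finishing in an end of weight $2o$ with $o$ odd; (ii) such a chain finishing in a symmetric fork of two ends of the same odd weight; (iii) a single end of weight $2e$ with $e$ even. A tropical cover of type $(g,\lambda,\mu,\underline x)$ is an effective non-zigzag cover if there are $n>1$ disjoint strings $S_1,\dots,S_n$ of odd edges, none of which belongs to a symmetric cycle or a symmetric odd fork, and connecting pieces $E_1,\dots,E_{n-1}$, such that * $E_i$ joins an inner vertex of $S_i$ to an inner vertex of $S_{i+1}$ (in either direction), and either both strings are not bent at these vertices and $E_i$ is a chain of even inner edges and any number $\ge 0$ of cycles made of two even edges, or both strings are bent there, with their peaks pointing towards $E_i$, and $E_i$ is a single even inner edge;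 * every connected component of the complement of $\bigcup_i S_i\cup\bigcup_i E_i$ is a tail attached to some $S_i$; * every vertex of every $E_i$, including its two points of attachment, is mapped to some $x_j$ with $j\le\lceil r/2\rceil$. Let $Z'_g(\lambda,\mu)$ be twice the number of isomorphism classes of effective non-zigzag covers of type $(g,\lambda,\mu,\underline x)$; it does not depend on the choice of $x_1<\dots<x_r$. Put $z'_{g,\lambda,\mu}(m)=Z'_g((\lambda,1^m),(\mu,1^m))$, where $(\lambda,1^m)$ is $\lambda$ with $m$ parts equal to $1$ added. Let $\lambda_0$ denote the set of odd numbers which occur an odd number of times in $\lambda$ (the last component of the tail decomposition $\lambda=(2\lambda_{2e},2\lambda_{2o},\lambda_{o,o}^2,\lambda_0)$), define $\mu_0$ similarly, and let $l(\lambda_0,\mu_0)=|\lambda_0|+|\mu_0|$. **Proposition.** Fix $g\in\mathbb N$ and partitions $\lambda,\mu$ with $|\lambda|=|\mu|$. There is $m_0\in\mathbb N$ such that, for every choice of the points $\underline x$ and for all $m>2m_0$ for which either $l(\lambda_0,\mu_0)\ge 2$, or $l(\lambda_0,\mu_0)=0$ and $m$ is odd, $$z'_{g,\lambda,\mu}(m)\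 \ge\ \Bigl(\bigl(\lfloor m/2\rfloor-m_0\bigr)!\Bigr)^4 .$$ -/

import Mathlib

/-- A tropical curve: a finite connected metric graph without 2-valent vertices. Every edge `e` is
parametrised as an interval starting at `src e` and finishing at `tgt e`; loops and multiple edges
are allowed. Leaves are the 1-valent vertices, ends are the edges adjacent to a leaf; ends have
infinite length, and all other edges have finite positive length. -/
structure TropicalCurve where
  V : Type
  E : Type
  [fintypeV : Fintype V]
  [fintypeE : Fintype E]
  [decEqV : DecidableEq V]
  [decEqE : DecidableEq E]
  src : E → V
  tgt : E → V
  len : E → ENNReal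
  connected : (SimpleGraph.fromRel (fun v w => ∃ e, src e = v ∧ tgt e = w)).Connected
  valence_ne_two : ∀ v,
    (Finset.univ.filter fun e => src e = v).card + (Finset.univ.filter fun e => tgt e = v).card ≠ 2
  len_pos : ∀ e, 0 < len e
  len_eq_top_iff : ∀ e, len e = ⊤ ↔ ∃ v, (v = src e ∨ v = tgt e) ∧
    (Finset.univ.filter fun e => src e = v).card + (Finset.univ.filter fun e => tgt e = v).card = 1

namespace TropicalCurve

attribute [instance] TropicalCurve.fintypeV TropicalCurve.fintypeE TropicalCurve.decEqV
  TropicalCurve.decEqE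

variable (C : TropicalCurve)

/-- The valence of a vertex (a loop counts twice). -/
def valence (v : C.V) : ℕ :=
  (Finset.univ.filter fun e => C.src e = v).card + (Finset.univ.filter fun e => C.tgt e = v).card

def IsLeaf (v : C.V) : Prop := C.valence v = 1

def IsEnd (e : C.E) : Prop := C.IsLeaf (C.src e) ∨ C.IsLeaf (C.tgt e)

/-- The edge `e` is adjacent to the vertex `v`. -/
def Touches (e : C.E) (v : C.V) : Prop := C.src e = v ∨ C.tgt e = v

/-- The vertices of the subgraph spanned by a set of edges. -/
def verts (S : Set C.E) : Set C.V := {v | ∃ e ∈ S, C.Touches e v}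

/-- The first Betti number of the (connected) graph is `g`. -/
def HasGenus (g : ℕ) : Prop := Fintype.card C.E + 1 = Fintype.card C.V + g

/-- A string, given by its set of edges: a non-empty connected subgraph which is a closed
one-dimensional submanifold away from the leaves, i.e. it has exactly two edges at each of its
inner vertices. -/
def IsString (S : Set C.E) : Prop :=
  S.Nonempty ∧
  (∀ e ∈ S, ∀ f ∈ S,
    Relation.ReflTransGen (fun a b => b ∈ S ∧ ∃ v, C.Touches a v ∧ C.Touches b v) e f) ∧
  (∀ v ∈ C.verts S, ¬ C.IsLeaf v →
    {e ∈ S | C.src e = v}.ncard + {e ∈ S | C.tgt e = v}.ncard = 2)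

/-- `T` is the set of edges of a connected component of `C ∖ U`, where `U` is the closed
subgraph given by a set of edges. -/
def IsComplComponent (U T : Set C.E) : Prop :=
  ∃ e, e ∉ U ∧ T = {f | Relation.ReflTransGen
    (fun a b => b ∉ U ∧ ∃ v, v ∉ C.verts U ∧ C.Touches a v ∧ C.Touches b v) e f}

end TropicalCurve

/-- A tropical cover `φ : C → ℝ ∪ {±∞}`. The map is given by its values `pos` at the vertices and
is affine of integer slope `± weight e` on each edge `e`; as this slope is non-zero, every edge is
taken to be parametrised in the direction in which `φ` increases. -/
structure TropicalCover extends TropicalCurve where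
  pos : V → EReal
  weight : E → ℕ
  isLeaf_iff : ∀ v, toTropicalCurve.IsLeaf v ↔ pos v = ⊥ ∨ pos v = ⊤
  exists_bot : ∃ v, pos v = ⊥
  exists_top : ∃ v, pos v = ⊤
  weight_pos : ∀ e, 0 < weight e
  pos_lt : ∀ e, pos (src e) < pos (tgt e)
  slope : ∀ e, ¬ toTropicalCurve.IsEnd e →
    (pos (tgt e)).toReal - (pos (src e)).toReal = weight e * (len e).toReal
  balanced : ∀ v, ¬ toTropicalCurve.IsLeaf v →
    ∑ e with tgt e = v, weight e = ∑ e with src e = v, weight e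

/-- An isomorphism of tropical covers: an isometry of the underlying curves compatible with the
maps to `ℝ ∪ {±∞}`. -/
structure TropicalCover.Iso (φ ψ : TropicalCover) where
  onV : φ.V ≃ ψ.V
  onE : φ.E ≃ ψ.E
  src_eq : ∀ e, ψ.src (onE e) = onV (φ.src e)
  tgt_eq : ∀ e, ψ.tgt (onE e) = onV (φ.tgt e)
  len_eq : ∀ e, ψ.len (onE e) = φ.len e
  weight_eq : ∀ e, ψ.weight (onE e) = φ.weight e
  pos_eq : ∀ v, ψ.pos (onV v) = φ.pos v

/-- The two directions on the target line. -/
inductive Side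
  | left
  | right

namespace TropicalCover

variable (φ : TropicalCover)

/-- The vertex of `e` from which `e` emanates when one walks in direction `s`. -/
def near : Side → φ.E → φ.V
  | .left => φ.tgt
  | .right => φ.src

/-- The vertex of `e` that is reached when one walks along `e` in direction `s`. -/
def far : Side → φ.E → φ.V
  | .left => φ.src
  | .right => φ.tgt

/-- `e` and `f` form a symmetric cycle. -/
def SymCycle (e f : φ.E) : Prop :=
  e ≠ f ∧ ¬ φ.IsEnd e ∧ ¬ φ.IsEnd f ∧ φ.weight e = φ.weight f ∧
    φ.src e = φ.src f ∧ φ.tgt e = φ.tgt f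

/-- `e` and `f` form a symmetric fork, with leaves in direction `s`. -/
def SymFork (s : Side) (e f : φ.E) : Prop :=
  e ≠ f ∧ φ.IsLeaf (φ.far s e) ∧ φ.IsLeaf (φ.far s f) ∧ φ.weight e = φ.weight f ∧
    φ.near s e = φ.near s f

/-- The edges which belong to a symmetric cycle or to a symmetric odd fork. -/
def symEdges : Set φ.E :=
  {e | ∃ f, φ.SymCycle e f ∨ (Odd (φ.weight e) ∧ ∃ s, φ.SymFork s e f)}

/-- The tails containing an edge of weight twice an odd number. `IsOddTail s v T` says that the
edges in `T` form a tail attached at `v` and leaving `v` in direction `s`: a chain of even edges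
and of any number of symmetric odd cycles, finishing either in an end of weight `2o` or in a
symmetric fork of two ends of weight `o`, with `o` odd. -/
inductive IsOddTail (s : Side) : φ.V → Set φ.E → Prop
  | single (a : φ.E) : φ.IsLeaf (φ.far s a) → (∃ o, Odd o ∧ φ.weight a = 2 * o) →
      IsOddTail s (φ.near s a) {a}
  | fork (a b c : φ.E) : φ.near s b = φ.far s a → φ.SymFork s b c → Odd (φ.weight b) →
      IsOddTail s (φ.near s a) {a, b, c}
  | cycle (a b c : φ.E) (T : Set φ.E) : φ.near s b = φ.far s a → φ.SymCycle b c →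
      Odd (φ.weight b) → IsOddTail s (φ.far s b) T →
      IsOddTail s (φ.near s a) ({a, b, c} ∪ T)

/-- The tails of zigzag covers: those of `IsOddTail`, and single ends of weight `2e`, with `e`
even. -/
def IsTail (s : Side) (v : φ.V) (T : Set φ.E) : Prop :=
  φ.IsOddTail s v T ∨
    ∃ a, T = {a} ∧ φ.near s a = v ∧ φ.IsLeaf (φ.far s a) ∧ ∃ k, Even k ∧ φ.weight a = 2 * k

/-- `IsEvenChain v w L`: the edges in `L` form a chain from `v` rightwards to `w` which consists
of even inner edges and of any number of cycles formed by two even inner edges. -/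
inductive IsEvenChain : φ.V → φ.V → Set φ.E → Prop
  | single (a : φ.E) : ¬ φ.IsEnd a → Even (φ.weight a) → IsEvenChain (φ.src a) (φ.tgt a) {a}
  | cycle (a b c : φ.E) (w : φ.V) (L : Set φ.E) : ¬ φ.IsEnd a → Even (φ.weight a) → b ≠ c →
      φ.src b = φ.tgt a → φ.src c = φ.tgt a → φ.tgt b = φ.tgt c →
      Even (φ.weight b) → Even (φ.weight c) → IsEvenChain (φ.tgt b) w L →
      IsEvenChain (φ.src a) w ({a, b, c} ∪ L)

/-- `L` connects the string `S`, on its left, with the string `S'`, on its right, in one of the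
two admissible ways: either neither string bends at the points of attachment, and `L` may carry
even cycles; or both strings bend there, with their peaks pointing towards `L`, and `L` is a single
even inner edge. -/
def IsLink (S S' L : Set φ.E) : Prop :=
  (∃ v w, φ.IsEvenChain v w L ∧
    (∃ e ∈ S, φ.tgt e = v) ∧ (∃ e ∈ S, φ.src e = v) ∧
    (∃ e ∈ S', φ.tgt e = w) ∧ (∃ e ∈ S', φ.src e = w)) ∨
  (∃ a, L = {a} ∧ ¬ φ.IsEnd a ∧ Even (φ.weight a) ∧
    (∃ e ∈ S, φ.tgt e = φ.src a) ∧ (∀ e ∈ S, φ.src e ≠ φ.src a) ∧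
    (∃ e ∈ S', φ.src e = φ.tgt a) ∧ (∀ e ∈ S', φ.tgt e ≠ φ.tgt a))

open scoped Classical in
/-- The weights of the ends adjacent to leaves over `-∞`. -/
noncomputable def leftWeights : Multiset ℕ :=
  (Finset.univ.filter fun e => φ.pos (φ.src e) = ⊥).val.map φ.weight

open scoped Classical in
/-- The weights of the ends adjacent to leaves over `+∞`. -/
noncomputable def rightWeights : Multiset ℕ :=
  (Finset.univ.filter fun e => φ.pos (φ.tgt e) = ⊤).val.map φ.weight

/-- `φ` is a tropical cover of type `(g, lam, mu, x)`. Its degree, which is the sum of the weights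
of the edges over any generic point of the line, is then `d`, as seen near `-∞`. -/
def HasType (g : ℕ) {d : ℕ} (lam mu : Nat.Partition d) {r : ℕ} (x : Fin r → ℝ) : Prop :=
  φ.HasGenus g ∧ φ.leftWeights = lam.parts ∧ φ.rightWeights = mu.parts ∧
    ∀ i, ∃ v, φ.pos v = (x i : EReal)

/-- The conditions that make a tropical cover with branch points `x 0 < ... < x (r - 1)` an
effective non-zigzag cover: strings `S 0, ..., S n` of odd edges, with `n + 1 > 1`, consecutive ones
being connected by `L i`, such that everything else consists of tails, and such that all vertices of
the `L i` lie over the first `⌈r / 2⌉` branch points. -/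
def IsEffectiveNonZigzag {r : ℕ} (x : Fin r → ℝ) : Prop :=
  ∃ (n : ℕ) (S : Fin (n + 1) → Set φ.E) (L : Fin n → Set φ.E), 1 < n + 1 ∧
    (∀ i, φ.IsString (S i) ∧ (∀ e ∈ S i, Odd (φ.weight e)) ∧ Disjoint (S i) φ.symEdges) ∧
    (∀ i j, i ≠ j → Disjoint (S i) (S j)) ∧
    (∀ i : Fin n, φ.IsLink (S i.castSucc) (S i.succ) (L i) ∨
      φ.IsLink (S i.succ) (S i.castSucc) (L i)) ∧
    (∀ T, φ.IsComplComponent ((⋃ i, S i) ∪ ⋃ i, L i) T →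
      ∃ i, ∃ v ∈ φ.verts (S i), ∃ s, φ.IsTail s v T) ∧
    (∀ i, ∀ v ∈ φ.verts (L i), ∃ j : Fin r, (j : ℕ) + 1 ≤ (r + 1) / 2 ∧ φ.pos v = (x j : EReal))

end TropicalCover

/-- The number `r = l(lam) + l(mu) + 2g - 2` of branch points. -/
def branchCount (g : ℕ) {d : ℕ} (lam mu : Nat.Partition d) : ℕ :=
  lam.parts.card + mu.parts.card + 2 * g - 2

/-- The effective non-zigzag covers of type `(g, lam, mu, x)`. -/
def EffectiveNonZigzagCover (g : ℕ) {d : ℕ} (lam mu : Nat.Partition d)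
    (x : Fin (branchCount g lam mu) → ℝ) : Type 1 :=
  {φ : TropicalCover // φ.HasType g lam mu x ∧ φ.IsEffectiveNonZigzag x}

instance effectiveNonZigzagSetoid (g : ℕ) {d : ℕ} (lam mu : Nat.Partition d)
    (x : Fin (branchCount g lam mu) → ℝ) : Setoid (EffectiveNonZigzagCover g lam mu x) where
  r φ ψ := Nonempty (TropicalCover.Iso φ.1 ψ.1)
  iseqv :=
    { refl := fun φ => ⟨⟨Equiv.refl _, Equiv.refl _, fun _ => rfl, fun _ => rfl, fun _ => rfl,
        fun _ => rfl, fun _ => rfl⟩⟩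
      symm := by
        rintro φ ψ ⟨i⟩
        refine ⟨⟨i.onV.symm, i.onE.symm, fun e => ?_, fun e => ?_, fun e => ?_, fun e => ?_,
          fun v => ?_⟩⟩
        · rw [Equiv.eq_symm_apply, ← i.src_eq, Equiv.apply_symm_apply]
        · rw [Equiv.eq_symm_apply, ← i.tgt_eq, Equiv.apply_symm_apply]
        · rw [← i.len_eq, Equiv.apply_symm_apply]
        · rw [← i.weight_eq, Equiv.apply_symm_apply]
        · rw [← i.pos_eq, Equiv.apply_symm_apply]
      trans := by
        rintro φ ψ χ ⟨i⟩ ⟨j⟩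
        exact ⟨⟨i.onV.trans j.onV, i.onE.trans j.onE,
          fun e => by simp [j.src_eq, i.src_eq], fun e => by simp [j.tgt_eq, i.tgt_eq],
          fun e => by simp [j.len_eq, i.len_eq], fun e => by simp [j.weight_eq, i.weight_eq],
          fun v => by simp [j.pos_eq, i.pos_eq]⟩⟩ }

/-- The effective non-zigzag number: twice the number of isomorphism classes of effective
non-zigzag covers of type `(g, lam, mu, x)`. -/
noncomputable def effectiveNonZigzagNumber (g : ℕ) {d : ℕ} (lam mu : Nat.Partition d)
    (x : Fin (branchCount g lam mu) → ℝ) : ℕ :=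
  2 * Nat.card (Quotient (effectiveNonZigzagSetoid g lam mu x))

namespace Nat.Partition

/-- The partition `(lam, 1 ^ m)`. -/
def addOnes {d : ℕ} (lam : Nat.Partition d) (m : ℕ) : Nat.Partition (d + m) where
  parts := lam.parts + Multiset.replicate m 1
  parts_pos := by
    intro i hi
    rcases Multiset.mem_add.1 hi with h | h
    · exact lam.parts_pos h
    · rw [Multiset.eq_of_mem_replicate h]; exact Nat.one_pos
  parts_sum := by simp [lam.parts_sum]

/-- The tail decomposition `lam = (2 e, 2 o, p ^ 2, z)`, where the parts in `e` are even, the parts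
in `o` and `p` are odd, and the parts in `z` are odd and pairwise distinct. -/
structure IsTailDecomposition {d : ℕ} (lam : Nat.Partition d) (e o p z : Multiset ℕ) : Prop where
  eq : lam.parts = e.map (2 * ·) + o.map (2 * ·) + (p + p) + z
  even_e : ∀ k ∈ e, Even k
  odd_o : ∀ k ∈ o, Odd k
  odd_p : ∀ k ∈ p, Odd k
  odd_z : ∀ k ∈ z, Odd k
  nodup_z : z.Nodup

/-- The last component `lam_0` of the tail decomposition of `lam` (see
`IsTailDecomposition.eq_zeroPart`): the odd numbers which occur an odd number of times in `lam`. -/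
def zeroPart {d : ℕ} (lam : Nat.Partition d) : Finset ℕ :=
  lam.parts.toFinset.filter fun k => Odd k ∧ Odd (lam.parts.count k)

theorem IsTailDecomposition.eq_zeroPart {d : ℕ} {lam : Nat.Partition d} {e o p z : Multiset ℕ}
    (h : lam.IsTailDecomposition e o p z) : z = lam.zeroPart.val := by
  have hc : ∀ k, Odd k → lam.parts.count k = 2 * p.count k + z.count k := by
    intro k hk
    have h0 : ∀ s : Multiset ℕ, (s.map (2 * ·)).count k = 0 := by
      intro s
      rw [Multiset.count_eq_zero, Multiset.mem_map]
      rintro ⟨a, -, rfl⟩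
      exact Nat.not_odd_iff_even.2 (even_two_mul a) hk
    rw [h.eq]
    simp only [Multiset.count_add, h0]
    omega
  refine (Multiset.Nodup.ext h.nodup_z lam.zeroPart.nodup).2 fun k => ?_
  rw [Finset.mem_val, zeroPart, Finset.mem_filter, Multiset.mem_toFinset]
  constructor
  · intro hk
    have h1 := Multiset.count_eq_one_of_mem h.nodup_z hk
    have ho := h.odd_z k hk
    refine ⟨by rw [h.eq]; exact Multiset.mem_add.2 (Or.inr hk), ho, ?_⟩
    rw [hc k ho, h1]
    exact odd_two_mul_add_one _
  · rintro ⟨-, ho, hodd⟩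
    rw [hc k ho] at hodd
    by_contra hk
    rw [Multiset.count_eq_zero.2 hk, add_zero] at hodd
    exact Nat.not_odd_iff_even.2 (even_two_mul _) hodd

theorem exists_isTailDecomposition {d : ℕ} (lam : Nat.Partition d) :
    ∃ e o p z, lam.IsTailDecomposition e o p z := by
  suffices H : ∀ s : Multiset ℕ, ∃ e o p z : Multiset ℕ,
      s = e.map (2 * ·) + o.map (2 * ·) + (p + p) + z ∧ (∀ k ∈ e, Even k) ∧ (∀ k ∈ o, Odd k) ∧
        (∀ k ∈ p, Odd k) ∧ (∀ k ∈ z, Odd k) ∧ z.Nodup by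
    obtain ⟨e, o, p, z, h1, h2, h3, h4, h5, h6⟩ := H lam.parts
    exact ⟨e, o, p, z, h1, h2, h3, h4, h5, h6⟩
  intro s
  induction s using Multiset.induction_on with
  | empty => exact ⟨0, 0, 0, 0, by simp⟩
  | cons a s ih =>
    obtain ⟨e, o, p, z, h1, h2, h3, h4, h5, h6⟩ := ih
    rcases Nat.even_or_odd a with ha | ha
    · obtain ⟨b, rfl⟩ := ha.two_dvd
      rcases Nat.even_or_odd b with hb | hb
      · exact ⟨b ::ₘ e, o, p, z, by simp [h1], by simpa [hb] using h2, h3, h4, h5, h6⟩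
      · exact ⟨e, b ::ₘ o, p, z, by simp [h1], h2, by simpa [hb] using h3, h4, h5, h6⟩
    · by_cases hz : a ∈ z
      · obtain ⟨t, rfl⟩ := Multiset.exists_cons_of_mem hz
        refine ⟨e, o, a ::ₘ p, t, by simp [h1], h2, h3, ?_, ?_, (Multiset.nodup_cons.1 h6).2⟩
        · simpa [ha] using h4
        · exact fun k hk => h5 k (Multiset.mem_cons_of_mem hk)
      · exact ⟨e, o, p, a ::ₘ z, by simp [h1], h2, h3, h4, by simpa [ha] using h5,
          Multiset.nodup_cons.2 ⟨hz, h6⟩⟩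

end Nat.Partition

/-! It suffices to exhibit `(K!)^4` pairwise non-isomorphic effective non-zigzag covers with `K ≥
⌊m/2⌋ - m₀`. All of them have the same underlying weighted graph and differ only in the order in
which its inner vertices lie over the branch points.

The graph is a caterpillar: a spine joining a left end of weight 1 to a right end of weight 1, with
a tail attached at every spine vertex. The signed weight of the spine (`catFlow`) is raised by left
tails and lowered by right tails; its sign is the direction in which the spine runs. There are four
blocks. (A) Even left tails make the flow large. (L) Single odd ends, alternately on the right and
on the left, absorb the unpaired odd parts of the partitions. The spine edge after each such right
end is even and serves as connecting piece, so this block cuts the spine into at least two unbent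
strings. (B) Even right tails, `g` of them carrying a symmetric cycle, bring the flow back to 1.
(Zigzag) `K` pairs of forks with ends of weight 1, alternately right and left, make the flow
alternate between 1 and -1.

In the zigzag every second spine vertex is a source of both its spine edges and the others are
sinks. Its vertices therefore fall into four antichains of `K` elements: left fork vertices,
sources, sinks, right fork vertices. Placing these antichains one after the other leaves the order
inside each of them free, whence `(K!)^4` orders. The zigzag has `4K` vertices, at least half of all
branch points, and lies over the last ones; so the connecting pieces lie over the first half.

Different orders give non-isomorphic covers, because an isomorphism must preserve positions: it
fixes the vertices before the zigzag, and then the zigzag vertex by vertex. Finally the set of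
isomorphism classes has to be finite for its `Nat.card` to be bounded below, since `Nat.card`
vanishes on infinite types.

The argument is carried by `finite_quotient_effectiveNonZigzag`, `catGraph_hasType`,
`CatEffective.isEffectiveNonZigzag`, `CatZigzag.key_increasing`, `CatZigzag.eq_of_iso`, and by the
distribution of the ones in `factorial_pow_le_of_tailDecomposition`. -/

set_option linter.unusedSectionVars false

/-! ### Bounds on vertices, edges and weights of a cover of given type -/

namespace TropicalCurve

variable (C : TropicalCurve)

theorem sum_valence : ∑ v, C.valence v = 2 * Fintype.card C.E := by
  simp only [valence, Finset.sum_add_distrib]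
  have h1 := Finset.card_eq_sum_card_fiberwise (f := C.src) (s := Finset.univ) (t := Finset.univ)
    (fun _ _ => Finset.mem_coe.2 (Finset.mem_univ _))
  have h2 := Finset.card_eq_sum_card_fiberwise (f := C.tgt) (s := Finset.univ) (t := Finset.univ)
    (fun _ _ => Finset.mem_coe.2 (Finset.mem_univ _))
  rw [← h1, ← h2, Finset.card_univ, two_mul]

theorem valence_pos_iff (v : C.V) : 0 < C.valence v ↔ ∃ e, C.Touches e v := by
  simp only [valence, Touches]
  rw [Nat.add_pos_iff_pos_or_pos, Finset.card_pos, Finset.card_pos]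
  constructor
  · rintro (⟨e, he⟩ | ⟨e, he⟩)
    · exact ⟨e, Or.inl (Finset.mem_filter.1 he).2⟩
    · exact ⟨e, Or.inr (Finset.mem_filter.1 he).2⟩
  · rintro ⟨e, he | he⟩
    · exact Or.inl ⟨e, by simpa using he⟩
    · exact Or.inr ⟨e, by simpa using he⟩

theorem exists_touches {v w : C.V} (h : v ≠ w) : ∃ e, C.Touches e v := by
  have hp := C.connected.preconnected v w
  obtain ⟨p⟩ := hp
  cases p with
  | nil => exact absurd rfl h
  | cons hadj _ =>
    rw [SimpleGraph.fromRel_adj] at hadj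
    rcases hadj.2 with ⟨e, he, -⟩ | ⟨e, -, he⟩
    · exact ⟨e, Or.inl he⟩
    · exact ⟨e, Or.inr he⟩

end TropicalCurve

namespace TropicalCover

variable (φ : TropicalCover)

theorem exists_touches (v : φ.V) : ∃ e, φ.Touches e v := by
  obtain ⟨a, ha⟩ := φ.exists_bot
  obtain ⟨b, hb⟩ := φ.exists_top
  by_cases h : v = a
  · subst h
    refine φ.toTropicalCurve.exists_touches (w := b) ?_
    rintro rfl
    rw [ha] at hb
    exact bot_ne_top hb
  · exact φ.toTropicalCurve.exists_touches h

theorem three_le_valence {v : φ.V} (hv : ¬ φ.IsLeaf v) : 3 ≤ φ.valence v := by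
  have h0 := (φ.valence_pos_iff v).2 (φ.exists_touches v)
  have h2 : φ.valence v ≠ 2 := φ.valence_ne_two v
  have h1 : φ.valence v ≠ 1 := hv
  omega

open scoped Classical in
theorem card_pos_eq_bot_le :
    (Finset.univ.filter fun v => φ.pos v = ⊥).card ≤ φ.leftWeights.card := by
  rw [leftWeights, Multiset.card_map]
  change _ ≤ (Finset.univ.filter fun e => φ.pos (φ.src e) = ⊥).card
  refine le_trans (Finset.card_le_card ?_) (Finset.card_image_le (f := φ.src))
  intro v hv
  have hv := (Finset.mem_filter.1 hv).2
  obtain ⟨e, he | he⟩ := φ.exists_touches v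
  · exact Finset.mem_image.2 ⟨e, by simpa [he] using hv, he⟩
  · have := φ.pos_lt e
    rw [he, hv] at this
    exact absurd this not_lt_bot

open scoped Classical in
theorem card_pos_eq_top_le :
    (Finset.univ.filter fun v => φ.pos v = ⊤).card ≤ φ.rightWeights.card := by
  rw [rightWeights, Multiset.card_map]
  change _ ≤ (Finset.univ.filter fun e => φ.pos (φ.tgt e) = ⊤).card
  refine le_trans (Finset.card_le_card ?_) (Finset.card_image_le (f := φ.tgt))
  intro v hv
  have hv := (Finset.mem_filter.1 hv).2
  obtain ⟨e, he | he⟩ := φ.exists_touches v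
  · have := φ.pos_lt e
    rw [he, hv] at this
    exact absurd this not_top_lt
  · exact Finset.mem_image.2 ⟨e, by simpa [he] using hv, he⟩

section HasType

variable {φ} {g d : ℕ} {lam mu : Nat.Partition d} {r : ℕ} {x : Fin r → ℝ}

open scoped Classical in
theorem HasType.card_leaves_le (h : φ.HasType g lam mu x) :
    (Finset.univ.filter fun v => φ.IsLeaf v).card ≤ lam.parts.card + mu.parts.card := by
  rw [← h.2.1, ← h.2.2.1]
  refine le_trans ?_ (add_le_add φ.card_pos_eq_bot_le φ.card_pos_eq_top_le)
  refine le_trans (Finset.card_le_card ?_) (Finset.card_union_le _ _)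
  intro v hv
  simpa [φ.isLeaf_iff] using hv

open scoped Classical in
-- The valences add up to `2|E| = 2(|V| + g - 1)`. Leaves contribute 1 each and inner vertices at
-- least 3 each, which leaves room for at most `r` inner vertices.
theorem HasType.card_inner_add_two_le (h : φ.HasType g lam mu x) :
    (Finset.univ.filter fun v => ¬ φ.IsLeaf v).card + 2 ≤
      lam.parts.card + mu.parts.card + 2 * g := by
  have h1 := h.card_leaves_le
  have h2 := φ.sum_valence
  have h3 : Fintype.card φ.E + 1 = Fintype.card φ.V + g := h.1
  have h4 := Finset.card_filter_add_card_filter_not (s := (Finset.univ : Finset φ.V))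
    (p := fun v => φ.IsLeaf v)
  rw [Finset.card_univ] at h4
  have h5 := Finset.sum_filter_add_sum_filter_not (Finset.univ : Finset φ.V)
    (fun v => φ.IsLeaf v) φ.valence
  have h6 : (Finset.univ.filter fun v => φ.IsLeaf v).card =
      ∑ v with φ.IsLeaf v, φ.valence v := by
    rw [Finset.card_eq_sum_ones]
    exact Finset.sum_congr rfl fun v hv => ((Finset.mem_filter.1 hv).2 : φ.valence v = 1).symm
  have h7 : (Finset.univ.filter fun v => ¬ φ.IsLeaf v).card • 3 ≤
      ∑ v with ¬ φ.IsLeaf v, φ.valence v :=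
    Finset.card_nsmul_le_sum _ _ _ fun v hv => φ.three_le_valence (Finset.mem_filter.1 hv).2
  rw [smul_eq_mul] at h7
  omega

theorem HasType.card_V_le (h : φ.HasType g lam mu x) :
    Fintype.card φ.V ≤ 2 * (lam.parts.card + mu.parts.card + 2 * g) := by
  classical
  have h1 := h.card_leaves_le
  have h2 := h.card_inner_add_two_le
  have h4 := Finset.card_filter_add_card_filter_not (s := (Finset.univ : Finset φ.V))
    (p := fun v => φ.IsLeaf v)
  rw [Finset.card_univ] at h4
  omega

theorem HasType.card_E_le (h : φ.HasType g lam mu x) :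
    Fintype.card φ.E ≤ 2 * (lam.parts.card + mu.parts.card + 2 * g) + g := by
  have h1 := h.card_V_le
  have h3 : Fintype.card φ.E + 1 = Fintype.card φ.V + g := h.1
  omega

/-- All inner vertices lie over the branch points. -/
theorem HasType.pos_mem_range {x : Fin (branchCount g lam mu) → ℝ} (hx : Function.Injective x)
    (h : φ.HasType g lam mu x) {v : φ.V} (hv : ¬ φ.IsLeaf v) : ∃ i, φ.pos v = (x i : EReal) := by
  classical
  have h2 := h.card_inner_add_two_le
  choose y hy using h.2.2.2
  have hyl : ∀ i, ¬ φ.IsLeaf (y i) := fun i => by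
    rw [φ.isLeaf_iff, hy]
    simp
  have hyi : Function.Injective y := fun i j hij => hx (EReal.coe_injective (by
    rw [← hy, ← hy, hij]))
  -- The `r` branch points already account for `r` distinct inner vertices, and there are no more
  -- than that.
  have h3 : Finset.univ.image y = Finset.univ.filter fun v => ¬ φ.IsLeaf v := by
    refine Finset.eq_of_subset_of_card_le ?_ ?_
    · intro w hw
      obtain ⟨i, -, rfl⟩ := Finset.mem_image.1 hw
      simpa using hyl i
    · rw [Finset.card_image_of_injective _ hyi, Finset.card_univ, Fintype.card_fin, branchCount]
      omega
  have h4 : v ∈ Finset.univ.image y := by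
    rw [h3]
    simpa using hv
  obtain ⟨i, -, rfl⟩ := Finset.mem_image.1 h4
  exact ⟨i, hy i⟩

/-- The weight of every edge is at most the degree. -/
theorem HasType.weight_le (h : φ.HasType g lam mu x) (e : φ.E) : φ.weight e ≤ d := by
  classical
  have hd : ∑ e with φ.pos (φ.src e) = ⊥, φ.weight e = d := by
    rw [← lam.parts_sum, ← h.2.1]
    rfl
  by_cases he : φ.pos (φ.src e) = ⊥
  · rw [← hd]
    exact Finset.single_le_sum (fun _ _ => Nat.zero_le _) (Finset.mem_filter.2 ⟨Finset.mem_univ _, he⟩)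
  set p := φ.pos (φ.src e) with hp
  have hpt : p < ⊤ := lt_of_lt_of_le (φ.pos_lt e) le_top
  -- A cut argument: `A` consists of the inner vertices up to the position where `e` starts. In the
  -- balancing condition summed over `A` the edges inside `A` cancel; what enters comes from `-∞`
  -- and weighs at most `d`, while `e` leaves `A`.
  let A : Finset φ.V := Finset.univ.filter fun v => φ.pos v ≤ p ∧ φ.pos v ≠ ⊥
  have hAl : ∀ v ∈ A, ¬ φ.IsLeaf v := by
    intro v hv
    rw [φ.isLeaf_iff]
    have hv := (Finset.mem_filter.1 hv).2
    rintro (h0 | h0)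
    · exact hv.2 h0
    · exact absurd (h0 ▸ hv.1) (not_le.2 hpt)
  have hbal : ∑ f with φ.tgt f ∈ A, φ.weight f = ∑ f with φ.src f ∈ A, φ.weight f := by
    rw [← Finset.sum_fiberwise_of_maps_to (s := Finset.univ.filter fun f => φ.tgt f ∈ A) (t := A)
      (g := φ.tgt) (fun f hf => (Finset.mem_filter.1 hf).2),
      ← Finset.sum_fiberwise_of_maps_to (s := Finset.univ.filter fun f => φ.src f ∈ A) (t := A)
      (g := φ.src) (fun f hf => (Finset.mem_filter.1 hf).2)]
    refine Finset.sum_congr rfl fun v hv => ?_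
    have := φ.balanced v (hAl v hv)
    rw [Finset.filter_filter, Finset.filter_filter]
    convert this using 3 with f f
    · constructor
      · exact fun h => h.2
      · exact fun h => ⟨h ▸ hv, h⟩
    · constructor
      · exact fun h => h.2
      · exact fun h => ⟨h ▸ hv, h⟩
  have hin : ∑ f with φ.tgt f ∈ A, φ.weight f ≤
      ∑ f with φ.src f ∈ A ∧ φ.tgt f ∈ A, φ.weight f + d := by
    rw [← hd]
    refine le_trans ?_ (Finset.sum_union_inter (s₁ := Finset.univ.filter fun f => φ.src f ∈ A ∧ φ.tgt f ∈ A)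
      (s₂ := Finset.univ.filter fun f => φ.pos (φ.src f) = ⊥) (f := φ.weight)).le
    refine le_trans (Finset.sum_le_sum_of_subset ?_) (Nat.le_add_right _ _)
    intro f hf
    have hf := (Finset.mem_filter.1 hf).2
    have hf' := (Finset.mem_filter.1 hf).2
    by_cases h0 : φ.pos (φ.src f) = ⊥
    · exact Finset.mem_union_right _ (by simpa using h0)
    · refine Finset.mem_union_left _ (Finset.mem_filter.2 ⟨Finset.mem_univ _, ?_, hf⟩)
      exact Finset.mem_filter.2 ⟨Finset.mem_univ _, (φ.pos_lt f).le.trans hf'.1, h0⟩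
  have hout : ∑ f with φ.src f ∈ A ∧ φ.tgt f ∈ A, φ.weight f + φ.weight e ≤
      ∑ f with φ.src f ∈ A, φ.weight f := by
    have he1 : e ∉ Finset.univ.filter fun f => φ.src f ∈ A ∧ φ.tgt f ∈ A := by
      intro h0
      have h0 := (Finset.mem_filter.1 (Finset.mem_filter.1 h0).2.2).2.1
      exact absurd (φ.pos_lt e) (not_lt.2 h0)
    rw [add_comm, ← Finset.sum_insert he1]
    refine Finset.sum_le_sum_of_subset ?_
    intro f hf
    rcases Finset.mem_insert.1 hf with rfl | hf
    · exact Finset.mem_filter.2 ⟨Finset.mem_univ _, Finset.mem_filter.2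
        ⟨Finset.mem_univ _, le_rfl, he⟩⟩
    · exact Finset.mem_filter.2 ⟨Finset.mem_univ _, (Finset.mem_filter.1 hf).2.1⟩
  omega

end HasType

/-- The lengths of the edges are determined by the other data. -/
theorem len_eq_ite (e : φ.E) [Decidable (φ.IsEnd e)] : φ.len e = if φ.IsEnd e then ⊤ else
    ENNReal.ofReal (((φ.pos (φ.tgt e)).toReal - (φ.pos (φ.src e)).toReal) / φ.weight e) := by
  have key : φ.len e = ⊤ ↔ φ.IsEnd e := by
    rw [φ.len_eq_top_iff e]
    constructor
    · rintro ⟨v, rfl | rfl, h⟩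
      · exact Or.inl h
      · exact Or.inr h
    · rintro (h | h)
      · exact ⟨_, Or.inl rfl, h⟩
      · exact ⟨_, Or.inr rfl, h⟩
  split_ifs with h
  · exact key.2 h
  · have hw : (φ.weight e : ℝ) ≠ 0 := Nat.cast_ne_zero.2 (φ.weight_pos e).ne'
    rw [φ.slope e h, mul_div_cancel_left₀ _ hw, ENNReal.ofReal_toReal]
    exact fun h0 => h (key.1 h0)

/-- An isomorphism of the weighted graphs over the line is an isomorphism of covers. -/
theorem nonempty_iso {φ ψ : TropicalCover} (a : φ.V ≃ ψ.V) (b : φ.E ≃ ψ.E)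
    (hs : ∀ e, ψ.src (b e) = a (φ.src e)) (ht : ∀ e, ψ.tgt (b e) = a (φ.tgt e))
    (hw : ∀ e, ψ.weight (b e) = φ.weight e) (hp : ∀ v, ψ.pos (a v) = φ.pos v) :
    Nonempty (TropicalCover.Iso φ ψ) := by
  classical
  refine ⟨⟨a, b, hs, ht, fun e => ?_, hw, hp⟩⟩
  have hl : ∀ v, ψ.IsLeaf (a v) ↔ φ.IsLeaf v := fun v => by
    rw [ψ.isLeaf_iff, φ.isLeaf_iff, hp]
  have he : ψ.IsEnd (b e) ↔ φ.IsEnd e := by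
    simp only [TropicalCurve.IsEnd, hs, ht, hl]
  rw [len_eq_ite, len_eq_ite, hs, ht, hw, hp, hp]
  simp only [he]

end TropicalCover

/-! ### Finiteness of the set of isomorphism classes -/

section Finiteness

variable {g d : ℕ} {lam mu : Nat.Partition d} {x : Fin (branchCount g lam mu) → ℝ}

/-- A class is determined by finite combinatorial data: sizes are bounded, weights are at most `d`,
positions lie in a finite set, and lengths are forced by positions and weights. -/
theorem finite_quotient_effectiveNonZigzag (hx : Function.Injective x) :
    Finite (Quotient (effectiveNonZigzagSetoid g lam mu x)) := by
  classical
  let Q := Quotient (effectiveNonZigzagSetoid g lam mu x)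
  let N := 2 * (lam.parts.card + mu.parts.card + 2 * g) + g + 1
  let T : Set EReal := {⊥, ⊤} ∪ Set.range fun i => (x i : EReal)
  have hT : T.Finite := ((Set.finite_singleton _).insert _).union (Set.finite_range _)
  have : Finite T := hT
  let φ : Q → TropicalCover := fun q => q.out.1
  have hφ : ∀ q, (φ q).HasType g lam mu x := fun q => q.out.2.1
  have hpT : ∀ q v, (φ q).pos v ∈ T := by
    intro q v
    by_cases hv : (φ q).IsLeaf v
    · rcases ((φ q).isLeaf_iff v).1 hv with h | h
      · exact Or.inl (Or.inl h)
      · exact Or.inl (Or.inr h)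
    · obtain ⟨i, hi⟩ := (hφ q).pos_mem_range hx hv
      exact Or.inr ⟨i, hi.symm⟩
  have hmain : ∀ a b : ℕ, {q : Q | Fintype.card (φ q).V = a ∧ Fintype.card (φ q).E = b}.Finite := by
    intro a b
    let F := (Fin b → Fin a) × (Fin b → Fin a) × (Fin b → Fin (d + 1)) × (Fin a → T)
    -- Vertices and edges of a representative are numbered, so that a cover becomes an element of
    -- the finite type `F`. The value `none` is only a default for classes of other sizes. Equal
    -- codes yield an isomorphism by composing the two numberings.
    refine Set.Finite.of_injOn (f := fun q : Q =>
      if h : Fintype.card (φ q).V = a ∧ Fintype.card (φ q).E = b then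
        some ((fun e => Fintype.equivFinOfCardEq h.1 ((φ q).src ((Fintype.equivFinOfCardEq h.2).symm e)),
          fun e => Fintype.equivFinOfCardEq h.1 ((φ q).tgt ((Fintype.equivFinOfCardEq h.2).symm e)),
          fun e => ⟨(φ q).weight ((Fintype.equivFinOfCardEq h.2).symm e),
            Nat.lt_succ_of_le ((hφ q).weight_le _)⟩,
          fun v => ⟨(φ q).pos ((Fintype.equivFinOfCardEq h.1).symm v), hpT q _⟩) : F)
      else none) (t := Set.univ) (fun _ _ => Set.mem_univ _) ?_ Set.finite_univ
    intro q hq q' hq' h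
    simp only [Set.mem_ofPred_eq] at hq hq'
    simp only [dif_pos hq, dif_pos hq', Option.some.injEq, Prod.mk.injEq] at h
    obtain ⟨h1, h2, h3, h4⟩ := h
    rw [← Quotient.out_eq q, ← Quotient.out_eq q']
    refine Quotient.sound ?_
    refine TropicalCover.nonempty_iso
      ((Fintype.equivFinOfCardEq hq.1).trans (Fintype.equivFinOfCardEq hq'.1).symm)
      ((Fintype.equivFinOfCardEq hq.2).trans (Fintype.equivFinOfCardEq hq'.2).symm) ?_ ?_ ?_ ?_
    · intro e
      have := congrFun h1 (Fintype.equivFinOfCardEq hq.2 e)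
      simp only [Equiv.symm_apply_apply] at this
      rw [Equiv.trans_apply, Equiv.trans_apply, Equiv.eq_symm_apply]
      exact this.symm
    · intro e
      have := congrFun h2 (Fintype.equivFinOfCardEq hq.2 e)
      simp only [Equiv.symm_apply_apply] at this
      rw [Equiv.trans_apply, Equiv.trans_apply, Equiv.eq_symm_apply]
      exact this.symm
    · intro e
      have := congrFun h3 (Fintype.equivFinOfCardEq hq.2 e)
      simp only [Equiv.symm_apply_apply, Fin.mk.injEq] at this
      exact this.symm
    · intro v
      have := congrFun h4 (Fintype.equivFinOfCardEq hq.1 v)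
      simp only [Equiv.symm_apply_apply, Subtype.mk.injEq] at this
      exact this.symm
  rw [← Set.finite_univ_iff]
  refine Set.Finite.subset (Set.Finite.biUnion (Set.finite_Iio N)
    fun a _ => Set.Finite.biUnion (Set.finite_Iio N) fun b _ => hmain a b) ?_
  intro q _
  have h1 := (hφ q).card_V_le
  have h2 := (hφ q).card_E_le
  simp only [Set.mem_iUnion, Set.mem_Iio]
  exact ⟨_, by omega, _, by omega, rfl, rfl⟩

end Finiteness

/-! ### Covers obtained by closing the open ends of a trivalent graph -/

/-- A weighted directed graph with vertex set `V` some of whose edges are half-open: `src e = none`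
means that `e` comes in from `-∞`, and `tgt e = none` means that `e` goes out to `+∞`. -/
structure OpenGraph (V E : Type) where
  src : E → Option V
  tgt : E → Option V
  weight : E → ℕ

namespace OpenGraph

variable {V E : Type} (G : OpenGraph V E)

def Touches (e : E) (v : V) : Prop := G.src e = some v ∨ G.tgt e = some v

instance [DecidableEq V] (e : E) (v : V) : Decidable (G.Touches e v) :=
  inferInstanceAs (Decidable (_ ∨ _))

/-- A connected trivalent balanced graph, in which no edge is open at both sides. -/
structure IsAdmissible [Fintype E] [DecidableEq V] : Prop where
  tgt_ne_none : ∀ e, G.src e = none → G.tgt e ≠ none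
  weight_pos : ∀ e, 0 < G.weight e
  loopless : ∀ e v, G.src e = some v → G.tgt e ≠ some v
  trivalent : ∀ v, (Finset.univ.filter fun e => G.Touches e v).card = 3
  balanced : ∀ v, ∑ e with G.tgt e = some v, G.weight e = ∑ e with G.src e = some v, G.weight e
  connected : ∃ v₀, ∀ v, Relation.ReflTransGen (fun a b => ∃ e, G.Touches e a ∧ G.Touches e b) v₀ v
  exists_bot : ∃ e, G.src e = none
  exists_top : ∃ e, G.tgt e = none

/-- A position function which increases along the edges. -/
def IsIncreasing (p : V → ℝ) : Prop :=
  ∀ e v w, G.src e = some v → G.tgt e = some w → p v < p w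

/-- The leaves that close the open ends. -/
abbrev Leaf : Type := {e : E // G.src e = none ∨ G.tgt e = none}

def srcV (e : E) : V ⊕ G.Leaf :=
  if h : G.src e = none then Sum.inr ⟨e, Or.inl h⟩ else
    Sum.inl ((G.src e).get (Option.isSome_iff_ne_none.2 h))

def tgtV (e : E) : V ⊕ G.Leaf :=
  if h : G.tgt e = none then Sum.inr ⟨e, Or.inr h⟩ else
    Sum.inl ((G.tgt e).get (Option.isSome_iff_ne_none.2 h))

@[simp]
theorem srcV_eq_inl {e : E} {v : V} : G.srcV e = Sum.inl v ↔ G.src e = some v := by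
  unfold srcV
  split_ifs with h
  · simp [h]
  · rw [Sum.inl.injEq, Option.eq_some_iff_get_eq]
    simp [Option.isSome_iff_ne_none, h]

@[simp]
theorem tgtV_eq_inl {e : E} {v : V} : G.tgtV e = Sum.inl v ↔ G.tgt e = some v := by
  unfold tgtV
  split_ifs with h
  · simp [h]
  · rw [Sum.inl.injEq, Option.eq_some_iff_get_eq]
    simp [Option.isSome_iff_ne_none, h]

@[simp]
theorem srcV_eq_inr {e : E} {l : G.Leaf} : G.srcV e = Sum.inr l ↔ G.src e = none ∧ e = l.1 := by
  unfold srcV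
  split_ifs with h
  · simp [h, Subtype.ext_iff]
  · simp [h]

@[simp]
theorem tgtV_eq_inr {e : E} {l : G.Leaf} : G.tgtV e = Sum.inr l ↔ G.tgt e = none ∧ e = l.1 := by
  unfold tgtV
  split_ifs with h
  · simp [h, Subtype.ext_iff]
  · simp [h]

/-- No edge of an admissible graph is open at both sides, so a leaf whose edge does have a source
belongs over `+∞`. -/
noncomputable def posV (p : V → ℝ) : V ⊕ G.Leaf → EReal
  | .inl v => (p v : EReal)
  | .inr l => if G.src l.1 = none then ⊥ else ⊤

@[simp]
theorem posV_inl (p : V → ℝ) (v : V) : G.posV p (Sum.inl v) = (p v : EReal) := rfl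

variable [Fintype V] [Fintype E] [DecidableEq V] [DecidableEq E]

instance : DecidablePred fun e => G.src e = none ∨ G.tgt e = none :=
  fun _ => inferInstanceAs (Decidable (_ ∨ _))

variable {G}

theorem IsAdmissible.valence_inl (h : G.IsAdmissible) (v : V) :
    (Finset.univ.filter fun e => G.srcV e = Sum.inl v).card +
      (Finset.univ.filter fun e => G.tgtV e = Sum.inl v).card = 3 := by
  simp only [srcV_eq_inl, tgtV_eq_inl]
  rw [← h.trivalent v, ← Finset.card_union_of_disjoint, ← Finset.filter_or]
  · rfl
  · rw [Finset.disjoint_filter]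
    exact fun e _ => h.loopless e v

theorem IsAdmissible.valence_inr (h : G.IsAdmissible) (l : G.Leaf) :
    (Finset.univ.filter fun e => G.srcV e = Sum.inr l).card +
      (Finset.univ.filter fun e => G.tgtV e = Sum.inr l).card = 1 := by
  simp only [srcV_eq_inr, tgtV_eq_inr]
  rw [← Finset.card_union_of_disjoint, ← Finset.filter_or, Finset.card_eq_one]
  · refine ⟨l.1, ?_⟩
    ext e
    simp only [Finset.mem_filter, Finset.mem_univ, true_and, Finset.mem_singleton]
    constructor
    · rintro (h | h)
      · exact h.2
      · exact h.2
    · rintro rfl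
      rcases l.2 with h | h
      · exact Or.inl ⟨h, rfl⟩
      · exact Or.inr ⟨h, rfl⟩
  · rw [Finset.disjoint_filter]
    exact fun e _ h1 h2 => h.tgt_ne_none e h1.1 h2.1

theorem IsAdmissible.src_ne_none (h : G.IsAdmissible) (e : E) (he : G.tgt e = none) :
    G.src e ≠ none := fun h' => h.tgt_ne_none e h' he

theorem exists_srcV_or (e : E) :
    ((∃ v, G.src e = some v ∧ G.srcV e = Sum.inl v) ∨
      ∃ h : G.src e = none, G.srcV e = Sum.inr ⟨e, Or.inl h⟩) := by
  by_cases h : G.src e = none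
  · exact Or.inr ⟨h, G.srcV_eq_inr.2 ⟨h, rfl⟩⟩
  · obtain ⟨v, hv⟩ := Option.ne_none_iff_exists'.1 h
    exact Or.inl ⟨v, hv, G.srcV_eq_inl.2 hv⟩

theorem exists_tgtV_or (e : E) :
    ((∃ v, G.tgt e = some v ∧ G.tgtV e = Sum.inl v) ∨
      ∃ h : G.tgt e = none, G.tgtV e = Sum.inr ⟨e, Or.inr h⟩) := by
  by_cases h : G.tgt e = none
  · exact Or.inr ⟨h, G.tgtV_eq_inr.2 ⟨h, rfl⟩⟩
  · obtain ⟨v, hv⟩ := Option.ne_none_iff_exists'.1 h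
    exact Or.inl ⟨v, hv, G.tgtV_eq_inl.2 hv⟩

theorem IsAdmissible.connected_closure (h : G.IsAdmissible) :
    (SimpleGraph.fromRel (fun v w => ∃ e, G.srcV e = v ∧ G.tgtV e = w)).Connected := by
  obtain ⟨v₀, hv₀⟩ := h.connected
  rw [SimpleGraph.connected_iff_exists_forall_reachable]
  have hedge : ∀ e, (SimpleGraph.fromRel (fun v w => ∃ e, G.srcV e = v ∧ G.tgtV e = w)).Reachable
      (G.srcV e) (G.tgtV e) := by
    intro e
    by_cases he : G.srcV e = G.tgtV e
    · rw [he]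
    · exact SimpleGraph.Adj.reachable (by
        rw [SimpleGraph.fromRel_adj]
        exact ⟨he, Or.inl ⟨e, rfl, rfl⟩⟩)
  have hv : ∀ v, (SimpleGraph.fromRel (fun v w => ∃ e, G.srcV e = v ∧ G.tgtV e = w)).Reachable
      (Sum.inl v₀) (Sum.inl v) := by
    intro v
    induction hv₀ v with
    | refl => exact SimpleGraph.Reachable.refl _
    | tail _ hab ih =>
      obtain ⟨e, ha, hb⟩ := hab
      refine ih.trans ?_
      have h0 := hedge e
      rcases ha with ha | ha <;> rcases hb with hb | hb
      · rw [ha] at hb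
        rw [Option.some.inj hb]
      · rwa [G.srcV_eq_inl.2 ha, G.tgtV_eq_inl.2 hb] at h0
      · rw [G.tgtV_eq_inl.2 ha, G.srcV_eq_inl.2 hb] at h0
        exact h0.symm
      · rw [ha] at hb
        rw [Option.some.inj hb]
  refine ⟨Sum.inl v₀, ?_⟩
  rintro (v | l)
  · exact hv v
  · have h0 := hedge l.1
    rcases l.2 with hl | hl
    · obtain ⟨w, hw⟩ := Option.ne_none_iff_exists'.1 (h.tgt_ne_none _ hl)
      rw [G.srcV_eq_inr.2 ⟨hl, rfl⟩, G.tgtV_eq_inl.2 hw] at h0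
      exact (hv w).trans h0.symm
    · obtain ⟨w, hw⟩ := Option.ne_none_iff_exists'.1 (h.src_ne_none _ hl)
      rw [G.tgtV_eq_inr.2 ⟨hl, rfl⟩, G.srcV_eq_inl.2 hw] at h0
      exact (hv w).trans h0

/-- The length of an edge. -/
noncomputable def length (G : OpenGraph V E) (p : V → ℝ) (e : E) : ENNReal :=
  if G.src e = none ∨ G.tgt e = none then ⊤ else
    ENNReal.ofReal (((G.posV p (G.tgtV e)).toReal - (G.posV p (G.srcV e)).toReal) / G.weight e)

theorem IsIncreasing.exists_of_inner {p : V → ℝ} (hp : G.IsIncreasing p) {e : E}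
    (he : ¬ (G.src e = none ∨ G.tgt e = none)) : ∃ v w, G.srcV e = Sum.inl v ∧
      G.tgtV e = Sum.inl w ∧ p v < p w := by
  push Not at he
  obtain ⟨v, hv⟩ := Option.ne_none_iff_exists'.1 he.1
  obtain ⟨w, hw⟩ := Option.ne_none_iff_exists'.1 he.2
  exact ⟨v, w, G.srcV_eq_inl.2 hv, G.tgtV_eq_inl.2 hw, hp e v w hv hw⟩

theorem IsAdmissible.exists_leaf_iff (h : G.IsAdmissible) (e : E) :
    (∃ v, (v = G.srcV e ∨ v = G.tgtV e) ∧ (Finset.univ.filter fun e => G.srcV e = v).card +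
      (Finset.univ.filter fun e => G.tgtV e = v).card = 1) ↔ G.src e = none ∨ G.tgt e = none := by
  constructor
  · rintro ⟨v | l, h1, h2⟩
    · rw [h.valence_inl] at h2
      omega
    · rcases h1 with h1 | h1
      · exact Or.inl (G.srcV_eq_inr.1 h1.symm).1
      · exact Or.inr (G.tgtV_eq_inr.1 h1.symm).1
  · intro h1
    refine ⟨Sum.inr ⟨e, h1⟩, ?_, h.valence_inr _⟩
    rcases h1 with h1 | h1
    · exact Or.inl (G.srcV_eq_inr.2 ⟨h1, rfl⟩).symm
    · exact Or.inr (G.tgtV_eq_inr.2 ⟨h1, rfl⟩).symm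

/-- The tropical curve obtained by closing the open ends. -/
noncomputable def toCurve (h : G.IsAdmissible) {p : V → ℝ} (hp : G.IsIncreasing p) :
    TropicalCurve where
  V := V ⊕ G.Leaf
  E := E
  src := G.srcV
  tgt := G.tgtV
  len := G.length p
  connected := h.connected_closure
  valence_ne_two := by
    rintro (v | l)
    · rw [h.valence_inl]
      decide
    · rw [h.valence_inr]
      decide
  len_pos := by
    intro e
    unfold length
    split_ifs with he
    · exact ENNReal.zero_lt_top
    · obtain ⟨v, w, hv, hw, hlt⟩ := hp.exists_of_inner he
      rw [hv, hw, ENNReal.ofReal_pos]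
      have := h.weight_pos e
      simp only [posV_inl, EReal.toReal_coe]
      exact div_pos (sub_pos.2 hlt) (Nat.cast_pos.2 this)
  len_eq_top_iff := by
    intro e
    rw [h.exists_leaf_iff]
    unfold length
    split_ifs with he <;> simp [he]

theorem toCurve_not_isLeaf (h : G.IsAdmissible) {p : V → ℝ} (hp : G.IsIncreasing p) (v : V) :
    ¬ (toCurve h hp).IsLeaf (Sum.inl v) := by
  have h1 := h.valence_inl v
  intro h2
  change (Finset.univ.filter fun e => G.srcV e = Sum.inl v).card +
      (Finset.univ.filter fun e => G.tgtV e = Sum.inl v).card = 1 at h2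
  omega

theorem toCurve_isLeaf (h : G.IsAdmissible) {p : V → ℝ} (hp : G.IsIncreasing p) (l : G.Leaf) :
    (toCurve h hp).IsLeaf (Sum.inr l) :=
  h.valence_inr l

theorem toCurve_isEnd_iff (h : G.IsAdmissible) {p : V → ℝ} (hp : G.IsIncreasing p) (e : E) :
    (toCurve h hp).IsEnd e ↔ G.src e = none ∨ G.tgt e = none := by
  rw [← h.exists_leaf_iff]
  constructor
  · rintro (h1 | h1)
    · exact ⟨_, Or.inl rfl, h1⟩
    · exact ⟨_, Or.inr rfl, h1⟩
  · rintro ⟨v, rfl | rfl, h1⟩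
    · exact Or.inl h1
    · exact Or.inr h1

/-- The tropical cover obtained by closing the open ends. -/
noncomputable def toCover (h : G.IsAdmissible) {p : V → ℝ} (hp : G.IsIncreasing p) :
    TropicalCover where
  toTropicalCurve := toCurve h hp
  pos := G.posV p
  weight := G.weight
  isLeaf_iff := by
    rintro (v | l)
    · simp [toCurve_not_isLeaf h hp v]
    · simp only [toCurve_isLeaf h hp l, posV, true_iff]
      split_ifs <;> simp
  exists_bot := by
    obtain ⟨e, he⟩ := h.exists_bot
    exact ⟨Sum.inr ⟨e, Or.inl he⟩, by simp [posV, he]⟩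
  exists_top := by
    obtain ⟨e, he⟩ := h.exists_top
    exact ⟨Sum.inr ⟨e, Or.inr he⟩, by simp [posV, h.src_ne_none e he]⟩
  weight_pos := h.weight_pos
  pos_lt := by
    intro e
    change G.posV p (G.srcV e) < G.posV p (G.tgtV e)
    by_cases he : G.src e = none ∨ G.tgt e = none
    · rcases he with he | he
      · obtain ⟨w, hw⟩ := Option.ne_none_iff_exists'.1 (h.tgt_ne_none _ he)
        rw [G.tgtV_eq_inl.2 hw, G.srcV_eq_inr (l := ⟨e, Or.inl he⟩) |>.2 ⟨he, rfl⟩]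
        simp [posV, he, EReal.bot_lt_coe]
      · have he' := h.src_ne_none _ he
        obtain ⟨w, hw⟩ := Option.ne_none_iff_exists'.1 he'
        rw [G.srcV_eq_inl.2 hw, G.tgtV_eq_inr (l := ⟨e, Or.inr he⟩) |>.2 ⟨he, rfl⟩]
        simp [posV, he', EReal.coe_lt_top]
    · obtain ⟨v, w, hv, hw, hlt⟩ := hp.exists_of_inner he
      rw [hv, hw]
      exact EReal.coe_lt_coe_iff.2 hlt
  slope := by
    intro e he
    have he := mt (toCurve_isEnd_iff h hp e).2 he
    obtain ⟨v, w, hv, hw, hlt⟩ := hp.exists_of_inner he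
    have hwt : (0 : ℝ) < G.weight e := Nat.cast_pos.2 (h.weight_pos e)
    change (G.posV p (G.tgtV e)).toReal - (G.posV p (G.srcV e)).toReal =
      G.weight e * (G.length p e).toReal
    have hl : G.length p e = ENNReal.ofReal
        (((G.posV p (G.tgtV e)).toReal - (G.posV p (G.srcV e)).toReal) / G.weight e) := if_neg he
    rw [hl, hv, hw]
    simp only [posV_inl, EReal.toReal_coe]
    rw [ENNReal.toReal_ofReal (div_pos (sub_pos.2 hlt) hwt).le, mul_div_cancel₀ _ hwt.ne']
  balanced := by
    rintro (v | l) hv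
    · change ∑ e with G.tgtV e = Sum.inl v, G.weight e = ∑ e with G.srcV e = Sum.inl v, G.weight e
      simp only [srcV_eq_inl, tgtV_eq_inl]
      exact h.balanced v
    · exact absurd (toCurve_isLeaf h hp l) hv

section toCover

variable (h : G.IsAdmissible) {p : V → ℝ} (hp : G.IsIncreasing p)

theorem toCover_leftWeights : (toCover h hp).leftWeights =
    (Finset.univ.filter fun e => G.src e = none).val.map G.weight := by
  classical
  unfold TropicalCover.leftWeights
  change (Finset.univ.filter fun e => G.posV p (G.srcV e) = ⊥).val.map G.weight = _
  congr 2
  ext e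
  simp only [Finset.mem_filter, Finset.mem_univ, true_and]
  rcases exists_srcV_or (G := G) e with ⟨v, h1, h2⟩ | ⟨h1, h2⟩
  · rw [h2, h1]
    simp
  · rw [h2]
    simp [posV, h1]

theorem toCover_rightWeights : (toCover h hp).rightWeights =
    (Finset.univ.filter fun e => G.tgt e = none).val.map G.weight := by
  classical
  unfold TropicalCover.rightWeights
  change (Finset.univ.filter fun e => G.posV p (G.tgtV e) = ⊤).val.map G.weight = _
  congr 2
  ext e
  simp only [Finset.mem_filter, Finset.mem_univ, true_and]
  rcases exists_tgtV_or (G := G) e with ⟨v, h1, h2⟩ | ⟨h1, h2⟩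
  · rw [h2, h1]
    simp
  · rw [h2]
    simp [posV, h1, h.src_ne_none e h1]

theorem IsAdmissible.card_leaf (h : G.IsAdmissible) : Fintype.card G.Leaf =
    (Finset.univ.filter fun e => G.src e = none).card +
      (Finset.univ.filter fun e => G.tgt e = none).card := by
  rw [Fintype.card_subtype, Finset.filter_or, Finset.card_union_of_disjoint]
  rw [Finset.disjoint_filter]
  exact fun e _ => h.tgt_ne_none e

end toCover

end OpenGraph

/-- This allows the balancing condition to be checked with signed integers on an explicit list
containing the edges at `v`, without knowing in advance which of them come in and which go out. -/
theorem OpenGraph.balanced_of_sum_eq_zero {V E : Type} [Fintype E] [DecidableEq V]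
    (G : OpenGraph V E) {v : V} (T : Finset E) (hT : ∀ e, G.Touches e v → e ∈ T)
    (h : ∑ e ∈ T, ((if G.tgt e = some v then (G.weight e : ℤ) else 0) -
      (if G.src e = some v then (G.weight e : ℤ) else 0)) = 0) :
    ∑ e with G.tgt e = some v, G.weight e = ∑ e with G.src e = some v, G.weight e := by
  have h1 : ∑ e, ((if G.tgt e = some v then (G.weight e : ℤ) else 0) -
      (if G.src e = some v then (G.weight e : ℤ) else 0)) = 0 := by
    refine Eq.trans ?_ h
    refine (Finset.sum_subset (Finset.subset_univ T) fun e _ he => ?_).symm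
    rw [if_neg fun h0 => he (hT e (Or.inr h0)), if_neg fun h0 => he (hT e (Or.inl h0)), sub_zero]
  rw [Finset.sum_sub_distrib, ← Finset.sum_filter, ← Finset.sum_filter, sub_eq_zero] at h1
  exact_mod_cast h1

/-! ### Tails -/

/-- The shapes of the subgraphs attached to the spine of a caterpillar: a single end, a fork, or a
cycle followed by a fork. -/
inductive TailKind
  | single
  | fork
  | cyc

namespace TailKind

def numE : TailKind → ℕ
  | single => 1
  | fork => 3
  | cyc => 6

def numV : TailKind → ℕ
  | single => 0
  | fork => 1
  | cyc => 3

/-- The endpoint closer to the spine; `none` stands for the point of attachment. -/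
def near : (k : TailKind) → Fin k.numE → Option (Fin k.numV)
  | single => ![none]
  | fork => ![none, some (0 : Fin 1), some (0 : Fin 1)]
  | cyc => ![none, some (0 : Fin 3), some (0 : Fin 3), some (1 : Fin 3), some (2 : Fin 3),
      some (2 : Fin 3)]

/-- The endpoint away from the spine; `none` stands for a leaf. -/
def far : (k : TailKind) → Fin k.numE → Option (Fin k.numV)
  | single => ![none]
  | fork => ![some (0 : Fin 1), none, none]
  | cyc => ![some (0 : Fin 3), some (1 : Fin 3), some (1 : Fin 3), some (2 : Fin 3), none, none]

/-- The weight of an edge as a multiple of the weight of the ends. -/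
def mult : (k : TailKind) → Fin k.numE → ℕ
  | single => ![1]
  | fork => ![2, 1, 1]
  | cyc => ![2, 1, 1, 2, 1, 1]

def stem : (k : TailKind) → Fin k.numE
  | single => (0 : Fin 1)
  | fork => (0 : Fin 3)
  | cyc => (0 : Fin 6)

theorem near_eq_none_iff (k : TailKind) : ∀ e, k.near e = none ↔ e = k.stem := by
  cases k <;> decide

theorem mult_pos (k : TailKind) : ∀ e, 0 < k.mult e := by
  cases k <;> decide

/-- The vertices of a tail are numbered so that the numbers grow away from the spine. This excludes
loops and lets positions be chosen by number. -/
theorem near_lt_far (k : TailKind) :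
    ∀ e v w, k.near e = some v → k.far e = some w → v < w := by
  cases k <;> decide

theorem card_incident (k : TailKind) :
    ∀ v, (Finset.univ.filter fun e => k.near e = some v ∨ k.far e = some v).card = 3 := by
  cases k <;> decide

theorem balanced (k : TailKind) :
    ∀ v, ∑ e with k.far e = some v, k.mult e = ∑ e with k.near e = some v, k.mult e := by
  cases k <;> decide

theorem exists_far_eq (k : TailKind) :
    ∀ v, ∃ e, k.far e = some v ∧ ∀ w, k.near e = some w → w < v := by
  cases k <;> decide

end TailKind

/-- A tail on the right (`out`) or on the left; `size` is the weight of its ends. -/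
structure TailOp where
  out : Bool
  kind : TailKind
  size : ℕ

namespace TailOp

/-- The weight of the edge by which the tail is attached. -/
def wt (o : TailOp) : ℕ := o.size * o.kind.mult o.kind.stem

/-- The change of the spine's flow at the point of attachment: a right tail carries weight away, a
left tail supplies it. -/
def sgn (o : TailOp) : ℤ := if o.out then -(o.wt : ℤ) else o.wt

def ends (o : TailOp) : Multiset ℕ :=
  match o.kind with
  | .single => {o.size}
  | _ => {o.size, o.size}

def leftEnds (o : TailOp) : Multiset ℕ := if o.out then 0 else o.ends

def rightEnds (o : TailOp) : Multiset ℕ := if o.out then o.ends else 0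

def numCyc (o : TailOp) : ℕ :=
  match o.kind with
  | .cyc => 1
  | _ => 0

theorem ends_eq (o : TailOp) :
    ∑ e, (if o.kind.far e = none then {o.size * o.kind.mult e} else 0 : Multiset ℕ) = o.ends := by
  obtain ⟨b, k, u⟩ := o
  cases k
  · change ∑ e : Fin 1, _ = _
    simp [ends, TailKind.far, TailKind.mult]
  · change ∑ e : Fin 3, _ = _
    simp [ends, TailKind.far, TailKind.mult, Fin.sum_univ_succ]
  · change ∑ e : Fin 6, _ = _
    simp [ends, TailKind.far, TailKind.mult, Fin.sum_univ_succ]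

/-- Euler characteristic: together with its point of attachment and its leaves, a tail is a
connected graph with `numCyc` independent cycles. -/
theorem card_ends (o : TailOp) : o.kind.numV + o.ends.card + o.numCyc = o.kind.numE := by
  obtain ⟨b, k, u⟩ := o
  cases k <;> rfl

/-- The contribution of one tail to the branch count: the left side counts inner vertices including
the spine vertex, the right side is the increment of `l(λ) + l(μ) + 2g - 2`. -/
theorem card_ends_add (o : TailOp) : 1 + o.kind.numV = o.ends.card + 2 * o.numCyc := by
  obtain ⟨b, k, u⟩ := o
  cases k <;> rfl

theorem card_leftEnds_add_card_rightEnds (o : TailOp) :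
    o.leftEnds.card + o.rightEnds.card = o.ends.card := by
  unfold leftEnds rightEnds
  split_ifs <;> simp

end TailOp

/-! ### Caterpillars: admissibility and type -/

section Caterpillar

variable (op : ℕ → TailOp) (P : ℕ)

/-- The signed weight of the edges of the spine. -/
def catFlow (j : ℕ) : ℤ := 1 + ∑ i ∈ Finset.range j, (op i).sgn

@[simp]
theorem catFlow_zero : catFlow op 0 = 1 := by simp [catFlow]

theorem catFlow_succ (j : ℕ) : catFlow op (j + 1) = catFlow op j + (op j).sgn := by
  rw [catFlow, catFlow, Finset.sum_range_succ, add_assoc]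

/-- The inner vertices of a caterpillar: those of the spine and those of the tails. -/
abbrev CatV : Type := Fin P ⊕ Σ j : Fin P, Fin (op j).kind.numV

abbrev CatE : Type := Fin (P + 1) ⊕ Σ j : Fin P, Fin (op j).kind.numE

variable {op P}

/-- Spine edge `j` lies between the spine vertices `j - 1` and `j`, which exist only for `0 < j` and
`j < P` respectively; `none` marks the two open ends of the spine. -/
def catPrev (j : Fin (P + 1)) : Option (CatV op P) :=
  if h : j.1 = 0 then none else some (Sum.inl ⟨j.1 - 1, by omega⟩)

def catNext (j : Fin (P + 1)) : Option (CatV op P) :=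
  if h : j.1 = P then none else some (Sum.inl ⟨j.1, by omega⟩)

def catNear (s : Σ j : Fin P, Fin (op j).kind.numE) : CatV op P :=
  ((op s.1).kind.near s.2).elim (Sum.inl s.1) fun v => Sum.inr ⟨s.1, v⟩

def catFar (s : Σ j : Fin P, Fin (op j).kind.numE) : Option (CatV op P) :=
  ((op s.1).kind.far s.2).map fun v => Sum.inr ⟨s.1, v⟩

/-- Edges must point to the right on the target line. A spine edge with negative flow therefore runs
from its higher to its lower numbered vertex, and a left tail runs towards the spine. -/
def catSrc : CatE op P → Option (CatV op P)
  | .inl j => if 0 < catFlow op j then catPrev j else catNext j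
  | .inr s => if (op s.1).out then some (catNear s) else catFar s

def catTgt : CatE op P → Option (CatV op P)
  | .inl j => if 0 < catFlow op j then catNext j else catPrev j
  | .inr s => if (op s.1).out then catFar s else some (catNear s)

def catWeight : CatE op P → ℕ
  | .inl j => (catFlow op j).natAbs
  | .inr s => (op s.1).size * (op s.1).kind.mult s.2

variable (op P) in
/-- The caterpillar whose spine starts with an end of weight `1` on the left, and to the vertices of
which the tails `op 0, ..., op (P - 1)` are attached. -/
def catGraph : OpenGraph (CatV op P) (CatE op P) where
  src := catSrc
  tgt := catTgt
  weight := catWeight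

variable (op P) in
-- Final flow 1 makes the last spine edge a right end of weight 1; nonzero flow makes every spine
-- edge have positive weight.
structure CatAdmissible : Prop where
  pos : 0 < P
  flow_ne : ∀ j ≤ P, catFlow op j ≠ 0
  flow_last : catFlow op P = 1
  size_pos : ∀ j < P, 0 < (op j).size

theorem catPrev_eq_some {j : Fin (P + 1)} {v : CatV op P} :
    catPrev j = some v ↔ ∃ i : Fin P, j = i.succ ∧ v = Sum.inl i := by
  unfold catPrev
  split_ifs with h
  · simp only [false_iff, not_exists, not_and]
    rintro i rfl
    simp at h
  · constructor
    · intro h'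
      exact ⟨⟨j.1 - 1, by omega⟩, Fin.ext (by simp; omega), (Option.some.inj h').symm⟩
    · rintro ⟨i, rfl, rfl⟩
      simp

theorem catNext_eq_some {j : Fin (P + 1)} {v : CatV op P} :
    catNext j = some v ↔ ∃ i : Fin P, j = i.castSucc ∧ v = Sum.inl i := by
  unfold catNext
  split_ifs with h
  · simp only [false_iff, not_exists, not_and]
    rintro i rfl
    have := i.2
    simp at h
    omega
  · constructor
    · intro h'
      exact ⟨⟨j.1, by omega⟩, Fin.ext (by simp), (Option.some.inj h').symm⟩
    · rintro ⟨i, rfl, rfl⟩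
      simp

theorem catPrev_eq_none {j : Fin (P + 1)} : (catPrev j : Option (CatV op P)) = none ↔ j.1 = 0 := by
  unfold catPrev
  split_ifs with h <;> simp [h]

theorem catNext_eq_none {j : Fin (P + 1)} : (catNext j : Option (CatV op P)) = none ↔ j.1 = P := by
  unfold catNext
  split_ifs with h <;> simp [h]

theorem catNear_eq_inl {s : Σ j : Fin P, Fin (op j).kind.numE} {j : Fin P} :
    catNear s = Sum.inl j ↔ s = ⟨j, (op j).kind.stem⟩ := by
  obtain ⟨i, e⟩ := s
  have h := (op i).kind.near_eq_none_iff e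
  unfold catNear
  dsimp only
  rcases h' : (op i).kind.near e with _ | v
  · rw [h.1 h']
    simp only [Option.elim_none, Sum.inl.injEq]
    constructor
    · rintro rfl
      rfl
    · intro h0
      exact congrArg Sigma.fst h0
  · simp only [Option.elim_some, reduceCtorEq, false_iff]
    intro h0
    obtain ⟨rfl, h1⟩ := Sigma.mk.inj_iff.1 h0
    rw [h.2 (eq_of_heq h1)] at h'
    simp at h'

/-- Stating the conclusion as an equality of dependent pairs avoids transporting `e` along `i = j`.
-/
theorem catNear_eq_inr {i j : Fin P} {e : Fin (op i).kind.numE} {v : Fin (op j).kind.numV} :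
    catNear ⟨i, e⟩ = Sum.inr ⟨j, v⟩ ↔
      ∃ e', (⟨i, e⟩ : Σ j : Fin P, Fin (op j).kind.numE) = ⟨j, e'⟩ ∧
        (op j).kind.near e' = some v := by
  unfold catNear
  dsimp only
  rcases h' : (op i).kind.near e with _ | w
  · simp only [Option.elim_none, reduceCtorEq, false_iff, not_exists, not_and]
    intro e' h0
    obtain ⟨rfl, h1⟩ := Sigma.mk.inj_iff.1 h0
    rw [← eq_of_heq h1, h']
    simp
  · simp only [Option.elim_some, Sum.inr.injEq]
    constructor
    · intro h0
      obtain ⟨rfl, h1⟩ := Sigma.mk.inj_iff.1 h0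
      exact ⟨e, rfl, by rw [h', eq_of_heq h1]⟩
    · rintro ⟨e', h0, h2⟩
      obtain ⟨rfl, h1⟩ := Sigma.mk.inj_iff.1 h0
      rw [← eq_of_heq h1, h'] at h2
      rw [Option.some.inj h2]

theorem catFar_eq_inr {i j : Fin P} {e : Fin (op i).kind.numE} {v : Fin (op j).kind.numV} :
    catFar ⟨i, e⟩ = some (Sum.inr ⟨j, v⟩) ↔
      ∃ e', (⟨i, e⟩ : Σ j : Fin P, Fin (op j).kind.numE) = ⟨j, e'⟩ ∧
        (op j).kind.far e' = some v := by
  unfold catFar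
  dsimp only
  rw [Option.map_eq_some_iff]
  constructor
  · rintro ⟨w, h', h0⟩
    obtain ⟨rfl, h1⟩ := Sigma.mk.inj_iff.1 (Sum.inr.inj h0)
    exact ⟨e, rfl, by rw [h', eq_of_heq h1]⟩
  · rintro ⟨e', h0, h2⟩
    obtain ⟨rfl, h1⟩ := Sigma.mk.inj_iff.1 h0
    exact ⟨v, by rw [eq_of_heq h1, h2], rfl⟩

@[simp]
theorem catFar_ne_inl {s : Σ j : Fin P, Fin (op j).kind.numE} {j : Fin P} :
    catFar s ≠ some (Sum.inl j) := by
  unfold catFar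
  rw [Ne, Option.map_eq_some_iff]
  rintro ⟨w, -, h⟩
  cases h

theorem catGraph_touches_inl {j : Fin (P + 1)} {v : CatV op P} :
    (catGraph op P).Touches (Sum.inl j) v ↔ catPrev j = some v ∨ catNext j = some v := by
  simp only [OpenGraph.Touches, catGraph, catSrc, catTgt]
  split_ifs
  · rfl
  · exact or_comm

theorem catGraph_touches_inr {s : Σ j : Fin P, Fin (op j).kind.numE} {v : CatV op P} :
    (catGraph op P).Touches (Sum.inr s) v ↔ catNear s = v ∨ catFar s = some v := by
  simp only [OpenGraph.Touches, catGraph, catSrc, catTgt]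
  split_ifs
  · rw [Option.some.injEq]
  · rw [Option.some.injEq]
    exact or_comm

/-- The three edges at a vertex of the spine. -/
theorem catGraph_touches_spine {e : CatE op P} {j : Fin P} :
    (catGraph op P).Touches e (Sum.inl j) ↔ e = Sum.inl j.castSucc ∨ e = Sum.inl j.succ ∨
      e = Sum.inr ⟨j, (op j).kind.stem⟩ := by
  rcases e with i | s
  · rw [catGraph_touches_inl, catPrev_eq_some, catNext_eq_some]
    simp only [Sum.inl.injEq, reduceCtorEq, or_false]
    constructor
    · rintro (⟨k, h1, rfl⟩ | ⟨k, h1, rfl⟩)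
      · exact Or.inr h1
      · exact Or.inl h1
    · rintro (h | h)
      · exact Or.inr ⟨j, h, rfl⟩
      · exact Or.inl ⟨j, h, rfl⟩
  · rw [catGraph_touches_inr, catNear_eq_inl]
    simp

theorem catGraph_touches_side {e : CatE op P} {j : Fin P} {v : Fin (op j).kind.numV} :
    (catGraph op P).Touches e (Sum.inr ⟨j, v⟩) ↔ ∃ e', e = Sum.inr ⟨j, e'⟩ ∧
      ((op j).kind.near e' = some v ∨ (op j).kind.far e' = some v) := by
  rcases e with i | ⟨i, e⟩
  · rw [catGraph_touches_inl, catPrev_eq_some, catNext_eq_some]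
    simp
  · rw [catGraph_touches_inr, catNear_eq_inr, catFar_eq_inr]
    simp only [Sum.inr.injEq, and_or_left, exists_or]

theorem catFlow_pos_or_neg {j : Fin (P + 1)} (h : CatAdmissible op P) :
    0 < catFlow op j ∨ catFlow op j < 0 :=
  (lt_or_gt_of_ne (h.flow_ne j (by omega))).symm

theorem catGraph_card_touches (v : CatV op P) :
    (Finset.univ.filter fun e => (catGraph op P).Touches e v).card = 3 := by
  rcases v with j | ⟨j, v⟩
  · simp only [catGraph_touches_spine]
    rw [Finset.card_eq_three]
    refine ⟨Sum.inl j.castSucc, Sum.inl j.succ, Sum.inr ⟨j, (op j).kind.stem⟩, ?_, by simp, by simp,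
      by ext; simp⟩
    rw [Ne, Sum.inl.injEq]
    exact j.castSucc_lt_succ.ne
  · simp only [catGraph_touches_side]
    rw [← (op j).kind.card_incident v, ← Finset.card_map
      (⟨fun e => (Sum.inr ⟨j, e⟩ : CatE op P), fun a b hab => by simpa using hab⟩ :
        Fin (op j).kind.numE ↪ CatE op P)]
    congr 1
    ext e
    simp only [Finset.mem_filter, Finset.mem_univ, true_and, Finset.mem_map]
    exact exists_congr fun a => by rw [and_comm, @eq_comm _ e]; rfl

theorem catGraph_src_side {e : CatE op P} {j : Fin P} {v : Fin (op j).kind.numV} :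
    (catGraph op P).src e = some (Sum.inr ⟨j, v⟩) ↔ ∃ e', e = Sum.inr ⟨j, e'⟩ ∧
      if (op j).out then (op j).kind.near e' = some v else (op j).kind.far e' = some v := by
  rcases e with i | ⟨i, e⟩
  · constructor
    · intro hi
      obtain ⟨e', h, -⟩ := catGraph_touches_side.1 (Or.inl hi)
      cases h
    · rintro ⟨e', h, -⟩
      cases h
  · simp only [catGraph, catSrc]
    by_cases hij : i = j
    · subst hij
      split_ifs with h
      · rw [Option.some.injEq, catNear_eq_inr]
        simp only [Sum.inr.injEq]
      · rw [catFar_eq_inr]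
        simp only [Sum.inr.injEq]
    · constructor
      · intro h
        have h0 := catGraph_touches_side.1 (Or.inl h : (catGraph op P).Touches (Sum.inr ⟨i, e⟩) _)
        obtain ⟨e', h1, -⟩ := h0
        exact absurd (congrArg Sigma.fst (Sum.inr.inj h1)) hij
      · rintro ⟨e', h1, -⟩
        exact absurd (congrArg Sigma.fst (Sum.inr.inj h1)) hij

theorem catGraph_tgt_side {e : CatE op P} {j : Fin P} {v : Fin (op j).kind.numV} :
    (catGraph op P).tgt e = some (Sum.inr ⟨j, v⟩) ↔ ∃ e', e = Sum.inr ⟨j, e'⟩ ∧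
      if (op j).out then (op j).kind.far e' = some v else (op j).kind.near e' = some v := by
  rcases e with i | ⟨i, e⟩
  · constructor
    · intro hi
      obtain ⟨e', h, -⟩ := catGraph_touches_side.1 (Or.inr hi)
      cases h
    · rintro ⟨e', h, -⟩
      cases h
  · simp only [catGraph, catTgt]
    by_cases hij : i = j
    · subst hij
      split_ifs with h
      · rw [catFar_eq_inr]
        simp only [Sum.inr.injEq]
      · rw [Option.some.injEq, catNear_eq_inr]
        simp only [Sum.inr.injEq]
    · constructor
      · intro h
        have h0 := catGraph_touches_side.1 (Or.inr h : (catGraph op P).Touches (Sum.inr ⟨i, e⟩) _)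
        obtain ⟨e', h1, -⟩ := h0
        exact absurd (congrArg Sigma.fst (Sum.inr.inj h1)) hij
      · rintro ⟨e', h1, -⟩
        exact absurd (congrArg Sigma.fst (Sum.inr.inj h1)) hij

theorem catGraph_sum_side {j : Fin P} (q : CatE op P → Prop) (p : Fin (op j).kind.numE → Prop)
    [DecidablePred p] [DecidablePred q] (hpq : ∀ e, q e ↔ ∃ e', e = Sum.inr ⟨j, e'⟩ ∧ p e') :
    ∑ e with q e, (catGraph op P).weight e = (op j).size * ∑ e with p e, (op j).kind.mult e := by
  rw [Finset.mul_sum]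
  symm
  refine Finset.sum_bij (fun e _ => Sum.inr ⟨j, e⟩) ?_ ?_ ?_ ?_
  · intro e he
    rw [Finset.mem_filter] at he ⊢
    exact ⟨Finset.mem_univ _, (hpq _).2 ⟨e, rfl, he.2⟩⟩
  · intro a _ b _ hab
    exact eq_of_heq (Sigma.mk.inj_iff.1 (Sum.inr.inj hab)).2
  · intro s hs
    obtain ⟨e', h1, h2⟩ := (hpq _).1 (Finset.mem_filter.1 hs).2
    exact ⟨e', by simpa using h2, h1.symm⟩
  · intro e _
    rfl

theorem catGraph_src_castSucc (j : Fin P) :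
    (catGraph op P).src (Sum.inl j.castSucc) = some (Sum.inl j) ↔ ¬ 0 < catFlow op j := by
  have h1 : (catNext j.castSucc : Option (CatV op P)) = some (Sum.inl j) :=
    catNext_eq_some.2 ⟨j, rfl, rfl⟩
  have h2 : (catPrev j.castSucc : Option (CatV op P)) ≠ some (Sum.inl j) := by
    rw [Ne, catPrev_eq_some]
    rintro ⟨i, h3, h4⟩
    rw [← Sum.inl.inj h4] at h3
    exact j.castSucc_lt_succ.ne h3
  simp only [catGraph, catSrc, Fin.val_castSucc]
  split_ifs with h <;> simp [h, h1, h2]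

theorem catGraph_tgt_castSucc (j : Fin P) :
    (catGraph op P).tgt (Sum.inl j.castSucc) = some (Sum.inl j) ↔ 0 < catFlow op j := by
  have h1 : (catNext j.castSucc : Option (CatV op P)) = some (Sum.inl j) :=
    catNext_eq_some.2 ⟨j, rfl, rfl⟩
  have h2 : (catPrev j.castSucc : Option (CatV op P)) ≠ some (Sum.inl j) := by
    rw [Ne, catPrev_eq_some]
    rintro ⟨i, h3, h4⟩
    rw [← Sum.inl.inj h4] at h3
    exact j.castSucc_lt_succ.ne h3
  simp only [catGraph, catTgt, Fin.val_castSucc]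
  split_ifs with h <;> simp [h, h1, h2]

theorem catGraph_src_succ (j : Fin P) :
    (catGraph op P).src (Sum.inl j.succ) = some (Sum.inl j) ↔ 0 < catFlow op (j + 1) := by
  have h1 : (catPrev j.succ : Option (CatV op P)) = some (Sum.inl j) :=
    catPrev_eq_some.2 ⟨j, rfl, rfl⟩
  have h2 : (catNext j.succ : Option (CatV op P)) ≠ some (Sum.inl j) := by
    rw [Ne, catNext_eq_some]
    rintro ⟨i, h3, h4⟩
    rw [← Sum.inl.inj h4] at h3
    exact j.castSucc_lt_succ.ne h3.symm
  simp only [catGraph, catSrc, Fin.val_succ]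
  split_ifs with h <;> simp [h, h1, h2]

theorem catGraph_tgt_succ (j : Fin P) :
    (catGraph op P).tgt (Sum.inl j.succ) = some (Sum.inl j) ↔ ¬ 0 < catFlow op (j + 1) := by
  have h1 : (catPrev j.succ : Option (CatV op P)) = some (Sum.inl j) :=
    catPrev_eq_some.2 ⟨j, rfl, rfl⟩
  have h2 : (catNext j.succ : Option (CatV op P)) ≠ some (Sum.inl j) := by
    rw [Ne, catNext_eq_some]
    rintro ⟨i, h3, h4⟩
    rw [← Sum.inl.inj h4] at h3
    exact j.castSucc_lt_succ.ne h3.symm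
  simp only [catGraph, catTgt, Fin.val_succ]
  split_ifs with h <;> simp [h, h1, h2]

theorem catGraph_src_stem (j : Fin P) :
    (catGraph op P).src (Sum.inr ⟨j, (op j).kind.stem⟩) = some (Sum.inl j) ↔ (op j).out = true := by
  have h5 : catNear (⟨j, (op j).kind.stem⟩ : Σ j : Fin P, Fin (op j).kind.numE) =
    (Sum.inl j : CatV op P) := catNear_eq_inl.2 rfl
  simp only [catGraph, catSrc]
  split_ifs with h <;> simp [h5, h]

theorem catGraph_tgt_stem (j : Fin P) :
    (catGraph op P).tgt (Sum.inr ⟨j, (op j).kind.stem⟩) = some (Sum.inl j) ↔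
      ¬ (op j).out = true := by
  have h5 : catNear (⟨j, (op j).kind.stem⟩ : Σ j : Fin P, Fin (op j).kind.numE) =
    (Sum.inl j : CatV op P) := catNear_eq_inl.2 rfl
  simp only [catGraph, catTgt]
  split_ifs with h <;> simp [h5, h]

theorem catGraph_balanced (h : CatAdmissible op P) (v : CatV op P) :
    ∑ e with (catGraph op P).tgt e = some v, (catGraph op P).weight e =
      ∑ e with (catGraph op P).src e = some v, (catGraph op P).weight e := by
  rcases v with j | ⟨j, v⟩
  · refine (catGraph op P).balanced_of_sum_eq_zero
      {Sum.inl j.castSucc, Sum.inl j.succ, Sum.inr ⟨j, (op j).kind.stem⟩} ?_ ?_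
    · intro e he
      simpa using catGraph_touches_spine.1 he
    · rw [Finset.sum_insert, Finset.sum_insert, Finset.sum_singleton]
      -- Whatever the signs of the two adjacent flows and the side of the tail, balancing amounts to
      -- the recursion for the flow.
      · have h6 := catFlow_succ op j
        have h7 := catFlow_pos_or_neg (j := j.castSucc) h
        have h8 := catFlow_pos_or_neg (j := j.succ) h
        have w1 : (catGraph op P).weight (Sum.inl j.castSucc) = (catFlow op j).natAbs := rfl
        have w2 : (catGraph op P).weight (Sum.inl j.succ) = (catFlow op (j + 1)).natAbs := rfl
        have w3 : (catGraph op P).weight (Sum.inr ⟨j, (op j).kind.stem⟩) = (op j).wt := rfl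
        rw [Fin.val_castSucc] at h7
        rw [Fin.val_succ] at h8
        rw [TailOp.sgn] at h6
        simp only [catGraph_src_castSucc, catGraph_tgt_castSucc, catGraph_src_succ,
          catGraph_tgt_succ, catGraph_src_stem, catGraph_tgt_stem, w1, w2, w3]
        split_ifs at h6 ⊢ <;> omega
      · simp
      · simp only [Finset.mem_insert, Sum.inl.injEq, Finset.mem_singleton, reduceCtorEq, or_false]
        exact j.castSucc_lt_succ.ne
  · have hb := (op j).kind.balanced v
    rw [catGraph_sum_side _ _ fun e => catGraph_tgt_side,
      catGraph_sum_side _ _ fun e => catGraph_src_side]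
    congr 1
    cases (op j).out
    · simpa using hb.symm
    · simpa using hb

theorem catGraph_connected (h : CatAdmissible op P) (v : CatV op P) :
    Relation.ReflTransGen (fun a b => ∃ e, (catGraph op P).Touches e a ∧ (catGraph op P).Touches e b)
      (Sum.inl ⟨0, h.pos⟩) v := by
  have hspine : ∀ j : ℕ, ∀ hj : j < P, Relation.ReflTransGen
      (fun a b => ∃ e, (catGraph op P).Touches e a ∧ (catGraph op P).Touches e b)
      (Sum.inl ⟨0, h.pos⟩) (Sum.inl ⟨j, hj⟩) := by
    intro j
    induction j with
    | zero => exact fun _ => Relation.ReflTransGen.refl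
    | succ j ih =>
      intro hj
      refine (ih (by omega)).tail ⟨Sum.inl ⟨j + 1, by omega⟩, ?_, ?_⟩
      · exact catGraph_touches_spine.2 (Or.inr (Or.inl rfl))
      · exact catGraph_touches_spine.2 (Or.inl rfl)
  rcases v with j | ⟨j, v⟩
  · exact hspine j.1 j.2
  -- Inside a tail, descend to a vertex with a smaller number until the stem reaches the spine.
  · obtain ⟨n, hn⟩ : ∃ n, n = v.1 := ⟨_, rfl⟩
    induction n using Nat.strong_induction_on generalizing v with
    | _ n ih =>
      obtain ⟨e, he, hlt⟩ := (op j).kind.exists_far_eq v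
      have hev : (catGraph op P).Touches (Sum.inr ⟨j, e⟩) (Sum.inr ⟨j, v⟩) :=
        catGraph_touches_side.2 ⟨e, rfl, Or.inr he⟩
      rcases hne : (op j).kind.near e with _ | w
      · refine (hspine j.1 j.2).tail ⟨Sum.inr ⟨j, e⟩, ?_, hev⟩
        rw [((op j).kind.near_eq_none_iff e).1 hne]
        exact catGraph_touches_spine.2 (Or.inr (Or.inr rfl))
      · have hw := hlt w hne
        refine (ih w.1 (by rw [hn]; exact hw) w rfl).tail ⟨Sum.inr ⟨j, e⟩, ?_, hev⟩
        exact catGraph_touches_side.2 ⟨e, rfl, Or.inl hne⟩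

theorem catGraph_src_inl_eq_none (h : CatAdmissible op P) (j : Fin (P + 1)) :
    (catGraph op P).src (Sum.inl j) = none ↔ j = 0 := by
  simp only [catGraph, catSrc]
  split_ifs with hj
  · rw [catPrev_eq_none, Fin.ext_iff]
    rfl
  · rw [catNext_eq_none]
    constructor
    · intro h1
      rw [h1, h.flow_last] at hj
      exact absurd one_pos hj
    · rintro rfl
      simp at hj

theorem catGraph_tgt_inl_eq_none (h : CatAdmissible op P) (j : Fin (P + 1)) :
    (catGraph op P).tgt (Sum.inl j) = none ↔ j = Fin.last P := by
  simp only [catGraph, catTgt]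
  split_ifs with hj
  · rw [catNext_eq_none, Fin.ext_iff]
    rfl
  · rw [catPrev_eq_none]
    constructor
    · intro h1
      rw [h1] at hj
      simp at hj
    · rintro rfl
      rw [Fin.val_last, h.flow_last] at hj
      exact absurd one_pos hj

theorem catFar_eq_none {s : Σ j : Fin P, Fin (op j).kind.numE} :
    (catFar s : Option (CatV op P)) = none ↔ (op s.1).kind.far s.2 = none := by
  rw [catFar, Option.map_eq_none_iff]

theorem catGraph_src_inr_eq_none (s : Σ j : Fin P, Fin (op j).kind.numE) :
    (catGraph op P).src (Sum.inr s) = none ↔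
      (op s.1).out = false ∧ (op s.1).kind.far s.2 = none := by
  simp only [catGraph, catSrc]
  split_ifs with h <;> simp [h, catFar_eq_none]

theorem catGraph_tgt_inr_eq_none (s : Σ j : Fin P, Fin (op j).kind.numE) :
    (catGraph op P).tgt (Sum.inr s) = none ↔
      (op s.1).out = true ∧ (op s.1).kind.far s.2 = none := by
  simp only [catGraph, catTgt]
  split_ifs with h <;> simp [h, catFar_eq_none]

theorem catGraph_isAdmissible (h : CatAdmissible op P) : (catGraph op P).IsAdmissible where
  tgt_ne_none := by
    rintro (j | s) h1 h2
    · rw [catGraph_src_inl_eq_none h] at h1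
      rw [catGraph_tgt_inl_eq_none h, h1] at h2
      have := congrArg Fin.val h2
      have := h.pos
      simp at *
      omega
    · rw [catGraph_src_inr_eq_none] at h1
      rw [catGraph_tgt_inr_eq_none, h1.1] at h2
      simp at h2
  weight_pos := by
    rintro (j | s)
    · exact Int.natAbs_pos.2 (h.flow_ne j (by omega))
    · exact Nat.mul_pos (h.size_pos s.1 s.1.2) (TailKind.mult_pos _ _)
  loopless := by
    rintro (j | s) v
    · simp only [catGraph, catSrc, catTgt]
      have : catPrev j = some v → catNext j ≠ some v := by
        rw [Ne, catPrev_eq_some, catNext_eq_some]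
        rintro ⟨i, h1, rfl⟩ ⟨k, h2, h3⟩
        rw [← Sum.inl.inj h3, h1] at h2
        exact i.castSucc_lt_succ.ne h2.symm
      split_ifs
      · exact this
      · exact fun h1 h2 => this h2 h1
    · simp only [catGraph, catSrc, catTgt]
      have : catNear s = v → catFar s ≠ some v := by
        rcases v with j | ⟨j, v⟩
        · intro _
          exact catFar_ne_inl
        · obtain ⟨i, e⟩ := s
          rw [Ne, catNear_eq_inr, catFar_eq_inr]
          rintro ⟨e', h1, h2⟩ ⟨e'', h3, h4⟩
          rw [h1] at h3
          rw [← eq_of_heq (Sigma.mk.inj_iff.1 h3).2] at h4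
          exact ((op j).kind.near_lt_far _ _ _ h2 h4).ne rfl
      split_ifs
      · exact fun h1 => this (Option.some.inj h1)
      · exact fun h1 h2 => this (Option.some.inj h2) h1
  trivalent := catGraph_card_touches
  balanced := catGraph_balanced h
  connected := ⟨_, catGraph_connected h⟩
  exists_bot := ⟨Sum.inl 0, (catGraph_src_inl_eq_none h _).2 rfl⟩
  exists_top := ⟨Sum.inl (Fin.last P), (catGraph_tgt_inl_eq_none h _).2 rfl⟩

theorem Finset.val_map_filter_eq_sum {α β : Type*} [Fintype α] (p : α → Prop) [DecidablePred p]
    (w : α → β) : (Finset.univ.filter p).val.map w = ∑ a, if p a then {w a} else (0 : Multiset β) := by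
  rw [← Finset.sum_filter, Finset.sum, ← Multiset.sum_map_singleton
    (Multiset.map w (Finset.univ.filter p).val), Multiset.map_map]
  rfl

theorem catGraph_leftWeights (h : CatAdmissible op P) :
    (Finset.univ.filter fun e => (catGraph op P).src e = none).val.map (catGraph op P).weight =
      {1} + ∑ j ∈ Finset.range P, (op j).leftEnds := by
  rw [Finset.val_map_filter_eq_sum, Fintype.sum_sum_type, Fintype.sum_sigma]
  congr 1
  · simp only [catGraph_src_inl_eq_none h]
    rw [Finset.sum_ite_eq' Finset.univ (0 : Fin (P + 1)), if_pos (Finset.mem_univ _)]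
    simp [catGraph, catWeight]
  · rw [Finset.sum_range]
    refine Finset.sum_congr rfl fun j _ => ?_
    simp only [catGraph_src_inr_eq_none, TailOp.leftEnds, ← TailOp.ends_eq]
    cases (op j).out
    · simp [catGraph, catWeight]
    · simp

theorem catGraph_rightWeights (h : CatAdmissible op P) :
    (Finset.univ.filter fun e => (catGraph op P).tgt e = none).val.map (catGraph op P).weight =
      {1} + ∑ j ∈ Finset.range P, (op j).rightEnds := by
  rw [Finset.val_map_filter_eq_sum, Fintype.sum_sum_type, Fintype.sum_sigma]
  congr 1
  · simp only [catGraph_tgt_inl_eq_none h]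
    rw [Finset.sum_ite_eq' Finset.univ (Fin.last P), if_pos (Finset.mem_univ _)]
    simp [catGraph, catWeight, h.flow_last]
  · rw [Finset.sum_range]
    refine Finset.sum_congr rfl fun j _ => ?_
    simp only [catGraph_tgt_inr_eq_none, TailOp.rightEnds, ← TailOp.ends_eq]
    cases (op j).out
    · simp
    · simp [catGraph, catWeight]

theorem card_catV : Fintype.card (CatV op P) = ∑ j ∈ Finset.range P, (1 + (op j).kind.numV) := by
  rw [Fintype.card_sum, Fintype.card_sigma, Finset.sum_add_distrib, Finset.sum_range fun j =>
    (op j).kind.numV]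
  simp

theorem card_catE : Fintype.card (CatE op P) =
    P + 1 + ∑ j ∈ Finset.range P, (op j).kind.numE := by
  rw [Fintype.card_sum, Fintype.card_sigma, Finset.sum_range fun j => (op j).kind.numE]
  simp

theorem catGraph_hasType (h : CatAdmissible op P) {g d : ℕ} {lam mu : Nat.Partition d}
    (hl : {1} + ∑ j ∈ Finset.range P, (op j).leftEnds = lam.parts)
    (hr : {1} + ∑ j ∈ Finset.range P, (op j).rightEnds = mu.parts)
    (hg : ∑ j ∈ Finset.range P, (op j).numCyc = g) {r : ℕ} {x : Fin r → ℝ}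
    {p : CatV op P → ℝ} (hp : (catGraph op P).IsIncreasing p) (hpx : ∀ i, ∃ v, p v = x i) :
    (OpenGraph.toCover (catGraph_isAdmissible h) hp).HasType g lam mu x := by
  refine ⟨?_, ?_, ?_, ?_⟩
  · change Fintype.card (CatE op P) + 1 = @Fintype.card (CatV op P ⊕ (catGraph op P).Leaf)
      (instFintypeSum _ _) + g
    rw [@Fintype.card_sum (CatV op P) (catGraph op P).Leaf, (catGraph_isAdmissible h).card_leaf, card_catV, card_catE]
    have h1 := congrArg Multiset.card (catGraph_leftWeights h)
    have h2 := congrArg Multiset.card (catGraph_rightWeights h)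
    rw [Multiset.card_map] at h1 h2
    simp only [Multiset.card_add, Multiset.card_singleton, Multiset.card_sum] at h1 h2
    change (Finset.univ.filter fun e => (catGraph op P).src e = none).card = _ at h1
    change (Finset.univ.filter fun e => (catGraph op P).tgt e = none).card = _ at h2
    rw [h1, h2, ← hg]
    simp only [← TailOp.card_ends, ← TailOp.card_leftEnds_add_card_rightEnds,
      Finset.sum_add_distrib]
    simp
    ring
  · rw [OpenGraph.toCover_leftWeights, catGraph_leftWeights h, hl]
  · rw [OpenGraph.toCover_rightWeights, catGraph_rightWeights h, hr]
  · intro i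
    obtain ⟨v, hv⟩ := hpx i
    exact ⟨Sum.inl v, congrArg (fun a : ℝ => (a : EReal)) hv⟩

/-- There are exactly as many inner vertices as branch points, so a total order on the vertices
compatible with the edges determines a cover of the required type. -/
theorem card_catV_eq_branchCount {g d : ℕ} {lam mu : Nat.Partition d}
    (hl : {1} + ∑ j ∈ Finset.range P, (op j).leftEnds = lam.parts)
    (hr : {1} + ∑ j ∈ Finset.range P, (op j).rightEnds = mu.parts)
    (hg : ∑ j ∈ Finset.range P, (op j).numCyc = g) :
    Fintype.card (CatV op P) = branchCount g lam mu := by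
  rw [card_catV, branchCount, ← hl, ← hr, ← hg]
  simp only [TailOp.card_ends_add, ← TailOp.card_leftEnds_add_card_rightEnds,
    Finset.sum_add_distrib, Multiset.card_add, Multiset.card_singleton, Multiset.card_sum,
    ← Finset.mul_sum]
  omega

end Caterpillar

/-! ### Strings, symmetric pairs and complementary components after closing the ends -/

theorem Relation.ReflTransGen.swap_of_symm {α : Type*} {r : α → α → Prop}
    (hr : ∀ a b, r a b → r b a) {a b : α} (h : Relation.ReflTransGen r a b) :
    Relation.ReflTransGen r b a := by
  induction h with
  | refl => exact Relation.ReflTransGen.refl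
  | tail _ hbc ih => exact Relation.ReflTransGen.head (hr _ _ hbc) ih

namespace OpenGraph

section Transfer

variable {V E : Type} {G : OpenGraph V E} [Fintype V] [Fintype E] [DecidableEq V] [DecidableEq E]
  (h : G.IsAdmissible) {p : V → ℝ} (hp : G.IsIncreasing p)

theorem toCover_touches_inl {e : E} {v : V} :
    (toCover h hp).Touches e (Sum.inl v) ↔ G.Touches e v := by
  change G.srcV e = Sum.inl v ∨ G.tgtV e = Sum.inl v ↔ _
  rw [srcV_eq_inl, tgtV_eq_inl]
  rfl

theorem toCover_touches_inr {e : E} {l : G.Leaf} :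
    (toCover h hp).Touches e (Sum.inr l) ↔ e = l.1 := by
  change G.srcV e = Sum.inr l ∨ G.tgtV e = Sum.inr l ↔ _
  rw [srcV_eq_inr, tgtV_eq_inr]
  constructor
  · rintro (h | h)
    · exact h.2
    · exact h.2
  · rintro rfl
    rcases l.2 with h | h
    · exact Or.inl ⟨h, rfl⟩
    · exact Or.inr ⟨h, rfl⟩

/-- Adjacency within `S` is symmetric, so it is enough to reach every edge from one base edge. As
there are no loops, the numbers of outgoing and incoming edges in `S` at a vertex add up to the
number of edges of `S` touching it. -/
theorem toCover_isString {S : Set E} (e₀ : E) (he₀ : e₀ ∈ S)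
    (hconn : ∀ e ∈ S, Relation.ReflTransGen
      (fun a b => a ∈ S ∧ b ∈ S ∧ ∃ v, G.Touches a v ∧ G.Touches b v) e₀ e)
    (htwo : ∀ v, (∃ e ∈ S, G.Touches e v) → {e ∈ S | G.Touches e v}.ncard = 2) :
    (toCover h hp).IsString S := by
  refine ⟨⟨e₀, he₀⟩, fun e he f hf => ?_, ?_⟩
  · have hsymm : ∀ a b, (a ∈ S ∧ b ∈ S ∧ ∃ v, G.Touches a v ∧ G.Touches b v) →
        b ∈ S ∧ a ∈ S ∧ ∃ v, G.Touches b v ∧ G.Touches a v := by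
      rintro a b ⟨h1, h2, v, h3, h4⟩
      exact ⟨h2, h1, v, h4, h3⟩
    have h1 : Relation.ReflTransGen
        (fun a b => a ∈ S ∧ b ∈ S ∧ ∃ v, G.Touches a v ∧ G.Touches b v) e e₀ :=
      (hconn e he).swap_of_symm hsymm
    refine Relation.ReflTransGen.mono ?_ _ _ (h1.trans (hconn f hf))
    rintro a b ⟨-, h2, v, h3, h4⟩
    exact ⟨h2, Sum.inl v, (toCover_touches_inl h hp).2 h3, (toCover_touches_inl h hp).2 h4⟩
  · rintro (v | l) hv hl
    · obtain ⟨e, he, hev⟩ := hv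
      have h2 := htwo v ⟨e, he, (toCover_touches_inl h hp).1 hev⟩
      change {e ∈ S | G.srcV e = Sum.inl v}.ncard + {e ∈ S | G.tgtV e = Sum.inl v}.ncard = 2
      simp only [srcV_eq_inl, tgtV_eq_inl]
      rw [← h2, ← Set.ncard_union_eq]
      · congr 1
        ext e
        simp only [Touches, Set.mem_union, Set.mem_ofPred_eq]
        tauto
      · rw [Set.disjoint_left]
        rintro e ⟨-, h3⟩ ⟨-, h4⟩
        exact h.loopless e v h3 h4
    · exact absurd (toCurve_isLeaf h hp l) hl

theorem toCover_symCycle {e f : E} (hef : (toCover h hp).SymCycle e f) :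
    ∃ v w, v ≠ w ∧ G.Touches e v ∧ G.Touches e w ∧ G.Touches f v ∧ G.Touches f w ∧ e ≠ f := by
  obtain ⟨h1, h2, -, -, h3, h4⟩ := hef
  have h2 := mt (toCurve_isEnd_iff h hp e).2 h2
  obtain ⟨v, w, hv, hw, hlt⟩ := hp.exists_of_inner h2
  refine ⟨v, w, ?_, Or.inl (G.srcV_eq_inl.1 hv), Or.inr (G.tgtV_eq_inl.1 hw),
    Or.inl (G.srcV_eq_inl.1 (h3.symm.trans hv)), Or.inr (G.tgtV_eq_inl.1 (h4.symm.trans hw)), h1⟩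
  rintro rfl
  exact hlt.ne rfl

theorem toCover_symFork {s : Side} {e f : E} (hef : (toCover h hp).SymFork s e f) :
    e ≠ f ∧ (G.src e = none ∨ G.tgt e = none) ∧ (G.src f = none ∨ G.tgt f = none) ∧
      G.weight e = G.weight f ∧ ∃ v, G.Touches e v ∧ G.Touches f v := by
  obtain ⟨h1, h2, h3, h4, h5⟩ := hef
  have hsrc : ∀ e, (toCover h hp).IsLeaf (G.srcV e) → G.src e = none := by
    intro e he
    by_contra h0
    obtain ⟨v, hv⟩ := Option.ne_none_iff_exists'.1 h0
    rw [G.srcV_eq_inl.2 hv] at he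
    exact toCurve_not_isLeaf h hp v he
  have htgt : ∀ e, (toCover h hp).IsLeaf (G.tgtV e) → G.tgt e = none := by
    intro e he
    by_contra h0
    obtain ⟨v, hv⟩ := Option.ne_none_iff_exists'.1 h0
    rw [G.tgtV_eq_inl.2 hv] at he
    exact toCurve_not_isLeaf h hp v he
  cases s
  · have he := hsrc e h2
    have hf := hsrc f h3
    obtain ⟨v, hv⟩ := Option.ne_none_iff_exists'.1 (h.tgt_ne_none e he)
    refine ⟨h1, Or.inl he, Or.inl hf, h4, v, Or.inr hv, Or.inr ?_⟩
    exact G.tgtV_eq_inl.1 (Eq.trans (Eq.symm h5 : G.tgtV f = G.tgtV e) (G.tgtV_eq_inl.2 hv))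
  · have he := htgt e h2
    have hf := htgt f h3
    obtain ⟨v, hv⟩ := Option.ne_none_iff_exists'.1 (h.src_ne_none e he)
    refine ⟨h1, Or.inr he, Or.inr hf, h4, v, Or.inl hv, Or.inl ?_⟩
    exact G.srcV_eq_inl.1 (Eq.trans (Eq.symm h5 : G.srcV f = G.srcV e) (G.srcV_eq_inl.2 hv))

/-- A set of edges which is connected by way of vertices outside the closed subgraph `U` and which
is left only through vertices of `U` is the only component that contains its edges. -/
theorem toCover_complComponent_eq {U T T' : Set E} {e : E} (heT' : e ∈ T')
    (hT : T = {f | Relation.ReflTransGen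
      (fun a b => b ∉ U ∧ ∃ v, v ∉ (toCover h hp).verts U ∧ (toCover h hp).Touches a v ∧
        (toCover h hp).Touches b v) e f})
    (hU : ∀ e ∈ T', e ∉ U)
    (hclosed : ∀ a ∈ T', ∀ v, (∀ f ∈ U, ¬ G.Touches f v) → G.Touches a v →
      ∀ b, G.Touches b v → b ∈ T')
    (hconn : ∀ a ∈ T', ∀ b ∈ T', Relation.ReflTransGen
      (fun a b => a ∈ T' ∧ b ∈ T' ∧ ∃ v, (∀ f ∈ U, ¬ G.Touches f v) ∧ G.Touches a v ∧
        G.Touches b v) a b) : T = T' := by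
  ext f
  rw [hT]
  constructor
  · intro hf
    change Relation.ReflTransGen _ e f at hf
    induction hf with
    | refl => exact heT'
    | tail _ hab ih =>
      obtain ⟨-, v, hv, ha, hb⟩ := hab
      rcases v with v | l
      · refine hclosed _ ih v (fun f hf hfv => hv ⟨f, hf, (toCover_touches_inl h hp).2 hfv⟩)
          ((toCover_touches_inl h hp).1 ha) _ ((toCover_touches_inl h hp).1 hb)
      · rw [(toCover_touches_inr h hp).1 hb, ← (toCover_touches_inr h hp).1 ha]
        exact ih
  · intro hf
    refine Relation.ReflTransGen.mono ?_ _ _ (hconn e heT' f hf)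
    rintro a b ⟨-, h2, v, hv, h3, h4⟩
    refine ⟨hU b h2, Sum.inl v, ?_, (toCover_touches_inl h hp).2 h3,
      (toCover_touches_inl h hp).2 h4⟩
    rintro ⟨f, hf, hfv⟩
    exact hv f hf ((toCover_touches_inl h hp).1 hfv)

end Transfer

end OpenGraph

namespace TailKind

/-- Two edges that share a vertex other than the point of attachment. -/
def Adj (k : TailKind) (e f : Fin k.numE) : Prop :=
  ∃ v, (k.near e = some v ∨ k.far e = some v) ∧ (k.near f = some v ∨ k.far f = some v)

theorem exists_adj_lt (k : TailKind) : ∀ f : Fin k.numE, f = k.stem ∨ ∃ e < f, k.Adj e f := by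
  unfold Adj
  cases k <;> decide

theorem Adj.symm {k : TailKind} {e f : Fin k.numE} (h : k.Adj e f) : k.Adj f e := by
  obtain ⟨v, h1, h2⟩ := h
  exact ⟨v, h2, h1⟩

theorem connected (k : TailKind) (e f : Fin k.numE) : Relation.ReflTransGen k.Adj e f := by
  have h : ∀ f : Fin k.numE, Relation.ReflTransGen k.Adj k.stem f := by
    intro f
    obtain ⟨n, hn⟩ : ∃ n, n = f.1 := ⟨_, rfl⟩
    induction n using Nat.strong_induction_on generalizing f with
    | _ n ih =>
      rcases k.exists_adj_lt f with rfl | ⟨e, he, hef⟩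
      · exact Relation.ReflTransGen.refl
      · exact (ih e.1 (by rw [hn]; exact he) e rfl).tail hef
  exact ((h e).swap_of_symm fun _ _ hab => hab.symm).trans (h f)

/-- The hypothesis `k = single`, in place of the constructor itself, lets this description be
applied to `(op j).kind`, on which the types of the edges depend. The same form is used for the
other two kinds. -/
theorem single_spec (k : TailKind) (hk : k = single) :
    k.far k.stem = none ∧ k.mult k.stem = 1 ∧ (∀ e, e = k.stem) ∧ k.numV = 0 := by
  subst hk
  decide

theorem fork_spec (k : TailKind) (hk : k = fork) :
    ∃ b c, b ≠ c ∧ k.far k.stem = k.near b ∧ k.near c = k.near b ∧ k.near b ≠ none ∧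
      k.far b = none ∧ k.far c = none ∧ k.mult b = 1 ∧ k.mult c = 1 ∧
      ∀ e, e = k.stem ∨ e = b ∨ e = c := by
  subst hk
  decide

theorem cyc_spec (k : TailKind) (hk : k = cyc) :
    ∃ b c, b ≠ c ∧ k.far k.stem = k.near b ∧ k.near c = k.near b ∧ k.near b ≠ none ∧
      k.far b = k.far c ∧ k.far b ≠ none ∧ k.mult b = 1 ∧ k.mult c = 1 ∧
    ∃ a', k.near a' = k.far b ∧ k.far a' ≠ none ∧
    ∃ b' c', b' ≠ c' ∧ k.far a' = k.near b' ∧ k.near c' = k.near b' ∧ k.near b' ≠ none ∧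
      k.far b' = none ∧ k.far c' = none ∧ k.mult b' = 1 ∧ k.mult c' = 1 ∧
      ∀ e, e = k.stem ∨ e = b ∨ e = c ∨ e = a' ∨ e = b' ∨ e = c' := by
  subst hk
  refine ⟨⟨1, by decide⟩, ⟨2, by decide⟩, by decide, by decide, by decide, by decide, by decide,
    by decide, by decide, by decide, ⟨3, by decide⟩, by decide, by decide, ⟨4, by decide⟩,
    ⟨5, by decide⟩, ?_⟩
  decide

end TailKind

/-! ### Decomposition of a caterpillar into strings, links and tails -/

section Effective

variable {op : ℕ → TailOp} {P q n : ℕ}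

variable (op P q n) in
/-- The tails between the positions `q` and `q + 2 * n` are single odd ends, alternately on the right
and on the left, which cut the spine into `n + 1` strings; all other tails are even. -/
structure CatEffective : Prop extends CatAdmissible op P where
  q_pos : 0 < q
  n_pos : 0 < n
  lt : q + 2 * n < P
  link_kind : ∀ j, q ≤ j → j < q + 2 * n → (op j).kind = TailKind.single
  link_odd : ∀ j, q ≤ j → j < q + 2 * n → Odd (op j).size
  link_out : ∀ k < n, (op (q + 2 * k)).out = true
  link_in : ∀ k < n, (op (q + 2 * k + 1)).out = false
  single_even : ∀ j < P, ¬ (q ≤ j ∧ j < q + 2 * n) → (op j).kind = TailKind.single →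
    Even (op j).size
  odd_of_ne_single : ∀ j < P, ¬ (q ≤ j ∧ j < q + 2 * n) → (op j).kind ≠ TailKind.single →
    Odd (op j).size
  flow_pos : ∀ j, q ≤ j → j ≤ q + 2 * n → 0 < catFlow op j

variable (q n) in
/-- The edges of the strings. -/
def catIsString : CatE op P → Prop
  | .inl j => ¬ ∃ k < n, j.1 = q + 2 * k + 1
  | .inr s => q ≤ s.1.1 ∧ s.1.1 < q + 2 * n

variable (q n) in
/-- The index of the string to which an edge belongs. -/
def catStringIdx : CatE op P → ℕ
  | .inl j => min ((j.1 - q) / 2) n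
  | .inr s => (s.1.1 - q + 1) / 2

variable (op P q n) in
def catString (i : Fin (n + 1)) : Set (CatE op P) :=
  {e | catIsString q n e ∧ catStringIdx q n e = i}

theorem TailOp.wt_single {o : TailOp} (h : o.kind = TailKind.single) : o.wt = o.size := by
  rw [TailOp.wt, (o.kind.single_spec h).2.1, mul_one]

theorem TailOp.even_wt {o : TailOp} (h : o.kind = TailKind.single → Even o.size) : Even o.wt := by
  obtain ⟨b, k, u⟩ := o
  cases k
  · rw [TailOp.wt_single rfl]
    exact h rfl
  · exact ⟨u, by rw [← mul_two]; rfl⟩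
  · exact ⟨u, by rw [← mul_two]; rfl⟩

namespace CatEffective

theorem even_wt (h : CatEffective op P q n) {j : ℕ} (hj : j < P)
    (hjq : ¬ (q ≤ j ∧ j < q + 2 * n)) : Even (op j).wt :=
  TailOp.even_wt (h.single_even j hj hjq)

theorem odd_wt (h : CatEffective op P q n) {j : ℕ} (h1 : q ≤ j) (h2 : j < q + 2 * n) :
    Odd (op j).wt := by
  rw [TailOp.wt_single (h.link_kind j h1 h2)]
  exact h.link_odd j h1 h2

/-- The flow starts at the odd value 1 and changes parity exactly at the `2n` single odd ends of the
link block. It is thus even only after an odd number of these ends. -/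
theorem flow_parity (h : CatEffective op P q n) (j : ℕ) (hj : j ≤ P) :
    catFlow op j % 2 = if q ≤ j ∧ j < q + 2 * n then 1 - ((j : ℤ) - q) % 2 else 1 := by
  induction j with
  | zero =>
    have := h.q_pos
    rw [if_neg (by omega), catFlow_zero]
    rfl
  | succ j ih =>
    have ih := ih (by omega)
    have hs : (op j).sgn % 2 = (op j).wt % 2 := by
      unfold TailOp.sgn
      split_ifs <;> omega
    rw [catFlow_succ]
    by_cases hjq : q ≤ j ∧ j < q + 2 * n
    · have := Nat.odd_iff.1 (h.odd_wt hjq.1 hjq.2)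
      rw [if_pos hjq] at ih
      split_ifs with h1
      · push_cast
        omega
      · omega
    · have := Nat.even_iff.1 (h.even_wt (by omega) hjq)
      rw [if_neg hjq] at ih
      split_ifs with h1
      · push_cast
        omega
      · omega

theorem odd_flow_iff (h : CatEffective op P q n) (j : ℕ) (hj : j ≤ P) :
    Odd (catFlow op j).natAbs ↔ ¬ ∃ k < n, j = q + 2 * k + 1 := by
  have h1 := h.flow_parity j hj
  rw [Int.natAbs_odd, Int.odd_iff, h1]
  split_ifs with h2
  · constructor
    · rintro h3 ⟨k, hk, rfl⟩
      push_cast at h3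
      omega
    · intro h3
      by_contra h4
      exact h3 ⟨(j - q) / 2, by omega, by omega⟩
  · simp only [true_iff]
    rintro ⟨k, hk, rfl⟩
    omega

theorem odd_of_isString (h : CatEffective op P q n) {e : CatE op P} (he : catIsString q n e) :
    Odd ((catGraph op P).weight e) := by
  rcases e with j | ⟨j, e⟩
  · exact (h.odd_flow_iff j (by omega)).2 he
  · have h1 := (op j).kind.single_spec (h.link_kind j he.1 he.2)
    change Odd ((op j).size * (op j).kind.mult e)
    rw [h1.2.2.1 e]
    exact h.odd_wt he.1 he.2

theorem even_stem (h : CatEffective op P q n) {j : Fin P} (hj : ¬ (q ≤ j.1 ∧ j.1 < q + 2 * n)) :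
    ¬ Odd ((catGraph op P).weight (Sum.inr ⟨j, (op j).kind.stem⟩)) :=
  Nat.not_odd_iff_even.2 (h.even_wt j.2 hj)

theorem isEmpty_of_link (h : CatEffective op P q n) {j : Fin P} (h1 : q ≤ j.1)
    (h2 : j.1 < q + 2 * n) (v : Fin (op j).kind.numV) : False := by
  have h3 := ((op j).kind.single_spec (h.link_kind j h1 h2)).2.2.2
  rw [h3] at v
  exact v.elim0

/-- Exactly two of the three edges at a vertex of the spine belong to strings, and in fact to the
same one. -/
theorem exists_pair (h : CatEffective op P q n) (j : Fin P) : ∃ a b : CatE op P, a ≠ b ∧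
    catStringIdx q n a = catStringIdx q n b ∧
    ∀ e, (catGraph op P).Touches e (Sum.inl j) ∧ catIsString q n e ↔ e = a ∨ e = b := by
  have hn := h.n_pos
  have hne : (Sum.inl j.castSucc : CatE op P) ≠ Sum.inl j.succ := by
    rw [Ne, Sum.inl.injEq]
    exact j.castSucc_lt_succ.ne
  by_cases hj : q ≤ j.1 ∧ j.1 < q + 2 * n
  -- At an even offset the string arrives along the lower spine edge and leaves by the right end; at
  -- an odd offset it arrives by the left end and continues along the upper spine edge. The
  -- remaining spine edge is a link, and both edges of the string get the same index.
  · have hs : catIsString q n (Sum.inr ⟨j, (op j).kind.stem⟩ : CatE op P) := hj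
    rcases Nat.even_or_odd' (j.1 - q) with ⟨k, hk | hk⟩
    · have h1 : catIsString q n (Sum.inl j.castSucc : CatE op P) := by
        rintro ⟨k', hk', h0⟩
        rw [Fin.val_castSucc] at h0
        omega
      have h2 : ¬ catIsString q n (Sum.inl j.succ : CatE op P) := fun h0 =>
        h0 ⟨k, by omega, by rw [Fin.val_succ]; omega⟩
      refine ⟨Sum.inl j.castSucc, Sum.inr ⟨j, (op j).kind.stem⟩, by simp, ?_, ?_⟩
      · simp only [catStringIdx, Fin.val_castSucc]
        omega
      · intro e
        rw [catGraph_touches_spine]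
        constructor
        · rintro ⟨rfl | rfl | rfl, he⟩
          · exact Or.inl rfl
          · exact absurd he h2
          · exact Or.inr rfl
        · rintro (rfl | rfl)
          · exact ⟨Or.inl rfl, h1⟩
          · exact ⟨Or.inr (Or.inr rfl), hs⟩
    · have h1 : catIsString q n (Sum.inl j.succ : CatE op P) := by
        rintro ⟨k', hk', h0⟩
        rw [Fin.val_succ] at h0
        omega
      have h2 : ¬ catIsString q n (Sum.inl j.castSucc : CatE op P) := fun h0 =>
        h0 ⟨k, by omega, by rw [Fin.val_castSucc]; omega⟩
      refine ⟨Sum.inl j.succ, Sum.inr ⟨j, (op j).kind.stem⟩, by simp, ?_, ?_⟩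
      · simp only [catStringIdx, Fin.val_succ]
        omega
      · intro e
        rw [catGraph_touches_spine]
        constructor
        · rintro ⟨rfl | rfl | rfl, he⟩
          · exact absurd he h2
          · exact Or.inl rfl
          · exact Or.inr rfl
        · rintro (rfl | rfl)
          · exact ⟨Or.inr (Or.inl rfl), h1⟩
          · exact ⟨Or.inr (Or.inr rfl), hs⟩
  · have hs : ¬ catIsString q n (Sum.inr ⟨j, (op j).kind.stem⟩ : CatE op P) := hj
    refine ⟨Sum.inl j.castSucc, Sum.inl j.succ, hne, ?_, ?_⟩
    · simp only [catStringIdx, Fin.val_castSucc, Fin.val_succ]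
      omega
    · intro e
      rw [catGraph_touches_spine]
      constructor
      · rintro ⟨rfl | rfl | rfl, he⟩
        · exact Or.inl rfl
        · exact Or.inr rfl
        · exact absurd he hs
      · rintro (rfl | rfl)
        · refine ⟨Or.inl rfl, ?_⟩
          rintro ⟨k', hk', h0⟩
          rw [Fin.val_castSucc] at h0
          omega
        · refine ⟨Or.inr (Or.inl rfl), ?_⟩
          rintro ⟨k', hk', h0⟩
          rw [Fin.val_succ] at h0
          omega

/-- The spine edge `q + 2i` is the core of string `i`, flanked by odd ends from the link block. Only
the first and the last string contain further spine edges, those up to `q` and those from `q + 2n`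
on. -/
theorem string_connected (h : CatEffective op P q n) (i : Fin (n + 1)) (e₀ : CatE op P)
    (he₀ : e₀ = Sum.inl ⟨q + 2 * i, by have := h.lt; omega⟩) (e : CatE op P)
    (he : e ∈ catString op P q n i) :
    Relation.ReflTransGen (fun a b => a ∈ catString op P q n i ∧ b ∈ catString op P q n i ∧
      ∃ v, (catGraph op P).Touches a v ∧ (catGraph op P).Touches b v) e₀ e := by
  have hlt := h.lt
  have hn := h.n_pos
  have hi : i.1 ≤ n := by omega
  have hmem : ∀ j : ℕ, ∀ hj : j < P + 1, (j ≤ q ∧ i.1 = 0) ∨ (j = q + 2 * i) ∨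
      (q + 2 * n ≤ j ∧ i.1 = n) → (Sum.inl ⟨j, hj⟩ : CatE op P) ∈ catString op P q n i := by
    intro j hj hjj
    constructor
    · rintro ⟨k, hk, h0⟩
      simp only at h0
      omega
    · simp only [catStringIdx]
      omega
  rcases e with ⟨j, hj⟩ | ⟨⟨j, hj⟩, e⟩
  · obtain ⟨h1, h2⟩ := he
    simp only [catStringIdx] at h2
    have h3 : (j ≤ q ∧ i.1 = 0) ∨ (j = q + 2 * i) ∨ (q + 2 * n ≤ j ∧ i.1 = n) := by
      by_cases h4 : q < j ∧ j < q + 2 * n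
      · have h5 : ¬ (j - q) % 2 = 1 := fun h5 => h1 ⟨(j - q) / 2, by omega, by simp only; omega⟩
        omega
      · omega
    rcases h3 with h3 | h3 | h3
    -- Induction on the distance along the spine to the edge `q`, where the first string meets the
    -- link block.
    · obtain ⟨d, hd⟩ : ∃ d, d = q - j := ⟨_, rfl⟩
      clear h1 h2
      induction d generalizing j with
      | zero =>
        have : j = q + 2 * i := by omega
        subst this
        rw [he₀]
      | succ d ih =>
        refine (ih (j + 1) (by omega) (by omega) (by omega)).tail ⟨hmem _ _ (by omega),
          hmem _ _ (by omega), Sum.inl ⟨j, by omega⟩, ?_, ?_⟩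
        · exact catGraph_touches_spine.2 (Or.inr (Or.inl rfl))
        · exact catGraph_touches_spine.2 (Or.inl rfl)
    · subst h3
      rw [he₀]
    · obtain ⟨d, hd⟩ : ∃ d, d = j - (q + 2 * n) := ⟨_, rfl⟩
      clear h1 h2
      induction d generalizing j with
      | zero =>
        have : j = q + 2 * i := by omega
        subst this
        rw [he₀]
      | succ d ih =>
        refine (ih (j - 1) (by omega) (by omega) (by omega)).tail ⟨hmem _ _ (by omega),
          hmem _ _ (by omega), Sum.inl ⟨j - 1, by omega⟩, ?_, ?_⟩
        · exact catGraph_touches_spine.2 (Or.inl rfl)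
        · refine catGraph_touches_spine.2 (Or.inr (Or.inl ?_))
          rw [Sum.inl.injEq, Fin.ext_iff, Fin.val_succ]
          simp only
          omega
  · have he' := he
    obtain ⟨h1, h2⟩ := he
    have h1' : q ≤ j ∧ j < q + 2 * n := h1
    simp only [catStringIdx] at h2
    have h3 := ((op j).kind.single_spec (h.link_kind j h1'.1 h1'.2)).2.2.1 e
    subst h3
    refine Relation.ReflTransGen.single ⟨he₀ ▸ hmem _ _ (by omega), he',
      Sum.inl ⟨j, hj⟩, ?_, catGraph_touches_spine.2 (Or.inr (Or.inr rfl))⟩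
    rw [catGraph_touches_spine, he₀]
    simp only [Sum.inl.injEq, Fin.ext_iff, Fin.val_castSucc, Fin.val_succ, reduceCtorEq, or_false]
    omega

theorem src_spine (j : ℕ) (hj : j + 1 < P + 1)
    (h1 : 0 < catFlow op (j + 1)) :
    (catGraph op P).src (Sum.inl ⟨j + 1, hj⟩) = some (Sum.inl ⟨j, by omega⟩) :=
  (catGraph_src_succ (⟨j, by omega⟩ : Fin P)).2 h1

theorem tgt_spine (j : ℕ) (hj : j < P) (h1 : 0 < catFlow op j) :
    (catGraph op P).tgt (Sum.inl ⟨j, by omega⟩) = some (Sum.inl ⟨j, hj⟩) :=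
  (catGraph_tgt_castSucc (⟨j, by omega⟩ : Fin P)).2 h1

/-- The spine is a path whose vertices carry distinct stems, so two different vertices of the spine
have at most one common edge. -/
theorem not_symCycle (v w : CatV op P) (hvw : v ≠ w) {j : Fin (P + 1)} {f : CatE op P}
    (h1 : (catGraph op P).Touches (Sum.inl j) v) (h2 : (catGraph op P).Touches (Sum.inl j) w)
    (h3 : (catGraph op P).Touches f v) (h4 : (catGraph op P).Touches f w) : f = Sum.inl j := by
  have hv : ∃ a, v = Sum.inl a := by
    rcases v with a | ⟨a, b⟩
    · exact ⟨a, rfl⟩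
    · obtain ⟨_, h0, -⟩ := catGraph_touches_side.1 h1
      cases h0
  have hw : ∃ a, w = Sum.inl a := by
    rcases w with a | ⟨a, b⟩
    · exact ⟨a, rfl⟩
    · obtain ⟨_, h0, -⟩ := catGraph_touches_side.1 h2
      cases h0
  obtain ⟨a, rfl⟩ := hv
  obtain ⟨b, rfl⟩ := hw
  have hab : a.1 ≠ b.1 := fun h0 => hvw (congrArg _ (Fin.ext h0))
  rw [catGraph_touches_spine] at h1 h2 h3 h4
  rcases f with i | s
  · simp only [Sum.inl.injEq, reduceCtorEq, or_false, Fin.ext_iff, Fin.val_castSucc,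
      Fin.val_succ] at h1 h2 h3 h4 ⊢
    omega
  · simp only [reduceCtorEq, Sum.inr.injEq, false_or] at h3 h4
    rw [h3] at h4
    exact absurd (congrArg (fun s => s.1.1) h4) hab

/-- An end belonging to a string is either one of the two ends of the spine or a single odd end of
the link block. The first and last spine vertices lie outside that block, because `0 < q` and `q +
2n < P`, so their stems are even; and the spine edges at a vertex of the block are inner edges. -/
theorem not_symFork (h : CatEffective op P q n) {e f : CatE op P} (hef : e ≠ f)
    (he : (catGraph op P).src e = none ∨ (catGraph op P).tgt e = none)
    (hf : (catGraph op P).src f = none ∨ (catGraph op P).tgt f = none)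
    (hw : (catGraph op P).weight e = (catGraph op P).weight f)
    (hv : ∃ v, (catGraph op P).Touches e v ∧ (catGraph op P).Touches f v) :
    ¬ catIsString q n e := by
  intro hs
  have hlt := h.lt
  have hq := h.q_pos
  have hn := h.n_pos
  have hodd := h.odd_of_isString hs
  have hend : ∀ j : Fin (P + 1), (catGraph op P).src (Sum.inl j) = none ∨
      (catGraph op P).tgt (Sum.inl j) = none → j.1 = 0 ∨ j.1 = P := by
    intro j hj
    rw [catGraph_src_inl_eq_none h.toCatAdmissible, catGraph_tgt_inl_eq_none h.toCatAdmissible,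
      Fin.ext_iff, Fin.ext_iff] at hj
    exact hj
  obtain ⟨v, hev, hfv⟩ := hv
  rcases v with j | ⟨j, v⟩
  · rw [catGraph_touches_spine] at hev hfv
    have hje : (e = Sum.inr ⟨j, (op j).kind.stem⟩ → q ≤ j.1 ∧ j.1 < q + 2 * n) := by
      rintro rfl
      exact hs
    rcases f with f | f
    · have hf := hend f hf
      rcases e with e | e
      · have he := hend e he
        simp only [Sum.inl.injEq, reduceCtorEq, or_false, Fin.ext_iff, Fin.val_castSucc,
          Fin.val_succ, Ne] at hev hfv hef
        omega
      · simp only [Sum.inl.injEq, reduceCtorEq, or_false, Fin.ext_iff, Fin.val_castSucc,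
          Fin.val_succ, Ne, false_or] at hev hfv hef
        have := hje hev
        omega
    · rcases hfv with h0 | h0 | h0
      · cases h0
      · cases h0
      · rw [hw, h0] at hodd
        have hjl : q ≤ j.1 ∧ j.1 < q + 2 * n := by
          by_contra h1
          exact h.even_stem h1 hodd
        rcases e with e | e
        · have he := hend e he
          simp only [Sum.inl.injEq, reduceCtorEq, or_false, Fin.ext_iff, Fin.val_castSucc,
            Fin.val_succ] at hev
          omega
        · rcases hev with h2 | h2 | h2
          · cases h2
          · cases h2
          · exact hef (h2.trans h0.symm)
  · obtain ⟨e', rfl, -⟩ := catGraph_touches_side.1 hev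
    exact h.isEmpty_of_link hs.1 hs.2 v

end CatEffective

end Effective

section Effective

variable {op : ℕ → TailOp} {P q n : ℕ}

theorem TailKind.eq_or (k : TailKind) :
    k = TailKind.single ∨ k = TailKind.fork ∨ k = TailKind.cyc := by
  cases k <;> simp

def tailSide (o : TailOp) : Side := if o.out then Side.right else Side.left

section Tail

variable (h : CatAdmissible op P) {p : CatV op P → ℝ} (hp : (catGraph op P).IsIncreasing p)

local notation "Φ" => OpenGraph.toCover (catGraph_isAdmissible h) hp

theorem toCover_near_side (s : Σ j : Fin P, Fin (op j).kind.numE) :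
    (Φ).near (tailSide (op s.1)) (Sum.inr s : CatE op P) = Sum.inl (catNear s) := by
  have h1 : (catGraph op P).src (Sum.inr s) = if (op s.1).out then some (catNear s) else catFar s := rfl
  have h2 : (catGraph op P).tgt (Sum.inr s) = if (op s.1).out then catFar s else some (catNear s) := rfl
  unfold tailSide
  split_ifs with h0
  · rw [if_pos h0] at h1
    exact ((catGraph op P).srcV_eq_inl).2 h1
  · rw [if_neg h0] at h2
    exact ((catGraph op P).tgtV_eq_inl).2 h2

theorem toCover_far_side {s : Σ j : Fin P, Fin (op j).kind.numE} {v : CatV op P}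
    (hv : catFar s = some v) :
    (Φ).far (tailSide (op s.1)) (Sum.inr s : CatE op P) = Sum.inl v := by
  have h1 : (catGraph op P).src (Sum.inr s) = if (op s.1).out then some (catNear s) else catFar s := rfl
  have h2 : (catGraph op P).tgt (Sum.inr s) = if (op s.1).out then catFar s else some (catNear s) := rfl
  unfold tailSide
  split_ifs with h0
  · rw [if_pos h0, hv] at h2
    exact ((catGraph op P).tgtV_eq_inl).2 h2
  · rw [if_neg h0, hv] at h1
    exact ((catGraph op P).srcV_eq_inl).2 h1

theorem toCover_isLeaf_far_side {s : Σ j : Fin P, Fin (op j).kind.numE}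
    (hs : (op s.1).kind.far s.2 = none) :
    (Φ).IsLeaf ((Φ).far (tailSide (op s.1)) (Sum.inr s : CatE op P)) := by
  have h3 := catGraph_src_inr_eq_none s
  have h4 := catGraph_tgt_inr_eq_none s
  unfold tailSide
  split_ifs with h0
  · have h5 := h4.2 ⟨h0, hs⟩
    have h6 : (catGraph op P).tgtV (Sum.inr s) = Sum.inr ⟨Sum.inr s, Or.inr h5⟩ :=
      ((catGraph op P).tgtV_eq_inr).2 ⟨h5, rfl⟩
    change (Φ).IsLeaf ((catGraph op P).tgtV (Sum.inr s))
    rw [h6]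
    exact OpenGraph.toCurve_isLeaf (catGraph_isAdmissible h) hp _
  · have h5 := h3.2 ⟨by simpa using h0, hs⟩
    have h6 : (catGraph op P).srcV (Sum.inr s) = Sum.inr ⟨Sum.inr s, Or.inl h5⟩ :=
      ((catGraph op P).srcV_eq_inr).2 ⟨h5, rfl⟩
    change (Φ).IsLeaf ((catGraph op P).srcV (Sum.inr s))
    rw [h6]
    exact OpenGraph.toCurve_isLeaf (catGraph_isAdmissible h) hp _

theorem toCover_not_isEnd_side {s : Σ j : Fin P, Fin (op j).kind.numE}
    (hs : (op s.1).kind.far s.2 ≠ none) : ¬ (Φ).IsEnd (Sum.inr s : CatE op P) := by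
  intro h0
  have h0 := (OpenGraph.toCurve_isEnd_iff (catGraph_isAdmissible h) hp (Sum.inr s)).1 h0
  rw [catGraph_src_inr_eq_none, catGraph_tgt_inr_eq_none] at h0
  rcases h0 with h0 | h0
  · exact hs h0.2
  · exact hs h0.2

theorem toCover_near_eq_far {j : Fin P} {a b : Fin (op j).kind.numE}
    (hab : (op j).kind.far a = (op j).kind.near b) (hb : (op j).kind.near b ≠ none) :
    (Φ).near (tailSide (op j)) (Sum.inr ⟨j, b⟩ : CatE op P) =
      (Φ).far (tailSide (op j)) (Sum.inr ⟨j, a⟩ : CatE op P) := by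
  obtain ⟨v, hv⟩ := Option.ne_none_iff_exists'.1 hb
  rw [toCover_near_side h hp ⟨j, b⟩, toCover_far_side h hp (s := ⟨j, a⟩) (v := Sum.inr ⟨j, v⟩)]
  · congr 1
    exact catNear_eq_inr.2 ⟨b, rfl, hv⟩
  · exact catFar_eq_inr.2 ⟨a, rfl, hab.trans hv⟩

theorem toCover_symFork_side {j : Fin P} {b c : Fin (op j).kind.numE} (hbc : b ≠ c)
    (hn : (op j).kind.near c = (op j).kind.near b) (hb : (op j).kind.far b = none)
    (hc : (op j).kind.far c = none) (hm : (op j).kind.mult b = (op j).kind.mult c) :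
    (Φ).SymFork (tailSide (op j)) (Sum.inr ⟨j, b⟩ : CatE op P) (Sum.inr ⟨j, c⟩ : CatE op P) := by
  refine ⟨fun h0 => hbc (eq_of_heq (Sigma.mk.inj_iff.1 (Sum.inr.inj h0)).2),
    toCover_isLeaf_far_side h hp (s := ⟨j, b⟩) hb, toCover_isLeaf_far_side h hp (s := ⟨j, c⟩) hc,
    ?_, ?_⟩
  · change (op j).size * (op j).kind.mult b = (op j).size * (op j).kind.mult c
    rw [hm]
  · rw [toCover_near_side h hp ⟨j, b⟩, toCover_near_side h hp ⟨j, c⟩, catNear, catNear, hn]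

theorem toCover_symCycle_side {j : Fin P} {b c : Fin (op j).kind.numE} (hbc : b ≠ c)
    (hn : (op j).kind.near c = (op j).kind.near b) (hf : (op j).kind.far b = (op j).kind.far c)
    (hb : (op j).kind.far b ≠ none) (hm : (op j).kind.mult b = (op j).kind.mult c) :
    (Φ).SymCycle (Sum.inr ⟨j, b⟩ : CatE op P) (Sum.inr ⟨j, c⟩ : CatE op P) := by
  obtain ⟨v, hv⟩ := Option.ne_none_iff_exists'.1 hb
  have hv' := hf.symm.trans hv
  have e1 : (Φ).near (tailSide (op j)) (Sum.inr ⟨j, b⟩ : CatE op P) =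
      (Φ).near (tailSide (op j)) (Sum.inr ⟨j, c⟩ : CatE op P) := by
    rw [toCover_near_side h hp ⟨j, b⟩, toCover_near_side h hp ⟨j, c⟩, catNear, catNear, hn]
  have e2 : (Φ).far (tailSide (op j)) (Sum.inr ⟨j, b⟩ : CatE op P) =
      (Φ).far (tailSide (op j)) (Sum.inr ⟨j, c⟩ : CatE op P) := by
    rw [toCover_far_side h hp (s := ⟨j, b⟩) (catFar_eq_inr.2 ⟨b, rfl, hv⟩),
      toCover_far_side h hp (s := ⟨j, c⟩) (catFar_eq_inr.2 ⟨c, rfl, hv'⟩)]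
  refine ⟨fun h0 => hbc (eq_of_heq (Sigma.mk.inj_iff.1 (Sum.inr.inj h0)).2),
    toCover_not_isEnd_side h hp (s := ⟨j, b⟩) hb,
    toCover_not_isEnd_side h hp (s := ⟨j, c⟩) (hf ▸ hb), ?_, ?_⟩
  · change (op j).size * (op j).kind.mult b = (op j).size * (op j).kind.mult c
    rw [hm]
  · unfold tailSide at e1 e2
    split_ifs at e1 e2 with h0
    · exact ⟨e1, e2⟩
    · exact ⟨e2, e1⟩

/-- Each kind of tail is one of the allowed forms: an even end, a fork, or a symmetric odd cycle
continued by a fork. Taking `T` with an equation lets it be replaced by the explicit set of edges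
for each kind. -/
theorem toCover_isTail {j : Fin P} (hev : (op j).kind = TailKind.single → Even (op j).size)
    (hodd : (op j).kind ≠ TailKind.single → Odd (op j).size) {T : Set (CatE op P)}
    (hTj : T = {e : CatE op P | ∃ e', e = Sum.inr ⟨j, e'⟩}) :
    (Φ).IsTail (tailSide (op j)) (Sum.inl (Sum.inl j)) T := by
  have hstem : (Φ).near (tailSide (op j)) (Sum.inr ⟨j, (op j).kind.stem⟩ : CatE op P) =
      Sum.inl (Sum.inl j) := by
    rw [toCover_near_side h hp ⟨j, (op j).kind.stem⟩, catNear_eq_inl.2 rfl]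
  have hwt : ∀ e, (op j).kind.mult e = 1 → (Φ).weight (Sum.inr ⟨j, e⟩ : CatE op P) = (op j).size :=
    fun e he => by
      change (op j).size * (op j).kind.mult e = _
      rw [he, mul_one]
  rcases (op j).kind.eq_or with hk | hk | hk
  · obtain ⟨h1, h2, h3, -⟩ := (op j).kind.single_spec hk
    have hT : {e : CatE op P | ∃ e', e = Sum.inr ⟨j, e'⟩} =
        {Sum.inr ⟨j, (op j).kind.stem⟩} := by
      ext e
      constructor
      · rintro ⟨e', rfl⟩
        rw [h3 e']
        rfl
      · rintro rfl
        exact ⟨_, rfl⟩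
    obtain rfl := hTj.trans hT
    obtain ⟨u, hu⟩ := (hev hk).two_dvd
    have hw := (hwt _ h2).trans hu
    -- An end of weight `2u` is an admissible tail for either parity of `u`, but under different
    -- clauses of the definition.
    rcases Nat.even_or_odd u with hu' | hu'
    · exact Or.inr ⟨_, rfl, hstem, toCover_isLeaf_far_side h hp (s := ⟨j, _⟩) h1, u, hu', hw⟩
    · have := TropicalCover.IsOddTail.single (φ := Φ) (s := tailSide (op j))
        (Sum.inr ⟨j, (op j).kind.stem⟩ : CatE op P)
        (toCover_isLeaf_far_side h hp (s := ⟨j, _⟩) h1) ⟨u, hu', hw⟩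
      rw [hstem] at this
      exact Or.inl this
  · obtain ⟨b, c, h1, h2, h3, h4, h5, h6, h7, h8, h9⟩ := (op j).kind.fork_spec hk
    have hT : {e : CatE op P | ∃ e', e = Sum.inr ⟨j, e'⟩} =
        {Sum.inr ⟨j, (op j).kind.stem⟩, Sum.inr ⟨j, b⟩, Sum.inr ⟨j, c⟩} := by
      ext e
      constructor
      · rintro ⟨e', rfl⟩
        rcases h9 e' with rfl | rfl | rfl
        · exact Or.inl rfl
        · exact Or.inr (Or.inl rfl)
        · exact Or.inr (Or.inr rfl)
      · rintro (rfl | rfl | rfl) <;> exact ⟨_, rfl⟩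
    have := TropicalCover.IsOddTail.fork (φ := Φ) (s := tailSide (op j))
      (Sum.inr ⟨j, (op j).kind.stem⟩ : CatE op P) (Sum.inr ⟨j, b⟩ : CatE op P)
      (Sum.inr ⟨j, c⟩ : CatE op P) (toCover_near_eq_far h hp h2 h4)
      (toCover_symFork_side h hp h1 h3 h5 h6 (h7.trans h8.symm))
      (by rw [hwt _ h7]; exact hodd (by rw [hk]; exact TailKind.noConfusion))
    rw [hstem] at this
    obtain rfl := hTj.trans hT
    exact Or.inl this
  · obtain ⟨b, c, h1, h2, h3, h4, h5, h6, h7, h8, a', h9, h10, b', c', g1, g2, g3, g4, g5, g6, g7,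
      g8, g9⟩ := (op j).kind.cyc_spec hk
    have hT : {e : CatE op P | ∃ e', e = Sum.inr ⟨j, e'⟩} =
        {Sum.inr ⟨j, (op j).kind.stem⟩, Sum.inr ⟨j, b⟩, Sum.inr ⟨j, c⟩} ∪
          {Sum.inr ⟨j, a'⟩, Sum.inr ⟨j, b'⟩, Sum.inr ⟨j, c'⟩} := by
      ext e
      constructor
      · rintro ⟨e', rfl⟩
        rcases g9 e' with rfl | rfl | rfl | rfl | rfl | rfl
        · exact Or.inl (Or.inl rfl)
        · exact Or.inl (Or.inr (Or.inl rfl))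
        · exact Or.inl (Or.inr (Or.inr rfl))
        · exact Or.inr (Or.inl rfl)
        · exact Or.inr (Or.inr (Or.inl rfl))
        · exact Or.inr (Or.inr (Or.inr rfl))
      · rintro ((rfl | rfl | rfl) | (rfl | rfl | rfl)) <;> exact ⟨_, rfl⟩
    have hs := hodd (by rw [hk]; exact TailKind.noConfusion)
    have t1 := TropicalCover.IsOddTail.fork (φ := Φ) (s := tailSide (op j))
      (Sum.inr ⟨j, a'⟩ : CatE op P) (Sum.inr ⟨j, b'⟩ : CatE op P)
      (Sum.inr ⟨j, c'⟩ : CatE op P) (toCover_near_eq_far h hp g2 g4)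
      (toCover_symFork_side h hp g1 g3 g5 g6 (g7.trans g8.symm))
      (by rw [hwt _ g7]; exact hs)
    rw [toCover_near_eq_far h hp h9.symm (by rw [h9]; exact h6)] at t1
    have t2 := TropicalCover.IsOddTail.cycle (φ := Φ) (s := tailSide (op j))
      (Sum.inr ⟨j, (op j).kind.stem⟩ : CatE op P) (Sum.inr ⟨j, b⟩ : CatE op P)
      (Sum.inr ⟨j, c⟩ : CatE op P) _ (toCover_near_eq_far h hp h2 h4)
      (toCover_symCycle_side h hp h1 h3 h5 h6 (h7.trans h8.symm))
      (by rw [hwt _ h7]; exact hs) t1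
    rw [hstem] at t2
    obtain rfl := hTj.trans hT
    exact Or.inl t2

end Tail

namespace CatEffective

/-- Strings and links together cover the entire spine and the single odd ends of the link block.
Hence only the other tails remain in the complement. -/
theorem mem_union_iff (h : CatEffective op P q n) (L : Fin n → Set (CatE op P))
    (hL : ∀ k, L k = {Sum.inl ⟨q + 2 * k + 1, by have := h.lt; omega⟩}) (e : CatE op P) :
    e ∈ (⋃ i, catString op P q n i) ∪ ⋃ i, L i ↔
      ∀ s, e = Sum.inr s → q ≤ s.1.1 ∧ s.1.1 < q + 2 * n := by
  have hidx : catStringIdx q n e < n + 1 ∨ ¬ catIsString q n e := by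
    rcases e with j | ⟨j, e⟩
    · simp only [catStringIdx]
      omega
    · simp only [catStringIdx, catIsString]
      omega
  simp only [Set.mem_union, Set.mem_iUnion, hL, Set.mem_singleton_iff]
  constructor
  · rintro (⟨i, hi⟩ | ⟨i, rfl⟩)
    · rintro s rfl
      exact hi.1
    · rintro s h0
      cases h0
  · intro h0
    by_cases he : catIsString q n e
    · exact Or.inl ⟨⟨catStringIdx q n e, hidx.resolve_right (not_not.2 he)⟩, he, rfl⟩
    · right
      rcases e with j | s
      · obtain ⟨k, hk, h1⟩ := not_not.1 he
        exact ⟨⟨k, hk⟩, congrArg _ (Fin.ext h1)⟩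
      · exact absurd (h0 s rfl) he

theorem isEffectiveNonZigzag (h : CatEffective op P q n) {p : CatV op P → ℝ}
    (hp : (catGraph op P).IsIncreasing p) {r : ℕ} {x : Fin r → ℝ}
    (hx : ∀ j : Fin P, q ≤ j.1 → j.1 < q + 2 * n →
      ∃ i : Fin r, (i : ℕ) + 1 ≤ (r + 1) / 2 ∧ p (Sum.inl j) = x i) :
    (OpenGraph.toCover (catGraph_isAdmissible h.toCatAdmissible) hp).IsEffectiveNonZigzag x := by
  have hlt := h.lt
  have hq := h.q_pos
  have hn := h.n_pos
  have hadm := catGraph_isAdmissible h.toCatAdmissible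
  have hlink : ∀ k : Fin n, q + 2 * k.1 + 1 < P + 1 := fun k => by omega
  obtain ⟨L, hL⟩ : ∃ L : Fin n → Set (CatE op P), ∀ k, L k = {Sum.inl ⟨q + 2 * k + 1, hlink k⟩} :=
    ⟨_, fun _ => rfl⟩
  have hmemU := h.mem_union_iff L hL
  have hsrc : ∀ k : Fin n, (catGraph op P).src (Sum.inl ⟨q + 2 * k + 1, hlink k⟩) =
      some (Sum.inl ⟨q + 2 * k, by omega⟩) := fun k =>
    src_spine _ _ (h.flow_pos _ (by omega) (by omega))
  have htgt : ∀ k : Fin n, (catGraph op P).tgt (Sum.inl ⟨q + 2 * k + 1, hlink k⟩) =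
      some (Sum.inl ⟨q + 2 * k + 1, by omega⟩) := fun k =>
    tgt_spine _ (by omega) (h.flow_pos _ (by omega) (by omega))
  refine ⟨n, catString op P q n, L, by omega, ?_, ?_, ?_, ?_, ?_⟩
  · intro i
    refine ⟨?_, fun e he => h.odd_of_isString he.1, ?_⟩
    · refine OpenGraph.toCover_isString _ hp (Sum.inl ⟨q + 2 * i, by omega⟩) ?_
        (h.string_connected i _ rfl) ?_
      · constructor
        · rintro ⟨k, hk, h0⟩
          simp only at h0
          omega
        · simp only [catStringIdx]
          omega
      · rintro (j | ⟨j, v⟩) ⟨e, he, hev⟩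
        · obtain ⟨a, b, hab, hidx, hiff⟩ := h.exists_pair j
          have hai : catStringIdx q n a = i := by
            rcases (hiff e).1 ⟨hev, he.1⟩ with rfl | rfl
            · exact he.2
            · exact hidx.trans he.2
          rw [← Set.ncard_pair hab]
          congr 1
          ext f
          constructor
          · rintro ⟨hf, hfv⟩
            exact (hiff f).1 ⟨hfv, hf.1⟩
          · intro hf
            have h1 := (hiff f).2 hf
            refine ⟨⟨h1.2, ?_⟩, h1.1⟩
            rcases hf with rfl | rfl
            · exact hai
            · exact hidx.symm.trans hai
        · obtain ⟨e', rfl, -⟩ := catGraph_touches_side.1 hev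
          exact (h.isEmpty_of_link he.1.1 he.1.2 v).elim
    · refine Set.disjoint_left.2 ?_
      rintro e he ⟨f, hf | ⟨-, s, hf⟩⟩
      · have hend := mt (OpenGraph.toCurve_isEnd_iff hadm hp e).2 hf.2.1
        obtain ⟨v, w, hvw, h1, h2, h3, h4, hne⟩ := OpenGraph.toCover_symCycle hadm hp hf
        rcases e with j | ⟨j, e⟩
        · exact hne (not_symCycle v w hvw h1 h2 h3 h4).symm
        · have hs := he.1
          have h5 := (op j).kind.single_spec (h.link_kind j hs.1 hs.2)
          have h6 := h5.2.2.1 e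
          subst h6
          rw [catGraph_src_inr_eq_none, catGraph_tgt_inr_eq_none] at hend
          simp only [h5.1, and_true] at hend
          cases ho : (op j).out <;> simp [ho] at hend
      · obtain ⟨h1, h2, h3, h4, h5⟩ := OpenGraph.toCover_symFork hadm hp hf
        exact h.not_symFork h1 h2 h3 h4 h5 he.1
  · intro i j hij
    refine Set.disjoint_left.2 ?_
    intro e he he'
    exact hij (Fin.ext (he.2.symm.trans he'.2))
  · intro k
    -- The flow is positive on the link block, so string `k` lies to the left of its link. Neither
    -- string bends: the left one passes from the spine into the right end, the right one from the
    -- left end into the spine.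
    left
    left
    refine ⟨Sum.inl (Sum.inl ⟨q + 2 * k, by omega⟩), Sum.inl (Sum.inl ⟨q + 2 * k + 1, by omega⟩),
      ?_, ⟨Sum.inl ⟨q + 2 * k, by omega⟩, ⟨?_, ?_⟩, ?_⟩,
      ⟨Sum.inr ⟨⟨q + 2 * k, by omega⟩, (op (q + 2 * k)).kind.stem⟩, ⟨?_, ?_⟩, ?_⟩,
      ⟨Sum.inr ⟨⟨q + 2 * k + 1, by omega⟩, (op (q + 2 * k + 1)).kind.stem⟩, ⟨?_, ?_⟩, ?_⟩,
      ⟨Sum.inl ⟨q + 2 * k + 1 + 1, by omega⟩, ⟨?_, ?_⟩, ?_⟩⟩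
    · rw [hL]
      have h1 := ((catGraph op P).srcV_eq_inl).2 (hsrc k)
      have h2 := ((catGraph op P).tgtV_eq_inl).2 (htgt k)
      have := TropicalCover.IsEvenChain.single (φ := OpenGraph.toCover hadm hp)
        (Sum.inl ⟨q + 2 * k + 1, hlink k⟩ : CatE op P) ?_ ?_
      · change (OpenGraph.toCover hadm hp).IsEvenChain ((catGraph op P).srcV _)
          ((catGraph op P).tgtV _) _ at this
        rw [h1, h2] at this
        exact this
      · intro h0
        have h0 := (OpenGraph.toCurve_isEnd_iff hadm hp _).1 h0
        rw [hsrc, htgt] at h0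
        simp at h0
      · have h3 := (h.odd_flow_iff (q + 2 * k + 1) (by omega)).not.2
          (not_not.2 ⟨k, k.2, rfl⟩)
        exact Nat.not_odd_iff_even.1 h3
    · rintro ⟨k', hk', h0⟩
      simp only at h0
      omega
    · simp only [catStringIdx, Fin.val_castSucc]
      omega
    · exact ((catGraph op P).tgtV_eq_inl).2
        (tgt_spine _ (by omega) (h.flow_pos _ (by omega) (by omega)))
    · exact ⟨by simp, by simp only; omega⟩
    · simp only [catStringIdx, Fin.val_castSucc]
      omega
    · exact ((catGraph op P).srcV_eq_inl).2
        ((catGraph_src_stem (⟨q + 2 * k, by omega⟩ : Fin P)).2 (h.link_out k k.2))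
    · exact ⟨by simp only; omega, by simp only; omega⟩
    · simp only [catStringIdx, Fin.val_succ]
      omega
    · exact ((catGraph op P).tgtV_eq_inl).2
        ((catGraph_tgt_stem (⟨q + 2 * k + 1, by omega⟩ : Fin P)).2
          (by rw [Bool.not_eq_true]; exact h.link_in k k.2))
    · rintro ⟨k', hk', h0⟩
      simp only at h0
      omega
    · simp only [catStringIdx, Fin.val_succ]
      omega
    · exact ((catGraph op P).srcV_eq_inl).2
        (src_spine _ (by omega) (h.flow_pos _ (by omega) (by omega)))
  · rintro T ⟨e, he, hT⟩
    have he' := (hmemU e).not.1 he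
    push Not at he'
    obtain ⟨⟨j, e'⟩, rfl, hj⟩ := he'
    have hj' : ¬ (q ≤ j.1 ∧ j.1 < q + 2 * n) := by
      simp only at hj
      omega
    have hTj : T = {e : CatE op P | ∃ e', e = Sum.inr ⟨j, e'⟩} := by
      have hfree : ∀ v : Fin (op j).kind.numV, ∀ f ∈ (⋃ i, catString op P q n i) ∪ ⋃ i, L i,
          ¬ (catGraph op P).Touches f (Sum.inr ⟨j, v⟩) := by
        intro v f hf hfv
        obtain ⟨f', rfl, -⟩ := catGraph_touches_side.1 hfv
        exact hj' ((hmemU _).1 hf _ rfl)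
      -- The component is the whole tail at `j`: its edges are connected through vertices of the
      -- tail, and the only vertex it shares with the rest lies on the spine, hence in the removed
      -- subgraph.
      refine OpenGraph.toCover_complComponent_eq hadm hp (T' := {e | ∃ e', e = Sum.inr ⟨j, e'⟩})
        ⟨e', rfl⟩ hT ?_ ?_ ?_
      · rintro _ ⟨f, rfl⟩ hf
        exact hj' ((hmemU _).1 hf _ rfl)
      · rintro _ ⟨a, rfl⟩ (i | ⟨i, v⟩) hv hav b hb
        · exact absurd (catGraph_touches_spine.2 (Or.inl rfl))
            (hv (Sum.inl i.castSucc) ((hmemU _).2 fun s h0 => by cases h0))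
        · obtain ⟨a', h1, -⟩ := catGraph_touches_side.1 hav
          obtain ⟨b', h2, -⟩ := catGraph_touches_side.1 hb
          obtain ⟨rfl, -⟩ := Sigma.mk.inj_iff.1 (Sum.inr.inj h1)
          exact ⟨b', h2⟩
      · rintro _ ⟨a, rfl⟩ _ ⟨b, rfl⟩
        refine Relation.ReflTransGen.lift (fun e => (Sum.inr ⟨j, e⟩ : CatE op P)) ?_ _ _
          ((op j).kind.connected a b)
        rintro c d ⟨v, hc, hd⟩
        exact ⟨⟨c, rfl⟩, ⟨d, rfl⟩, Sum.inr ⟨j, v⟩, hfree v, catGraph_touches_side.2 ⟨c, rfl, hc⟩,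
          catGraph_touches_side.2 ⟨d, rfl, hd⟩⟩
    have hstr : catIsString q n (Sum.inl j.castSucc : CatE op P) := by
      rintro ⟨k, hk, h0⟩
      rw [Fin.val_castSucc] at h0
      omega
    refine ⟨⟨catStringIdx q n (Sum.inl j.castSucc : CatE op P), ?_⟩, Sum.inl (Sum.inl j),
      ⟨Sum.inl j.castSucc, ⟨hstr, rfl⟩, ?_⟩, tailSide (op j), ?_⟩
    · simp only [catStringIdx]
      omega
    · exact (OpenGraph.toCover_touches_inl hadm hp).2 (catGraph_touches_spine.2 (Or.inl rfl))
    · exact toCover_isTail h.toCatAdmissible hp (h.single_even j j.2 hj')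
        (h.odd_of_ne_single j j.2 hj') hTj
  · rintro k v ⟨e, he, hev⟩
    rw [hL] at he
    have he : e = (Sum.inl ⟨q + 2 * k + 1, hlink k⟩ : CatE op P) := he
    subst he
    have h1 := ((catGraph op P).srcV_eq_inl).2 (hsrc k)
    have h2 := ((catGraph op P).tgtV_eq_inl).2 (htgt k)
    rcases hev with hev | hev
    · change (catGraph op P).srcV _ = v at hev
      rw [h1] at hev
      subst hev
      obtain ⟨i, hi, hpi⟩ := hx ⟨q + 2 * k, by omega⟩ (by simp) (by simp only; omega)
      exact ⟨i, hi, congrArg (fun a : ℝ => (a : EReal)) hpi⟩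
    · change (catGraph op P).tgtV _ = v at hev
      rw [h2] at hev
      subst hev
      obtain ⟨i, hi, hpi⟩ := hx ⟨q + 2 * k + 1, by omega⟩ (by simp only; omega) (by simp only; omega)
      exact ⟨i, hi, congrArg (fun a : ℝ => (a : EReal)) hpi⟩

end CatEffective

end Effective

/-! ### Placing the vertices over the branch points in the order of a key -/

section KeyRank

variable {V κ : Type*} [Fintype V] [LinearOrder κ]

/-- The number of elements with a smaller key. -/
def keyRank (key : V → κ) (v : V) : ℕ := (Finset.univ.filter fun w => key w < key v).card

theorem keyRank_lt_keyRank {key : V → κ} {v w : V} (h : key v < key w) :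
    keyRank key v < keyRank key w := by
  refine Finset.card_lt_card ⟨fun u hu => ?_, fun hsub => ?_⟩
  · rw [Finset.mem_filter] at hu ⊢
    exact ⟨hu.1, hu.2.trans h⟩
  · have := hsub (Finset.mem_filter.2 ⟨Finset.mem_univ v, h⟩)
    exact lt_irrefl _ (Finset.mem_filter.1 this).2

theorem keyRank_lt_iff {key : V → κ} {v w : V} :
    keyRank key v < keyRank key w ↔ key v < key w := by
  refine ⟨fun h => ?_, keyRank_lt_keyRank⟩
  by_contra h'
  rcases (not_lt.1 h').lt_or_eq with h1 | h1
  · exact lt_asymm h (keyRank_lt_keyRank h1)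
  · rw [keyRank, keyRank, h1] at h
    exact lt_irrefl _ h

theorem keyRank_lt_card (key : V → κ) (v : V) : keyRank key v < Fintype.card V := by
  rw [← Finset.card_univ]
  refine Finset.card_lt_card ⟨Finset.subset_univ _, fun hsub => ?_⟩
  exact lt_irrefl _ (Finset.mem_filter.1 (hsub (Finset.mem_univ v))).2

/-- The points `x 0 < x 1 < ...`, placed in the order of the keys. -/
def keyPos (key : V → κ) {r : ℕ} (hr : Fintype.card V = r) (x : Fin r → ℝ) (v : V) : ℝ :=
  x ⟨keyRank key v, hr ▸ keyRank_lt_card key v⟩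

variable {key : V → κ} {r : ℕ} (hr : Fintype.card V = r) {x : Fin r → ℝ}

theorem keyPos_lt (hx : StrictMono x) {v w : V} (h : key v < key w) :
    keyPos key hr x v < keyPos key hr x w :=
  hx (Fin.mk_lt_mk.2 (keyRank_lt_keyRank h))

theorem keyRank_injective (hkey : Function.Injective key) : Function.Injective (keyRank key) := by
  intro v w h
  by_contra hne
  rcases lt_or_gt_of_ne (hkey.ne hne) with h1 | h1
  · exact (keyRank_lt_keyRank h1).ne h
  · exact (keyRank_lt_keyRank h1).ne h.symm

theorem keyPos_injective (hx : StrictMono x) (hkey : Function.Injective key) :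
    Function.Injective (keyPos key hr x) := fun _ _ h =>
  keyRank_injective hkey (Fin.mk.inj (hx.injective h))

theorem exists_keyPos_eq (hkey : Function.Injective key) (i : Fin r) :
    ∃ v, keyPos key hr x v = x i := by
  have h1 : Function.Injective fun v => (⟨keyRank key v, hr ▸ keyRank_lt_card key v⟩ : Fin r) :=
    fun _ _ h => keyRank_injective hkey (Fin.mk.inj h)
  obtain ⟨v, hv⟩ := ((Fintype.bijective_iff_injective_and_card _).2
    ⟨h1, by rw [hr, Fintype.card_fin]⟩).2 i
  exact ⟨v, congrArg x hv⟩

end KeyRank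

/-- `b ∘ a⁻¹` is an order automorphism of a finite chain, hence the identity. -/
theorem Equiv.Perm.eq_of_lt_iff {K : ℕ} {a b : Equiv.Perm (Fin K)}
    (h : ∀ i j, a i < a j ↔ b i < b j) : a = b := by
  let f : Fin K ≃o Fin K :=
    { toEquiv := a.symm.trans b
      map_rel_iff' := by
        intro i j
        have := h (a.symm j) (a.symm i)
        rw [a.apply_symm_apply, a.apply_symm_apply] at this
        rw [← not_lt, ← not_lt, this]
        rfl }
  have hf : f = OrderIso.refl _ := Subsingleton.elim _ _
  ext i
  have := congrArg (fun g : Fin K ≃o Fin K => g (a i)) hf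
  have h2 : b (a.symm (a i)) = a i := this
  rw [a.symm_apply_apply] at h2
  rw [h2]

/-- A permutation, extended to the natural numbers. -/
def permNat {K : ℕ} (σ : Equiv.Perm (Fin K)) (i : ℕ) : ℕ :=
  if h : i < K then (σ ⟨i, h⟩).1 else i

theorem permNat_of_lt {K : ℕ} (σ : Equiv.Perm (Fin K)) (i : Fin K) : permNat σ i = σ i := by
  rw [permNat, dif_pos i.2]

theorem permNat_inj {K : ℕ} (σ : Equiv.Perm (Fin K)) {i j : ℕ} (hi : i < K) (hj : j < K)
    (h : permNat σ i = permNat σ j) : i = j := by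
  rw [permNat, permNat, dif_pos hi, dif_pos hj] at h
  exact congrArg Fin.val (σ.injective (Fin.ext h))

/-! ### The zigzag and the orders of its vertices -/

section Zigzag

variable {op : ℕ → TailOp} {c K : ℕ}

variable (op c K) in
/-- From the vertex `c` on, the spine is a zigzag with alternating forks on the right and on the
left. -/
structure CatZigzag : Prop where
  c_pos : 0 < c
  K_pos : 0 < K
  flow_pos : ∀ j ≤ c, 0 < catFlow op j
  flow_eq : catFlow op c = 1
  right : ∀ i < K, op (c + 2 * i) = ⟨true, TailKind.fork, 1⟩
  left : ∀ i < K, op (c + 2 * i + 1) = ⟨false, TailKind.fork, 1⟩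

theorem TailKind.numV_le (k : TailKind) : k.numV ≤ 3 := by
  cases k <;> decide

/-- The position of the vertices of the base, followed by those of the zigzag which are permuted. -/
def catKey (σ : Fin 4 → Equiv.Perm (Fin K)) : CatV op (c + 2 * K) → ℕ ×ₗ ℕ
  | .inl j => if j.1 < c then toLex (1, j.1) else
      if (j.1 - c) % 2 = 0 then toLex (5, permNat (σ 2) ((j.1 - c) / 2)) else
        toLex (4, permNat (σ 1) ((j.1 - c) / 2))
  | .inr s => if s.1.1 < c then
      if (op s.1).out then toLex (2, 3 * s.1.1 + s.2.1) else toLex (0, 3 * s.1.1 + (2 - s.2.1)) else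
      if (s.1.1 - c) % 2 = 0 then toLex (6, permNat (σ 3) ((s.1.1 - c) / 2)) else
        toLex (3, permNat (σ 0) ((s.1.1 - c) / 2))

/-- The vertices before the zigzag. -/
def catIsBase : CatV op (c + 2 * K) → Prop
  | .inl j => j.1 < c
  | .inr s => s.1.1 < c

namespace CatZigzag

theorem sgn_right (h : CatZigzag op c K) {i : ℕ} (hi : i < K) : (op (c + 2 * i)).sgn = -2 := by
  rw [h.right i hi]
  rfl

theorem sgn_left (h : CatZigzag op c K) {i : ℕ} (hi : i < K) : (op (c + 2 * i + 1)).sgn = 2 := by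
  rw [h.left i hi]
  rfl

theorem flow_even (h : CatZigzag op c K) (i : ℕ) (hi : i ≤ K) : catFlow op (c + 2 * i) = 1 := by
  induction i with
  | zero => exact h.flow_eq
  | succ i ih =>
    have e : c + 2 * (i + 1) = c + 2 * i + 1 + 1 := by ring
    rw [e, catFlow_succ, catFlow_succ, ih (by omega), h.sgn_right (by omega),
      h.sgn_left (by omega)]
    rfl

theorem flow_odd (h : CatZigzag op c K) (i : ℕ) (hi : i < K) :
    catFlow op (c + 2 * i + 1) = -1 := by
  rw [catFlow_succ, h.flow_even i hi.le, h.sgn_right hi]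
  rfl

theorem kind_eq (h : CatZigzag op c K) {j : ℕ} (h1 : c ≤ j) (h2 : j < c + 2 * K) :
    (op j).kind = TailKind.fork := by
  rcases Nat.even_or_odd' (j - c) with ⟨i, hi | hi⟩
  · rw [show j = c + 2 * i by omega, h.right i (by omega)]
  · rw [show j = c + 2 * i + 1 by omega, h.left i (by omega)]

theorem out_iff (h : CatZigzag op c K) {j : ℕ} (h1 : c ≤ j) (h2 : j < c + 2 * K) :
    (op j).out = true ↔ (j - c) % 2 = 0 := by
  rcases Nat.even_or_odd' (j - c) with ⟨i, hi | hi⟩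
  · rw [show j = c + 2 * i by omega, h.right i (by omega)]
    simp
  · rw [show j = c + 2 * i + 1 by omega, h.left i (by omega)]
    simp only [Bool.false_eq_true, false_iff]
    omega

theorem flow_pos_iff (h : CatZigzag op c K) {j : ℕ} (h1 : c ≤ j) (h2 : j ≤ c + 2 * K) :
    0 < catFlow op j ↔ (j - c) % 2 = 0 := by
  rcases Nat.even_or_odd' (j - c) with ⟨i, hi | hi⟩
  · rw [show j = c + 2 * i by omega, h.flow_even i (by omega)]
    simp
  · rw [show j = c + 2 * i + 1 by omega, h.flow_odd i (by omega)]
    omega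

theorem val_eq_zero (h : CatZigzag op c K) {j : Fin (c + 2 * K)} (h1 : c ≤ j.1)
    (v : Fin (op j).kind.numV) : v.1 = 0 := by
  have h3 : (op j).kind.numV = 1 := by rw [h.kind_eq h1 j.2]; rfl
  omega

/-- In the base, `j` and `v` can be recovered from `3 * j + v` and from `3 * j + (2 - v)`, as a tail
has at most three vertices. In the zigzag every tail has a single vertex, so its level and its
permuted index suffice. -/
theorem key_injective (h : CatZigzag op c K) (σ : Fin 4 → Equiv.Perm (Fin K)) :
    Function.Injective (catKey σ : CatV op (c + 2 * K) → ℕ ×ₗ ℕ) := by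
  have hlex : ∀ a b a' b' : ℕ, toLex (a, b) = toLex (a', b') → a = a' ∧ b = b' := by
    intro a b a' b' h0
    exact Prod.mk.inj (toLex.injective h0)
  rintro (i | ⟨i, v⟩) (j | ⟨j, w⟩) hij
  · simp only [catKey] at hij
    have hi := i.2
    have hj := j.2
    congr 1
    apply Fin.ext
    split_ifs at hij with h1 h2 h3 h4 h5 h6 h7 h8
    all_goals
      obtain ⟨g1, g2⟩ := hlex _ _ _ _ hij
      first
      | omega
      | (have := permNat_inj _ (by omega) (by omega) g2
         omega)
  · simp only [catKey] at hij
    split_ifs at hij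
    all_goals
      obtain ⟨g1, g2⟩ := hlex _ _ _ _ hij
      omega
  · simp only [catKey] at hij
    split_ifs at hij
    all_goals
      obtain ⟨g1, g2⟩ := hlex _ _ _ _ hij
      omega
  · simp only [catKey] at hij
    have hi := i.2
    have hj := j.2
    have hv := v.2
    have hw := w.2
    have hv3 := (op i).kind.numV_le
    have hw3 := (op j).kind.numV_le
    have key : i.1 = j.1 ∧ v.1 = w.1 := by
      by_cases hic : i.1 < c
      · by_cases hjc : j.1 < c
        · rw [if_pos hic, if_pos hjc] at hij
          split_ifs at hij
          all_goals
            obtain ⟨g1, g2⟩ := hlex _ _ _ _ hij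
            omega
        · rw [if_pos hic, if_neg hjc] at hij
          split_ifs at hij
          all_goals
            obtain ⟨g1, g2⟩ := hlex _ _ _ _ hij
            omega
      · by_cases hjc : j.1 < c
        · rw [if_neg hic, if_pos hjc] at hij
          split_ifs at hij
          all_goals
            obtain ⟨g1, g2⟩ := hlex _ _ _ _ hij
            omega
        · rw [if_neg hic, if_neg hjc] at hij
          have e1 := h.val_eq_zero (not_lt.1 hic) v
          have e2 := h.val_eq_zero (not_lt.1 hjc) w
          split_ifs at hij
          all_goals
            obtain ⟨g1, g2⟩ := hlex _ _ _ _ hij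
            first
            | omega
            | (have := permNat_inj _ (by omega) (by omega) g2
               omega)
    obtain ⟨k1, k2⟩ := key
    obtain rfl : i = j := Fin.ext k1
    obtain rfl : v = w := Fin.ext k2
    rfl

/-- In the base, left tails come first, with vertices farther from the spine placed earlier; then
the spine, along which the flow is positive; then right tails. In the zigzag the levels 3, 4, 5, 6
hold left fork vertices, sources, sinks and right fork vertices. Inner edges only go from a lower to
a higher level there, so the permutations inside the levels do not matter. -/
theorem key_increasing (h : CatZigzag op c K) (σ : Fin 4 → Equiv.Perm (Fin K))
    {e : CatE op (c + 2 * K)} {v w : CatV op (c + 2 * K)}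
    (hv : (catGraph op (c + 2 * K)).src e = some v) (hw : (catGraph op (c + 2 * K)).tgt e = some w) :
    catKey σ v < catKey σ w := by
  rcases e with j | ⟨j, e⟩
  · have hj := j.2
    simp only [catGraph, catSrc, catTgt] at hv hw
    by_cases hpos : 0 < catFlow op j
    · rw [if_pos hpos, catPrev_eq_some] at hv
      rw [if_pos hpos, catNext_eq_some] at hw
      obtain ⟨i, hi, rfl⟩ := hv
      obtain ⟨k, hk, rfl⟩ := hw
      have hi' := congrArg Fin.val hi
      have hk' := congrArg Fin.val hk
      rw [Fin.val_succ] at hi'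
      rw [Fin.val_castSucc] at hk'
      have h0 : c ≤ j.1 → (j.1 - c) % 2 = 0 := fun h1 => (h.flow_pos_iff h1 (by omega)).1 hpos
      simp only [catKey]
      split_ifs <;> rw [Prod.Lex.toLex_lt_toLex] <;> simp <;> omega
    · rw [if_neg hpos, catNext_eq_some] at hv
      rw [if_neg hpos, catPrev_eq_some] at hw
      obtain ⟨i, hi, rfl⟩ := hv
      obtain ⟨k, hk, rfl⟩ := hw
      have hi' := congrArg Fin.val hi
      have hk' := congrArg Fin.val hk
      rw [Fin.val_castSucc] at hi'
      rw [Fin.val_succ] at hk'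
      have h1 : c < j.1 := by
        by_contra h1
        exact hpos (h.flow_pos _ (by omega))
      have h0 := (h.flow_pos_iff h1.le (by omega)).not.1 hpos
      simp only [catKey]
      split_ifs <;> rw [Prod.Lex.toLex_lt_toLex] <;> simp <;> omega
  · have hnf : ∀ a b : CatV op (c + 2 * K), catNear ⟨j, e⟩ = a → catFar ⟨j, e⟩ = some b →
        if (op j).out then catKey σ a < catKey σ b else catKey σ b < catKey σ a := by
      rintro a (b | ⟨i, w⟩) ha hb
      · exact absurd hb catFar_ne_inl
      · obtain ⟨e', h1, h2⟩ := catFar_eq_inr.1 hb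
        obtain ⟨rfl, h1⟩ := Sigma.mk.inj_iff.1 h1
        obtain rfl := eq_of_heq h1
        have hj := j.2
        have hw := w.2
        have hw3 := (op j).kind.numV_le
        have hout := fun h1 : c ≤ j.1 => h.out_iff h1 hj
        rcases a with a | ⟨a, u⟩
        · obtain ⟨rfl, -⟩ := Sigma.mk.inj_iff.1 (catNear_eq_inl.1 ha)
          simp only [catKey]
          split_ifs with g1 g2 g3 g4 g5 <;> rw [Prod.Lex.toLex_lt_toLex] <;> simp <;>
            first
            | omega
            | (have := hout (by omega)
               simp_all)
        · obtain ⟨e'', h3, h4⟩ := catNear_eq_inr.1 ha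
          obtain ⟨rfl, h3⟩ := Sigma.mk.inj_iff.1 h3
          obtain rfl := eq_of_heq h3
          have hlt : u.1 < w.1 := (op j).kind.near_lt_far _ _ _ h4 h2
          by_cases hjc : j.1 < c
          · simp only [catKey, if_pos hjc]
            split_ifs <;> rw [Prod.Lex.toLex_lt_toLex] <;> simp <;> omega
          · have := h.val_eq_zero (not_lt.1 hjc) w
            omega
    simp only [catGraph, catSrc, catTgt] at hv hw
    split_ifs at hv hw with ho
    · have := hnf v w (Option.some.inj hv) hw
      rwa [if_pos ho] at this
    · have := hnf w v (Option.some.inj hw) hv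
      rwa [if_neg ho] at this

theorem isIncreasing (h : CatZigzag op c K) (σ : Fin 4 → Equiv.Perm (Fin K)) {r : ℕ}
    (hr : Fintype.card (CatV op (c + 2 * K)) = r) {x : Fin r → ℝ} (hx : StrictMono x) :
    (catGraph op (c + 2 * K)).IsIncreasing (keyPos (catKey σ) hr x) :=
  fun _ _ _ hv hw => keyPos_lt hr hx (h.key_increasing σ hv hw)

theorem key_base (σ τ : Fin 4 → Equiv.Perm (Fin K)) {v : CatV op (c + 2 * K)} (hv : catIsBase v) :
    catKey σ v = catKey τ v := by
  rcases v with j | ⟨j, v⟩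
  · have hv : j.1 < c := hv
    simp only [catKey, if_pos hv]
  · have hv : j.1 < c := hv
    simp only [catKey, if_pos hv]

theorem key_lt_of_base (σ : Fin 4 → Equiv.Perm (Fin K)) {v w : CatV op (c + 2 * K)}
    (hv : catIsBase v) (hw : ¬ catIsBase w) : catKey σ v < catKey σ w := by
  have h1 : ∃ a b, catKey σ v = toLex (a, b) ∧ a ≤ 2 := by
    rcases v with j | ⟨j, v⟩
    · have hv : j.1 < c := hv
      simp only [catKey, if_pos hv]
      exact ⟨_, _, rfl, by omega⟩
    · have hv : j.1 < c := hv
      simp only [catKey, if_pos hv]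
      split_ifs
      · exact ⟨_, _, rfl, by omega⟩
      · exact ⟨_, _, rfl, by omega⟩
  have h2 : ∃ a b, catKey σ w = toLex (a, b) ∧ 3 ≤ a := by
    rcases w with j | ⟨j, v⟩
    · have hw : ¬ j.1 < c := hw
      simp only [catKey, if_neg hw]
      split_ifs
      · exact ⟨_, _, rfl, by omega⟩
      · exact ⟨_, _, rfl, by omega⟩
    · have hw : ¬ j.1 < c := hw
      simp only [catKey, if_neg hw]
      split_ifs
      · exact ⟨_, _, rfl, by omega⟩
      · exact ⟨_, _, rfl, by omega⟩
  obtain ⟨a, b, h1, ha⟩ := h1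
  obtain ⟨a', b', h2, ha'⟩ := h2
  rw [h1, h2, Prod.Lex.toLex_lt_toLex]
  exact Or.inl (by simp only; omega)

/-- The base is an initial segment of the order, and its keys do not involve the permutations. Its
vertices thus have the same positions in all the covers, which anchors the rigidity argument. -/
theorem keyRank_base (σ τ : Fin 4 → Equiv.Perm (Fin K)) {v : CatV op (c + 2 * K)}
    (hv : catIsBase v) : keyRank (catKey σ) v = keyRank (catKey τ) v := by
  unfold keyRank
  congr 1
  ext w
  simp only [Finset.mem_filter, Finset.mem_univ, true_and]
  by_cases hw : catIsBase w
  · rw [key_base σ τ hv, key_base σ τ hw]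
  · exact iff_of_false (key_lt_of_base σ hv hw).not_gt (key_lt_of_base τ hv hw).not_gt

/-- The `2K` spine vertices and `2K` fork vertices of the zigzag all come after the base. -/
theorem keyRank_base_add_le (h : CatZigzag op c K) (σ : Fin 4 → Equiv.Perm (Fin K))
    {v : CatV op (c + 2 * K)} (hv : catIsBase v) :
    keyRank (catKey σ) v + 1 + 4 * K ≤ Fintype.card (CatV op (c + 2 * K)) := by
  classical
  have hnum : ∀ i : Fin (2 * K), 0 < (op (c + i)).kind.numV := by
    intro i
    rw [h.kind_eq (by omega) (by omega)]
    exact Nat.one_pos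
  let f : Fin (2 * K) ⊕ Fin (2 * K) → CatV op (c + 2 * K) := Sum.elim
    (fun i => Sum.inl ⟨c + i, by omega⟩)
    (fun i => Sum.inr ⟨⟨c + i, by omega⟩, ⟨0, hnum i⟩⟩)
  have hf : Function.Injective f := by
    rintro (i | i) (j | j) hij
    · simp only [f, Sum.elim_inl, Sum.inl.injEq, Fin.mk.injEq] at hij
      exact congrArg _ (Fin.ext (by omega))
    · cases hij
    · cases hij
    · simp only [f, Sum.elim_inr, Sum.inr.injEq, Sigma.mk.injEq, Fin.mk.injEq] at hij
      exact congrArg _ (Fin.ext (by omega))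
  have hbase : ∀ i, ¬ catIsBase (f i) := by
    rintro (i | i) hi
    · have hi : c + i.1 < c := hi
      omega
    · have hi : c + i.1 < c := hi
      omega
  have hle : (insert v ((Finset.univ.filter fun w => catKey σ w < catKey σ v) ∪
      Finset.univ.image f)).card ≤ Fintype.card (CatV op (c + 2 * K)) := Finset.card_le_univ _
  rw [Finset.card_insert_of_notMem, Finset.card_union_of_disjoint,
    Finset.card_image_of_injective _ hf, Finset.card_univ, Fintype.card_sum, Fintype.card_fin] at hle
  · unfold keyRank
    omega
  · rw [Finset.disjoint_right]
    intro w hw hw'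
    obtain ⟨i, -, rfl⟩ := Finset.mem_image.1 hw
    exact (key_lt_of_base σ hv (hbase i)).not_gt (Finset.mem_filter.1 hw').2
  · rw [Finset.mem_union, not_or]
    refine ⟨fun h0 => lt_irrefl _ (Finset.mem_filter.1 h0).2, fun h0 => ?_⟩
    obtain ⟨i, -, rfl⟩ := Finset.mem_image.1 h0
    exact hbase i hv

end CatZigzag

end Zigzag

/-! ### Rigidity: different orders give non-isomorphic covers -/

namespace OpenGraph

variable {V E : Type} {G : OpenGraph V E} [Fintype V] [Fintype E] [DecidableEq V] [DecidableEq E]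
  (h : G.IsAdmissible) {p p' : V → ℝ} (hp : G.IsIncreasing p) (hp' : G.IsIncreasing p')

theorem posV_eq_coe_iff {p : V → ℝ} {a : V ⊕ G.Leaf} {t : ℝ} :
    G.posV p a = t ↔ ∃ v, a = Sum.inl v ∧ p v = t := by
  rcases a with v | l
  · simp [posV]
  · simp only [posV, reduceCtorEq, false_and, exists_false, iff_false]
    split_ifs
    · exact (EReal.coe_ne_bot t).symm
    · exact (EReal.coe_ne_top t).symm

section Iso

variable (i : TropicalCover.Iso (toCover h hp) (toCover h hp'))

theorem iso_exists_onV (v : V) : ∃ w, i.onV (Sum.inl v) = Sum.inl w ∧ p' w = p v :=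
  posV_eq_coe_iff.1 (i.pos_eq (Sum.inl v))

theorem iso_src {e : E} {v w : V} (he : G.src e = some v) (hv : i.onV (Sum.inl v) = Sum.inl w) :
    G.src (i.onE e) = some w := by
  have h1 := i.src_eq e
  change G.srcV (i.onE e) = i.onV (G.srcV e) at h1
  rw [G.srcV_eq_inl.2 he] at h1
  exact G.srcV_eq_inl.1 (h1.trans hv)

theorem iso_tgt {e : E} {v w : V} (he : G.tgt e = some v) (hv : i.onV (Sum.inl v) = Sum.inl w) :
    G.tgt (i.onE e) = some w := by
  have h1 := i.tgt_eq e
  change G.tgtV (i.onE e) = i.onV (G.tgtV e) at h1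
  rw [G.tgtV_eq_inl.2 he] at h1
  exact G.tgtV_eq_inl.1 (h1.trans hv)

theorem iso_touches {e : E} {v w : V} (he : G.Touches e v) (hv : i.onV (Sum.inl v) = Sum.inl w) :
    G.Touches (i.onE e) w := by
  rcases he with he | he
  · exact Or.inl (iso_src h hp hp' i he hv)
  · exact Or.inr (iso_tgt h hp hp' i he hv)

theorem iso_onV_of_onE {e : E} {v : V} (he : G.Touches e v) (hi : i.onE e = e) :
    i.onV (Sum.inl v) = Sum.inl v := by
  obtain ⟨w, hw, -⟩ := iso_exists_onV h hp hp' i v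
  rw [hw]
  rcases he with he | he
  · have h1 := iso_src h hp hp' i he hw
    rw [hi, he] at h1
    rw [Option.some.inj h1]
  · have h1 := iso_tgt h hp hp' i he hw
    rw [hi, he] at h1
    rw [Option.some.inj h1]

end Iso

end OpenGraph

theorem TailKind.far_stem_of_fork (k : TailKind) (hk : k = TailKind.fork) :
    ∀ w, k.far k.stem = some w := by
  subst hk
  decide

section Zigzag

variable {op : ℕ → TailOp} {c K : ℕ}

namespace CatZigzag

/-- An isomorphism between two covers with the same underlying caterpillar fixes the caterpillar. -/
theorem iso_onV_eq (h : CatZigzag op c K) (hadm : (catGraph op (c + 2 * K)).IsAdmissible)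
    (σ τ : Fin 4 → Equiv.Perm (Fin K)) {r : ℕ}
    (hr : Fintype.card (CatV op (c + 2 * K)) = r) {x : Fin r → ℝ} (hx : StrictMono x)
    (i : TropicalCover.Iso (OpenGraph.toCover hadm (h.isIncreasing σ hr hx))
      (OpenGraph.toCover hadm (h.isIncreasing τ hr hx))) (v : CatV op (c + 2 * K)) :
    i.onV (Sum.inl v) = Sum.inl v := by
  have hc := h.c_pos
  have hK := h.K_pos
  have hexists := OpenGraph.iso_exists_onV hadm (h.isIncreasing σ hr hx) (h.isIncreasing τ hr hx) i
  have hsrc := @OpenGraph.iso_src _ _ _ _ _ _ _ hadm _ _ (h.isIncreasing σ hr hx)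
    (h.isIncreasing τ hr hx) i
  have htgt := @OpenGraph.iso_tgt _ _ _ _ _ _ _ hadm _ _ (h.isIncreasing σ hr hx)
    (h.isIncreasing τ hr hx) i
  have htouch := @OpenGraph.iso_touches _ _ _ _ _ _ _ hadm _ _ (h.isIncreasing σ hr hx)
    (h.isIncreasing τ hr hx) i
  have hfix := @OpenGraph.iso_onV_of_onE _ _ _ _ _ _ _ hadm _ _ (h.isIncreasing σ hr hx)
    (h.isIncreasing τ hr hx) i
  obtain ⟨a, ha⟩ : ∃ a : CatE op (c + 2 * K) → CatE op (c + 2 * K), a = i.onE := ⟨_, rfl⟩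
  have hainj : Function.Injective a := by
    rw [ha]
    exact i.onE.injective
  -- Base vertices have the same position in both covers, and different vertices have different
  -- positions.
  have hbase : ∀ v : CatV op (c + 2 * K), catIsBase v → i.onV (Sum.inl v) = Sum.inl v := by
    intro v hv
    obtain ⟨w, hw, hpw⟩ := hexists v
    rw [hw]
    congr 1
    refine keyPos_injective hr hx (h.key_injective τ) (hpw.trans ?_)
    exact congrArg x (Fin.ext (keyRank_base σ τ hv))
  -- Edge `c` leaves the last base vertex for the first zigzag vertex. Its image also starts at that
  -- base vertex, and can only be the same edge or the stem there.
  have hstart : a (Sum.inl ⟨c, by omega⟩) = Sum.inl ⟨c, by omega⟩ := by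
    obtain ⟨b, rfl⟩ : ∃ b, c = b + 1 := ⟨c - 1, by omega⟩
    have h1 : (catGraph op (b + 1 + 2 * K)).src (Sum.inl ⟨b + 1, by omega⟩) =
        some (Sum.inl ⟨b, by omega⟩) := CatEffective.src_spine _ _ (h.flow_pos _ le_rfl)
    have h2 : (catGraph op (b + 1 + 2 * K)).tgt (Sum.inl ⟨b + 1, by omega⟩) =
        some (Sum.inl ⟨b + 1, by omega⟩) := CatEffective.tgt_spine _ (by omega) (h.flow_pos _ le_rfl)
    have hb : i.onV (Sum.inl (Sum.inl ⟨b, by omega⟩ : CatV op (b + 1 + 2 * K))) =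
        Sum.inl (Sum.inl ⟨b, by omega⟩) := hbase _ (Nat.lt_succ_self b)
    have h3 := hsrc h1 hb
    rw [← ha] at h3
    rcases catGraph_touches_spine.1 (Or.inl h3) with h4 | h4 | h4
    · rw [h4] at h3
      exact absurd (h.flow_pos b (by omega)) ((catGraph_src_castSucc _).1 h3)
    · exact h4
    -- If it were the stem, the zigzag vertex would be sent to a vertex of a base tail. That vertex
    -- is already fixed, which contradicts injectivity.
    · exfalso
      rw [h4] at h3
      obtain ⟨w, hw, -⟩ := hexists (Sum.inl ⟨b + 1, by omega⟩)
      have h5 := htgt h2 hw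
      rw [← ha, h4] at h5
      have hout := (catGraph_src_stem _).1 h3
      have hwb : catIsBase w := by
        rcases w with w | ⟨w, u⟩
        · have h6 := catGraph_touches_spine.1 (Or.inr h5)
          simp only [reduceCtorEq, Sum.inr.injEq, false_or] at h6
          have h7 : b = w.1 := congrArg (fun s => s.1.1) h6
          have : w.1 < b + 1 := by omega
          exact this
        · obtain ⟨e', h6, -⟩ := catGraph_touches_side.1 (Or.inr h5)
          have h7 : b = w.1 := congrArg (fun s => s.1.1) (Sum.inr.inj h6)
          have : w.1 < b + 1 := by omega
          exact this
      have h6 := i.onV.injective (hw.trans (hbase w hwb).symm)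
      rw [← Sum.inl.inj h6] at hwb
      have hwb : b + 1 < b + 1 := hwb
      omega
  -- Walk along the zigzag: once one spine edge is fixed, so is its next vertex, and there the next
  -- spine edge and the stem have opposite directions, so they cannot be interchanged.
  have hspine : ∀ d : ℕ, ∀ hd : d ≤ 2 * K, a (Sum.inl ⟨c + d, by omega⟩) =
      Sum.inl ⟨c + d, by omega⟩ := by
    intro d
    induction d with
    | zero => exact fun _ => hstart
    | succ d ih =>
      intro hd
      have ih := ih (by omega)
      have hv := hfix (e := Sum.inl ⟨c + d, by omega⟩) (v := Sum.inl ⟨c + d, by omega⟩)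
        (catGraph_touches_spine.2 (Or.inl rfl)) (ha ▸ ih)
      have h1 := htouch (e := Sum.inl ⟨c + d + 1, by omega⟩) (v := Sum.inl ⟨c + d, by omega⟩)
        (catGraph_touches_spine.2 (Or.inr (Or.inl rfl))) hv
      rw [← ha] at h1
      rcases catGraph_touches_spine.1 h1 with h4 | h4 | h4
      · have h5 := Sum.inl.inj (hainj (h4.trans ih.symm))
        have h6 := congrArg Fin.val h5
        simp only at h6
        omega
      · exact h4
      · exfalso
        have hout := h.out_iff (j := c + d) (by omega) (by omega)
        have hflow := h.flow_pos_iff (j := c + d + 1) (by omega) (by omega)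
        have hs := catGraph_src_succ (⟨c + d, by omega⟩ : Fin (c + 2 * K)) (op := op)
        have ht := catGraph_tgt_succ (⟨c + d, by omega⟩ : Fin (c + 2 * K)) (op := op)
        simp only at hs ht
        by_cases hf : 0 < catFlow op (c + d + 1)
        · have h5 := hsrc (hs.2 hf) hv
          have h6 : a (Sum.inl (Fin.succ ⟨c + d, by omega⟩)) = _ := h4
          rw [← ha, h6] at h5
          have h7 := hout.1 ((catGraph_src_stem _).1 h5)
          have h8 := hflow.1 hf
          omega
        · have h5 := htgt (ht.2 hf) hv
          have h6 : a (Sum.inl (Fin.succ ⟨c + d, by omega⟩)) = _ := h4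
          rw [← ha, h6] at h5
          have h7 := (mt hout.2) ((catGraph_tgt_stem _).1 h5)
          have h8 := (mt hflow.2) hf
          omega
  rcases v with j | ⟨j, w⟩
  · by_cases hj : j.1 < c
    · exact hbase _ hj
    · obtain ⟨d, hd⟩ : ∃ d, j.1 = c + d := ⟨j.1 - c, by omega⟩
      have h1 := hspine d (by omega)
      refine hfix (e := Sum.inl ⟨c + d, by omega⟩) (catGraph_touches_spine.2 (Or.inl ?_)) (ha ▸ h1)
      exact congrArg _ (Fin.ext hd.symm)
  · by_cases hj : j.1 < c
    · exact hbase _ hj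
    · obtain ⟨d, hd⟩ : ∃ d, j.1 = c + d := ⟨j.1 - c, by omega⟩
      have h1 : a (Sum.inl j.castSucc) = Sum.inl j.castSucc := by
        have e : (⟨c + d, by omega⟩ : Fin (c + 2 * K + 1)) = j.castSucc := Fin.ext hd.symm
        rw [← e]
        exact hspine d (by omega)
      have h2 : a (Sum.inl j.succ) = Sum.inl j.succ := by
        have e : (⟨c + (d + 1), by omega⟩ : Fin (c + 2 * K + 1)) = j.succ :=
          Fin.ext (by rw [Fin.val_succ]; simp only; omega)
        rw [← e]
        exact hspine (d + 1) (by omega)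
      have hv := hfix (catGraph_touches_spine.2 (Or.inl rfl)) (ha ▸ h1)
      have h3 := htouch (e := Sum.inr ⟨j, (op j).kind.stem⟩)
        (catGraph_touches_spine.2 (Or.inr (Or.inr rfl))) hv
      rw [← ha] at h3
      have h4 : a (Sum.inr ⟨j, (op j).kind.stem⟩) = Sum.inr ⟨j, (op j).kind.stem⟩ := by
        rcases catGraph_touches_spine.1 h3 with h4 | h4 | h4
        · exact absurd (hainj (h4.trans h1.symm)) (by simp)
        · exact absurd (hainj (h4.trans h2.symm)) (by simp)
        · exact h4
      refine hfix (catGraph_touches_side.2 ⟨(op j).kind.stem, rfl, Or.inr ?_⟩) (ha ▸ h4)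
      exact (op j).kind.far_stem_of_fork (h.kind_eq (not_lt.1 hj) j.2) w

/-- As the isomorphism fixes all inner vertices and preserves positions, both keys induce the same
order on the vertices. Restricted to each of the four levels this recovers the permutation. -/
theorem eq_of_iso (h : CatZigzag op c K) (hadm : (catGraph op (c + 2 * K)).IsAdmissible)
    (σ τ : Fin 4 → Equiv.Perm (Fin K)) {r : ℕ}
    (hr : Fintype.card (CatV op (c + 2 * K)) = r) {x : Fin r → ℝ} (hx : StrictMono x)
    (i : TropicalCover.Iso (OpenGraph.toCover hadm (h.isIncreasing σ hr hx))
      (OpenGraph.toCover hadm (h.isIncreasing τ hr hx))) : σ = τ := by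
  have hrank : ∀ v : CatV op (c + 2 * K), keyRank (catKey σ) v = keyRank (catKey τ) v := by
    intro v
    obtain ⟨w, hw, hpw⟩ := OpenGraph.iso_exists_onV hadm _ _ i v
    obtain rfl : v = w := Sum.inl.inj ((h.iso_onV_eq hadm σ τ hr hx i v).symm.trans hw)
    exact (Fin.mk.inj (hx.injective hpw)).symm
  have hlt : ∀ v w : CatV op (c + 2 * K), catKey σ v < catKey σ w ↔ catKey τ v < catKey τ w := by
    intro v w
    rw [← keyRank_lt_iff (key := catKey σ), ← keyRank_lt_iff (key := catKey τ), hrank, hrank]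
  have hnum : ∀ j : Fin (c + 2 * K), c ≤ j.1 → 0 < (op j).kind.numV := by
    intro j hj
    rw [h.kind_eq hj j.2]
    exact Nat.one_pos
  have hex : ∀ t : Fin 4, ∀ k : Fin K, ∃ v : CatV op (c + 2 * K),
      ∀ ρ : Fin 4 → Equiv.Perm (Fin K), catKey ρ v = toLex (3 + t.1, (ρ t k).1) := by
    intro t k
    have e0 : (c + 2 * k.1 - c) / 2 = k.1 := by omega
    have e1 : (c + 2 * k.1 + 1 - c) / 2 = k.1 := by omega
    fin_cases t
    · refine ⟨Sum.inr ⟨⟨c + 2 * k + 1, by omega⟩, ⟨0, hnum _ (by simp only; omega)⟩⟩, fun ρ => ?_⟩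
      simp only [catKey]
      rw [if_neg (by omega), if_neg (by omega), e1, permNat_of_lt]
      rfl
    · refine ⟨Sum.inl ⟨c + 2 * k + 1, by omega⟩, fun ρ => ?_⟩
      simp only [catKey]
      rw [if_neg (by omega), if_neg (by omega), e1, permNat_of_lt]
      rfl
    · refine ⟨Sum.inl ⟨c + 2 * k, by omega⟩, fun ρ => ?_⟩
      simp only [catKey]
      rw [if_neg (by omega), if_pos (by omega), e0, permNat_of_lt]
      rfl
    · refine ⟨Sum.inr ⟨⟨c + 2 * k, by omega⟩, ⟨0, hnum _ (by simp)⟩⟩, fun ρ => ?_⟩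
      simp only [catKey]
      rw [if_neg (by omega), if_pos (by omega), e0, permNat_of_lt]
      rfl
  funext t
  refine Equiv.Perm.eq_of_lt_iff fun k l => ?_
  obtain ⟨v, hv⟩ := hex t k
  obtain ⟨w, hw⟩ := hex t l
  have := hlt v w
  rw [hv, hv, hw, hw, Prod.Lex.toLex_lt_toLex, Prod.Lex.toLex_lt_toLex] at this
  simpa using this

/-- The bound `hK` on the branch count is what pushes the base, and with it all links, into the
first half of the branch points. -/
theorem factorial_pow_le (h : CatZigzag op c K) {q n : ℕ} (he : CatEffective op (c + 2 * K) q n)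
    (hqc : q + 2 * n ≤ c) {g d : ℕ} {lam mu : Nat.Partition d}
    (hl : {1} + ∑ j ∈ Finset.range (c + 2 * K), (op j).leftEnds = lam.parts)
    (hr : {1} + ∑ j ∈ Finset.range (c + 2 * K), (op j).rightEnds = mu.parts)
    (hg : ∑ j ∈ Finset.range (c + 2 * K), (op j).numCyc = g)
    (hK : branchCount g lam mu ≤ 8 * K)
    {x : Fin (branchCount g lam mu) → ℝ} (hx : StrictMono x) :
    Nat.factorial K ^ 4 ≤ effectiveNonZigzagNumber g lam mu x := by
  have hcard := card_catV_eq_branchCount hl hr hg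
  have hadm := catGraph_isAdmissible he.toCatAdmissible
  have htype : ∀ σ : Fin 4 → Equiv.Perm (Fin K),
      (OpenGraph.toCover hadm (h.isIncreasing σ hcard hx)).HasType g lam mu x := fun σ =>
    catGraph_hasType he.toCatAdmissible hl hr hg _ (exists_keyPos_eq hcard (h.key_injective σ))
  have heff : ∀ σ : Fin 4 → Equiv.Perm (Fin K),
      (OpenGraph.toCover hadm (h.isIncreasing σ hcard hx)).IsEffectiveNonZigzag x := by
    intro σ
    refine he.isEffectiveNonZigzag _ fun j hj1 hj2 => ⟨_, ?_, rfl⟩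
    have hb : catIsBase (Sum.inl j : CatV op (c + 2 * K)) := by
      change j.1 < c
      omega
    -- With `r` branch points, `rank + 1 ≤ r - 4K ≤ r / 2` because `r ≤ 8K`.
    have := h.keyRank_base_add_le σ hb
    rw [hcard] at this
    simp only
    omega
  let F : (Fin 4 → Equiv.Perm (Fin K)) → Quotient (effectiveNonZigzagSetoid g lam mu x) :=
    fun σ => Quotient.mk _ ⟨_, htype σ, heff σ⟩
  have hF : Function.Injective F := by
    intro σ τ hστ
    obtain ⟨i⟩ := Quotient.exact hστ
    exact h.eq_of_iso hadm σ τ hcard hx i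
  have := finite_quotient_effectiveNonZigzag (g := g) (lam := lam) (mu := mu) hx.injective
  have hle := Nat.card_le_card_of_injective F hF
  rw [Nat.card_eq_fintype_card, Fintype.card_fun, Fintype.card_perm, Fintype.card_fin,
    Fintype.card_fin] at hle
  rw [effectiveNonZigzagNumber]
  omega

end CatZigzag

end Zigzag

/-! ### Caterpillars described by lists of tails -/

namespace TailOp

theorem wt_eq_sum_ends (o : TailOp) : o.wt = o.ends.sum := by
  obtain ⟨b, k, u⟩ := o
  cases k
  · simp [wt, ends, TailKind.mult, TailKind.stem]
  · simp [wt, ends, TailKind.mult, TailKind.stem, mul_two]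
  · simp [wt, ends, TailKind.mult, TailKind.stem, mul_two]

theorem sgn_eq (o : TailOp) : o.sgn = (o.leftEnds.sum : ℤ) - o.rightEnds.sum := by
  unfold sgn leftEnds rightEnds
  rw [wt_eq_sum_ends]
  split_ifs <;> simp

/-- A tail which attaches an even edge. -/
structure IsEven (o : TailOp) : Prop where
  size_pos : 0 < o.size
  even : o.kind = TailKind.single → Even o.size
  odd : o.kind ≠ TailKind.single → Odd o.size

end TailOp

/-- The single odd ends next to the links: the end on the right of one string, and the end on the
left of the next one. -/
def linkOps (L : List (ℕ × ℕ)) : List TailOp :=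
  L.flatMap fun a => [⟨true, TailKind.single, a.1⟩, ⟨false, TailKind.single, a.2⟩]

theorem linkOps_length (L : List (ℕ × ℕ)) : (linkOps L).length = 2 * L.length := by
  induction L with
  | nil => rfl
  | cons a L ih =>
    have : linkOps (a :: L) = ⟨true, TailKind.single, a.1⟩ :: ⟨false, TailKind.single, a.2⟩ ::
      linkOps L := rfl
    rw [this, List.length_cons, List.length_cons, ih, List.length_cons]
    ring

theorem linkOps_getElem? (L : List (ℕ × ℕ)) (k : ℕ) :
    (linkOps L)[2 * k]? = L[k]?.map (fun a => ⟨true, TailKind.single, a.1⟩) ∧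
      (linkOps L)[2 * k + 1]? = L[k]?.map (fun a => ⟨false, TailKind.single, a.2⟩) := by
  induction L generalizing k with
  | nil => simp [linkOps]
  | cons a L ih =>
    have h : linkOps (a :: L) = ⟨true, TailKind.single, a.1⟩ :: ⟨false, TailKind.single, a.2⟩ ::
      linkOps L := rfl
    cases k with
    | zero => simp [h]
    | succ k =>
      have e : 2 * (k + 1) = 2 * k + 1 + 1 := by ring
      rw [h, e]
      simpa using ih k

theorem linkOps_leftEnds (L : List (ℕ × ℕ)) :
    ((linkOps L).map TailOp.leftEnds).sum = ((L.map Prod.snd : List ℕ) : Multiset ℕ) := by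
  induction L with
  | nil => rfl
  | cons a L ih =>
    have h : linkOps (a :: L) = ⟨true, TailKind.single, a.1⟩ :: ⟨false, TailKind.single, a.2⟩ ::
      linkOps L := rfl
    rw [h, List.map_cons, List.map_cons, List.sum_cons, List.sum_cons, ih, List.map_cons,
      ← Multiset.cons_coe, ← Multiset.singleton_add]
    simp [TailOp.leftEnds, TailOp.ends]

theorem linkOps_rightEnds (L : List (ℕ × ℕ)) :
    ((linkOps L).map TailOp.rightEnds).sum = ((L.map Prod.fst : List ℕ) : Multiset ℕ) := by
  induction L with
  | nil => rfl
  | cons a L ih =>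
    have h : linkOps (a :: L) = ⟨true, TailKind.single, a.1⟩ :: ⟨false, TailKind.single, a.2⟩ ::
      linkOps L := rfl
    rw [h, List.map_cons, List.map_cons, List.sum_cons, List.sum_cons, ih, List.map_cons,
      ← Multiset.cons_coe, ← Multiset.singleton_add]
    simp [TailOp.rightEnds, TailOp.ends]

theorem linkOps_numCyc (L : List (ℕ × ℕ)) : ((linkOps L).map TailOp.numCyc).sum = 0 := by
  induction L with
  | nil => rfl
  | cons a L ih =>
    have h : linkOps (a :: L) = ⟨true, TailKind.single, a.1⟩ :: ⟨false, TailKind.single, a.2⟩ ::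
      linkOps L := rfl
    rw [h, List.map_cons, List.map_cons, List.sum_cons, List.sum_cons, ih]
    rfl

/-- At worst all right ends have been met and nothing has come back from the left ends. -/
theorem linkOps_take_sum (L : List (ℕ × ℕ)) (k : ℕ) :
    -((L.map Prod.fst).sum : ℤ) ≤ (((linkOps L).take k).map TailOp.sgn).sum := by
  induction L generalizing k with
  | nil => simp [linkOps]
  | cons a L ih =>
    have h : linkOps (a :: L) = ⟨true, TailKind.single, a.1⟩ :: ⟨false, TailKind.single, a.2⟩ ::
      linkOps L := rfl
    have e1 : (⟨true, TailKind.single, a.1⟩ : TailOp).sgn = -(a.1 : ℤ) := by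
      simp [TailOp.sgn, TailOp.wt, TailKind.mult, TailKind.stem]
    have e2 : (⟨false, TailKind.single, a.2⟩ : TailOp).sgn = (a.2 : ℤ) := by
      simp [TailOp.sgn, TailOp.wt, TailKind.mult, TailKind.stem]
    rw [h, List.map_cons, List.sum_cons]
    rcases k with _ | _ | k
    · simp only [List.take_zero, List.map_nil, List.sum_nil]
      omega
    · simp only [zero_add, List.take_succ_cons, List.take_zero, List.map_cons, List.map_nil,
        List.sum_cons, List.sum_nil, e1]
      omega
    · simp only [List.take_succ_cons, List.map_cons, List.sum_cons, e1, e2]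
      have := ih k
      omega

/-- The tails of a list, followed by those of a zigzag. -/
def listOp (l : List TailOp) (j : ℕ) : TailOp :=
  l[j]?.getD (if (j - l.length) % 2 = 0 then ⟨true, TailKind.fork, 1⟩ else
    ⟨false, TailKind.fork, 1⟩)

theorem listOp_of_lt {l : List TailOp} {j : ℕ} (h : j < l.length) : listOp l j = l[j] := by
  rw [listOp, List.getElem?_eq_getElem h, Option.getD_some]

theorem listOp_right (l : List TailOp) (i : ℕ) :
    listOp l (l.length + 2 * i) = ⟨true, TailKind.fork, 1⟩ := by
  rw [listOp, List.getElem?_eq_none (by omega), Option.getD_none, if_pos (by omega)]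

theorem listOp_left (l : List TailOp) (i : ℕ) :
    listOp l (l.length + 2 * i + 1) = ⟨false, TailKind.fork, 1⟩ := by
  rw [listOp, List.getElem?_eq_none (by omega), Option.getD_none, if_neg (by omega)]

theorem sum_range_listOp {M : Type*} [AddCommMonoid M] (f : TailOp → M) (l : List TailOp) (j : ℕ)
    (hj : j ≤ l.length) : ∑ i ∈ Finset.range j, f (listOp l i) = ((l.take j).map f).sum := by
  induction j with
  | zero => simp
  | succ j ih =>
    rw [Finset.sum_range_succ, ih (by omega), listOp_of_lt (by omega),
      List.take_succ_eq_append_getElem (by omega), List.map_append, List.sum_append]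
    simp

theorem sum_range_listOp_zigzag {M : Type*} [AddCommMonoid M] (f : TailOp → M) (l : List TailOp)
    (K : ℕ) : ∑ i ∈ Finset.range (l.length + 2 * K), f (listOp l i) =
      (l.map f).sum + K • (f ⟨true, TailKind.fork, 1⟩ + f ⟨false, TailKind.fork, 1⟩) := by
  induction K with
  | zero =>
    rw [Nat.mul_zero, Nat.add_zero, sum_range_listOp f l _ le_rfl, List.take_length, zero_smul,
      add_zero]
  | succ K ih =>
    have e : l.length + 2 * (K + 1) = l.length + 2 * K + 1 + 1 := by ring
    rw [e, Finset.sum_range_succ, Finset.sum_range_succ, ih, listOp_right, listOp_left, succ_nsmul]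
    abel

section Lists

variable {A B : List TailOp} {L : List (ℕ × ℕ)} {K : ℕ}

theorem List.sum_map_sgn (l : List TailOp) : (l.map TailOp.sgn).sum =
    (((l.map TailOp.leftEnds).sum.sum : ℕ) : ℤ) - ((l.map TailOp.rightEnds).sum.sum : ℕ) := by
  induction l with
  | nil => rfl
  | cons a l ih =>
    rw [List.map_cons, List.map_cons, List.map_cons, List.sum_cons, List.sum_cons, List.sum_cons,
      Multiset.sum_add, Multiset.sum_add, ih, a.sgn_eq]
    push_cast
    ring

theorem catFlow_listOp (l : List TailOp) {j : ℕ} (hj : j ≤ l.length) :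
    catFlow (listOp l) j = 1 + ((l.take j).map TailOp.sgn).sum := by
  rw [catFlow, sum_range_listOp _ l j hj]

/-- Along `A` the flow rises from 1. Along the links it stays at least 1, because `A` has supplied
at least as much as all right ends of the links take away. Along `B` it only decreases, towards its
final value 1. -/
theorem catFlow_listOp_pos (hA : ∀ o ∈ A, o.out = false) (hB : ∀ o ∈ B, o.out = true)
    (hL : (L.map Prod.fst).sum ≤ (A.map TailOp.wt).sum)
    (hsum : ((A ++ (linkOps L ++ B)).map TailOp.sgn).sum = 0) {j : ℕ}
    (hj : j ≤ (A ++ (linkOps L ++ B)).length) :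
    0 < catFlow (listOp (A ++ (linkOps L ++ B))) j := by
  have hA' : ∀ o ∈ A, o.sgn = o.wt := fun o ho => by simp [TailOp.sgn, hA o ho]
  have hAs : (A.map TailOp.sgn).sum = ((A.map TailOp.wt).sum : ℕ) := by
    rw [List.map_congr_left hA', Nat.cast_list_sum, List.map_map]
    rfl
  rw [catFlow_listOp _ hj]
  by_cases h1 : j ≤ A.length
  · rw [List.take_append_of_le_length h1]
    have : 0 ≤ ((A.take j).map TailOp.sgn).sum := by
      refine List.sum_nonneg fun z hz => ?_
      obtain ⟨o, ho, rfl⟩ := List.mem_map.1 hz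
      rw [hA' o (List.mem_of_mem_take ho)]
      positivity
    omega
  · by_cases h2 : j ≤ A.length + 2 * L.length
    · rw [List.take_append, List.take_of_length_le (by omega),
        List.take_append_of_le_length (by rw [linkOps_length]; omega), List.map_append,
        List.sum_append, hAs]
      have := linkOps_take_sum L (j - A.length)
      omega
    -- In block `B` the flow is bounded from the far end: the total change is zero and the remaining
    -- tails can only lower the flow.
    · have h3 := congrArg (fun l => (l.map TailOp.sgn).sum)
        (List.take_append_drop j (A ++ (linkOps L ++ B)))
      simp only [List.map_append, List.sum_append] at h3 hsum
      have h4 : ((List.drop j (A ++ (linkOps L ++ B))).map TailOp.sgn).sum ≤ 0 := by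
        rw [List.drop_append, List.drop_eq_nil_of_le (by omega), List.nil_append, List.drop_append,
          List.drop_eq_nil_of_le (by rw [linkOps_length]; omega), List.nil_append]
        refine (List.sum_le_card_nsmul _ 0 fun z hz => ?_).trans (smul_zero _).le
        obtain ⟨o, ho, rfl⟩ := List.mem_map.1 hz
        have := hB o (List.mem_of_mem_drop ho)
        simp [TailOp.sgn, this]
      omega

theorem catZigzag_listOp (hA : ∀ o ∈ A, o.out = false) (hB : ∀ o ∈ B, o.out = true)
    (hA0 : A ≠ []) (hK : 0 < K)
    (hL : (L.map Prod.fst).sum ≤ (A.map TailOp.wt).sum)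
    (hsum : ((A ++ (linkOps L ++ B)).map TailOp.sgn).sum = 0) :
    CatZigzag (listOp (A ++ (linkOps L ++ B))) (A ++ (linkOps L ++ B)).length K where
  c_pos := by
    have := List.length_pos_iff.2 hA0
    rw [List.length_append]
    omega
  K_pos := hK
  flow_pos := fun j hj => catFlow_listOp_pos hA hB hL hsum hj
  flow_eq := by
    rw [catFlow_listOp _ le_rfl, List.take_length, hsum, add_zero]
  right := fun i _ => listOp_right _ i
  left := fun i _ => listOp_left _ i

theorem catEffective_listOp (hA : ∀ o ∈ A, o.out = false) (hB : ∀ o ∈ B, o.out = true)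
    (hAe : ∀ o ∈ A, o.IsEven) (hBe : ∀ o ∈ B, o.IsEven)
    (hA0 : A ≠ []) (hL0 : L ≠ []) (hK : 0 < K) (hodd : ∀ a ∈ L, Odd a.1 ∧ Odd a.2)
    (hL : (L.map Prod.fst).sum ≤ (A.map TailOp.wt).sum)
    (hsum : ((A ++ (linkOps L ++ B)).map TailOp.sgn).sum = 0) :
    CatEffective (listOp (A ++ (linkOps L ++ B))) ((A ++ (linkOps L ++ B)).length + 2 * K)
      A.length L.length := by
  have hz := catZigzag_listOp hA hB hA0 hK hL hsum
  have hlen : (A ++ (linkOps L ++ B)).length = A.length + (2 * L.length + B.length) := by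
    rw [List.length_append, List.length_append, linkOps_length]
  have hlink : ∀ j, A.length ≤ j → j < A.length + 2 * L.length →
      listOp (A ++ (linkOps L ++ B)) j = ((linkOps L)[j - A.length]?).getD ⟨true, .single, 1⟩ := by
    intro j h1 h2
    rw [listOp, List.getElem?_append_right h1,
      List.getElem?_append_left (by rw [linkOps_length]; omega),
      List.getElem?_eq_getElem (by rw [linkOps_length]; omega)]
    rfl
  have hout : ∀ k (hk : k < L.length), listOp (A ++ (linkOps L ++ B)) (A.length + 2 * k) =
      ⟨true, TailKind.single, L[k].1⟩ := by
    intro k hk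
    rw [hlink _ (by omega) (by omega), Nat.add_sub_cancel_left, (linkOps_getElem? L k).1,
      List.getElem?_eq_getElem hk]
    rfl
  have hin : ∀ k (hk : k < L.length), listOp (A ++ (linkOps L ++ B)) (A.length + 2 * k + 1) =
      ⟨false, TailKind.single, L[k].2⟩ := by
    intro k hk
    rw [hlink _ (by omega) (by omega), Nat.add_assoc, Nat.add_sub_cancel_left,
      (linkOps_getElem? L k).2, List.getElem?_eq_getElem hk]
    rfl
  have hlinkodd : ∀ j, A.length ≤ j → j < A.length + 2 * L.length →
      (listOp (A ++ (linkOps L ++ B)) j).kind = TailKind.single ∧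
        Odd (listOp (A ++ (linkOps L ++ B)) j).size := by
    intro j h1 h2
    rcases Nat.even_or_odd' (j - A.length) with ⟨k, hk | hk⟩
    · rw [show j = A.length + 2 * k by omega, hout k (by omega)]
      exact ⟨rfl, (hodd _ (List.getElem_mem _)).1⟩
    · rw [show j = A.length + 2 * k + 1 by omega, hin k (by omega)]
      exact ⟨rfl, (hodd _ (List.getElem_mem _)).2⟩
  have hev : ∀ j, ¬ (A.length ≤ j ∧ j < A.length + 2 * L.length) →
      (listOp (A ++ (linkOps L ++ B)) j).IsEven := by
    intro j hj
    by_cases h1 : j < A.length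
    · rw [listOp_of_lt (by omega), List.getElem_append_left h1]
      exact hAe _ (List.getElem_mem _)
    · by_cases h2 : j < (A ++ (linkOps L ++ B)).length
      · rw [listOp_of_lt h2, List.getElem_append_right (by omega),
          List.getElem_append_right (by rw [linkOps_length]; omega)]
        exact hBe _ (List.getElem_mem _)
      · rw [listOp, List.getElem?_eq_none (by omega), Option.getD_none]
        split_ifs
        · exact ⟨Nat.one_pos, TailKind.noConfusion, fun _ => odd_one⟩
        · exact ⟨Nat.one_pos, TailKind.noConfusion, fun _ => odd_one⟩
  have hpos : 0 < A.length := List.length_pos_iff.2 hA0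
  refine
    { pos := by omega
      flow_ne := ?_
      flow_last := hz.flow_even K le_rfl
      size_pos := ?_
      q_pos := hpos
      n_pos := List.length_pos_iff.2 hL0
      lt := by omega
      link_kind := fun j h1 h2 => (hlinkodd j h1 h2).1
      link_odd := fun j h1 h2 => (hlinkodd j h1 h2).2
      link_out := fun k hk => by rw [hout k hk]
      link_in := fun k hk => by rw [hin k hk]
      single_even := fun j _ hj => (hev j hj).even
      odd_of_ne_single := fun j _ hj => (hev j hj).odd
      flow_pos := fun j _ h2 => hz.flow_pos j (by omega) }
  · intro j hj
    by_cases h1 : j ≤ (A ++ (linkOps L ++ B)).length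
    · exact (hz.flow_pos j h1).ne'
    · rcases Nat.even_or_odd' (j - (A ++ (linkOps L ++ B)).length) with ⟨k, hk | hk⟩
      · rw [show j = (A ++ (linkOps L ++ B)).length + 2 * k by omega, hz.flow_even k (by omega)]
        exact one_ne_zero
      · rw [show j = (A ++ (linkOps L ++ B)).length + 2 * k + 1 by omega,
          hz.flow_odd k (by omega)]
        decide
  · intro j _
    by_cases h1 : A.length ≤ j ∧ j < A.length + 2 * L.length
    · exact (hlinkodd j h1.1 h1.2).2.pos
    · exact (hev j h1).size_pos

/-- On each side the summand `{1}` is the end of the spine and `K • {1, 1}` comes from the forks of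
the zigzag. -/
theorem factorial_pow_le_of_lists (hA : ∀ o ∈ A, o.out = false) (hB : ∀ o ∈ B, o.out = true)
    (hAe : ∀ o ∈ A, o.IsEven) (hBe : ∀ o ∈ B, o.IsEven)
    (hA0 : A ≠ []) (hL0 : L ≠ []) (hK : 0 < K) (hodd : ∀ a ∈ L, Odd a.1 ∧ Odd a.2)
    (hL : (L.map Prod.fst).sum ≤ (A.map TailOp.wt).sum)
    {g d : ℕ} {lam mu : Nat.Partition d}
    (hl : {1} + (((A ++ (linkOps L ++ B)).map TailOp.leftEnds).sum + K • {1, 1}) = lam.parts)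
    (hr : {1} + (((A ++ (linkOps L ++ B)).map TailOp.rightEnds).sum + K • {1, 1}) = mu.parts)
    (hg : ((A ++ (linkOps L ++ B)).map TailOp.numCyc).sum = g)
    (hK8 : branchCount g lam mu ≤ 8 * K)
    {x : Fin (branchCount g lam mu) → ℝ} (hx : StrictMono x) :
    Nat.factorial K ^ 4 ≤ effectiveNonZigzagNumber g lam mu x := by
  -- Both partitions have the same degree and the zigzag contributes equally to both sides, so the
  -- listed tails change the flow by zero in total.
  have hsum : ((A ++ (linkOps L ++ B)).map TailOp.sgn).sum = 0 := by
    have h1 := (congrArg Multiset.sum hl).trans (lam.parts_sum.trans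
      (mu.parts_sum.symm.trans (congrArg Multiset.sum hr).symm))
    simp only [Multiset.sum_add] at h1
    rw [List.sum_map_sgn]
    omega
  refine (catZigzag_listOp hA hB hA0 hK hL hsum).factorial_pow_le
    (catEffective_listOp hA hB hAe hBe hA0 hL0 hK hodd hL hsum) ?_ ?_ ?_ ?_ hK8 hx
  · rw [List.length_append, List.length_append, linkOps_length]
    omega
  · rw [sum_range_listOp_zigzag, ← hl]
    rfl
  · rw [sum_range_listOp_zigzag, ← hr]
    rfl
  · rw [sum_range_listOp_zigzag, hg]
    rfl

end Lists

namespace TailOp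

theorem sum_leftEnds_single (l : List ℕ) :
    ((l.map (TailOp.mk false .single)).map leftEnds).sum = (l : Multiset ℕ) := by
  induction l with
  | nil => rfl
  | cons a l ih =>
    rw [List.map_cons, List.map_cons, List.sum_cons, ih]
    rfl

theorem sum_rightEnds_single (l : List ℕ) :
    ((l.map (TailOp.mk true .single)).map rightEnds).sum = (l : Multiset ℕ) := by
  induction l with
  | nil => rfl
  | cons a l ih =>
    rw [List.map_cons, List.map_cons, List.sum_cons, ih]
    rfl

theorem ends_of_ne_single {o : TailOp} (h : o.kind ≠ .single) : o.ends = {o.size} + {o.size} := by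
  obtain ⟨b, k, u⟩ := o
  cases k
  · exact absurd rfl h
  · rfl
  · rfl

theorem sum_leftEnds_of_ne_single {k : TailKind} (hk : k ≠ .single) (l : List ℕ) :
    ((l.map (TailOp.mk false k)).map leftEnds).sum = (l + l : Multiset ℕ) := by
  induction l with
  | nil => rfl
  | cons a l ih =>
    have h : (TailOp.mk false k a).leftEnds = {a} + {a} := ends_of_ne_single hk
    rw [List.map_cons, List.map_cons, List.sum_cons, ih, h, ← Multiset.cons_coe,
      ← Multiset.singleton_add]
    abel

theorem sum_rightEnds_of_ne_single {k : TailKind} (hk : k ≠ .single) (l : List ℕ) :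
    ((l.map (TailOp.mk true k)).map rightEnds).sum = (l + l : Multiset ℕ) := by
  induction l with
  | nil => rfl
  | cons a l ih =>
    have h : (TailOp.mk true k a).rightEnds = {a} + {a} := ends_of_ne_single hk
    rw [List.map_cons, List.map_cons, List.sum_cons, ih, h, ← Multiset.cons_coe,
      ← Multiset.singleton_add]
    abel

theorem sum_leftEnds_out (k : TailKind) (l : List ℕ) :
    ((l.map (TailOp.mk true k)).map leftEnds).sum = 0 := by
  refine List.sum_eq_zero fun a ha => ?_
  simp only [List.map_map, List.mem_map] at ha
  obtain ⟨u, -, rfl⟩ := ha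
  rfl

theorem sum_rightEnds_in (k : TailKind) (l : List ℕ) :
    ((l.map (TailOp.mk false k)).map rightEnds).sum = 0 := by
  refine List.sum_eq_zero fun a ha => ?_
  simp only [List.map_map, List.mem_map] at ha
  obtain ⟨u, -, rfl⟩ := ha
  rfl

theorem sum_numCyc_of_ne_cyc (b : Bool) {k : TailKind} (hk : k ≠ .cyc) (l : List ℕ) :
    ((l.map (TailOp.mk b k)).map numCyc).sum = 0 := by
  refine List.sum_eq_zero fun a ha => ?_
  simp only [List.map_map, List.mem_map] at ha
  obtain ⟨u, -, rfl⟩ := ha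
  cases k
  · rfl
  · rfl
  · exact absurd rfl hk

theorem sum_numCyc_cyc (b : Bool) (l : List ℕ) :
    ((l.map (TailOp.mk b .cyc)).map numCyc).sum = l.length := by
  induction l with
  | nil => rfl
  | cons a l ih =>
    rw [List.map_cons, List.map_cons, List.sum_cons, ih, List.length_cons, add_comm]
    rfl

end TailOp

/-! ### Distributing the parts of the partitions among the tails -/

namespace Nat.Partition

/-- Any positive even part can be a single-end tail, so the two even components of the tail
decomposition are merged into `E`. The paired odd parts `p` become forks, and `z` goes into the
links. -/
theorem exists_lists {d : ℕ} (lam : Nat.Partition d) : ∃ E p z : List ℕ,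
    lam.parts = (E + (p + p) + z : Multiset ℕ) ∧ (∀ u ∈ E, 0 < u ∧ Even u) ∧ (∀ u ∈ p, Odd u) ∧
      ∀ u ∈ z, Odd u := by
  obtain ⟨e, o, p, z, h⟩ := lam.exists_isTailDecomposition
  have hE : ∀ u ∈ e.map (2 * ·) + o.map (2 * ·), 0 < u ∧ Even u := by
    intro u hu
    refine ⟨lam.parts_pos ?_, ?_⟩
    · rw [h.eq]
      exact Multiset.mem_add.2 (Or.inl (Multiset.mem_add.2 (Or.inl hu)))
    · rcases Multiset.mem_add.1 hu with hu | hu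
      · obtain ⟨a, -, rfl⟩ := Multiset.mem_map.1 hu
        exact even_two_mul a
      · obtain ⟨a, -, rfl⟩ := Multiset.mem_map.1 hu
        exact even_two_mul a
  refine ⟨(e.map (2 * ·) + o.map (2 * ·)).toList, p.toList, z.toList, ?_, ?_, ?_, ?_⟩
  · simp only [Multiset.coe_toList]
    exact h.eq
  · exact fun u hu => hE u (Multiset.mem_toList.1 hu)
  · exact fun u hu => h.odd_p u (Multiset.mem_toList.1 hu)
  · exact fun u hu => h.odd_z u (Multiset.mem_toList.1 hu)

theorem mod_two_eq {d : ℕ} {lam : Nat.Partition d} {E p z : List ℕ}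
    (h : lam.parts = (E + (p + p) + z : Multiset ℕ)) (hE : ∀ u ∈ E, 0 < u ∧ Even u)
    (hz : ∀ u ∈ z, Odd u) : d % 2 = z.length % 2 := by
  have h1 : E.sum % 2 = 0 := by
    refine Nat.even_iff.1 (even_iff_two_dvd.2 (List.dvd_sum fun u hu => ?_))
    exact (hE u hu).2.two_dvd
  have h2 : z.sum % 2 = z.length % 2 := by
    clear h
    induction z with
    | nil => rfl
    | cons a z ih =>
      have ih := ih fun u hu => hz u (List.mem_cons_of_mem _ hu)
      have ha := Nat.odd_iff.1 (hz a List.mem_cons_self)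
      rw [List.sum_cons, List.length_cons]
      omega
  have h3 := lam.parts_sum
  rw [h, Multiset.sum_add, Multiset.sum_add, Multiset.sum_add, Multiset.sum_coe, Multiset.sum_coe,
    Multiset.sum_coe] at h3
  omega

end Nat.Partition

theorem Multiset.nsmul_pair_one (K : ℕ) :
    K • ({1, 1} : Multiset ℕ) = Multiset.replicate K 1 + Multiset.replicate K 1 := by
  have : ({1, 1} : Multiset ℕ) = {1} + {1} := rfl
  rw [this, nsmul_add, Multiset.nsmul_singleton]

/-- The left ends of the strings attached to a link, and the right ends. -/
def linkPairs (z z' : List ℕ) (c : ℕ) : List (ℕ × ℕ) :=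
  z.map (fun a => (1, a)) ++ (z'.map (fun b => (b, 1)) ++ List.replicate c (1, 1))

theorem linkPairs_fst (z z' : List ℕ) (c : ℕ) : (linkPairs z z' c).map Prod.fst =
    List.replicate z.length 1 ++ (z' ++ List.replicate c 1) := by
  simp [linkPairs, List.map_map, Function.comp_def, List.map_const']

theorem linkPairs_snd (z z' : List ℕ) (c : ℕ) : (linkPairs z z' c).map Prod.snd =
    z ++ (List.replicate z'.length 1 ++ List.replicate c 1) := by
  simp [linkPairs, List.map_map, Function.comp_def, List.map_const']

/-- Every unpaired part of `lam` or `mu` is matched with a 1 on the other side in a link; `c`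
further links are pairs of ones. The equations `hm` and `hm'` count the ones on the two sides: the
end of the spine, `N` left forks or `N'` right forks, `g` cycle tails on the right, the partners of
`z'` or `z`, the `c` extra links, and the `K` forks of the zigzag. The right ends of the links weigh
`z.length + z'.sum + c`; by `hN` the `N` forks on the left supply that much. -/
theorem factorial_pow_le_of_tailDecomposition {g d m : ℕ} {lam mu : Nat.Partition d}
    {E p z E' p' z' : List ℕ}
    (hlam : lam.parts = (E + (p + p) + z : Multiset ℕ)) (hmu : mu.parts = (E' + (p' + p') + z' : Multiset ℕ))
    (hE : ∀ u ∈ E, 0 < u ∧ Even u) (hp : ∀ u ∈ p, Odd u) (hz : ∀ u ∈ z, Odd u)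
    (hE' : ∀ u ∈ E', 0 < u ∧ Even u) (hp' : ∀ u ∈ p', Odd u) (hz' : ∀ u ∈ z', Odd u)
    {N N' c K : ℕ} (hN : z.length + z'.sum + c ≤ 2 * N) (hc : 0 < c) (hK : 0 < K)
    (hm : m = 1 + 2 * N + z'.length + c + 2 * K)
    (hm' : m = 1 + 2 * N' + 2 * g + z.length + c + 2 * K)
    (hK8 : branchCount g (lam.addOnes m) (mu.addOnes m) ≤ 8 * K)
    {x : Fin (branchCount g (lam.addOnes m) (mu.addOnes m)) → ℝ} (hx : StrictMono x) :
    Nat.factorial K ^ 4 ≤ effectiveNonZigzagNumber g (lam.addOnes m) (mu.addOnes m) x := by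
  have hne : TailKind.fork ≠ TailKind.single := TailKind.noConfusion
  have hne' : TailKind.cyc ≠ TailKind.single := TailKind.noConfusion
  have hone : ({1} : Multiset ℕ) = Multiset.replicate 1 1 := rfl
  refine factorial_pow_le_of_lists
    (A := E.map (TailOp.mk false .single) ++ (p ++ List.replicate N 1).map (TailOp.mk false .fork))
    (B := E'.map (TailOp.mk true .single) ++ ((p' ++ List.replicate N' 1).map (TailOp.mk true .fork) ++
      (List.replicate g 1).map (TailOp.mk true .cyc)))
    (L := linkPairs z z' c) ?_ ?_ ?_ ?_ ?_ ?_ hK ?_ ?_ ?_ ?_ ?_ hK8 hx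
  · intro o ho
    rcases List.mem_append.1 ho with ho | ho
    · obtain ⟨u, -, rfl⟩ := List.mem_map.1 ho
      rfl
    · obtain ⟨u, -, rfl⟩ := List.mem_map.1 ho
      rfl
  · intro o ho
    rcases List.mem_append.1 ho with ho | ho
    · obtain ⟨u, -, rfl⟩ := List.mem_map.1 ho
      rfl
    · rcases List.mem_append.1 ho with ho | ho
      · obtain ⟨u, -, rfl⟩ := List.mem_map.1 ho
        rfl
      · obtain ⟨u, -, rfl⟩ := List.mem_map.1 ho
        rfl
  · intro o ho
    rcases List.mem_append.1 ho with ho | ho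
    · obtain ⟨u, hu, rfl⟩ := List.mem_map.1 ho
      exact ⟨(hE u hu).1, fun _ => (hE u hu).2, fun h => absurd rfl h⟩
    · obtain ⟨u, hu, rfl⟩ := List.mem_map.1 ho
      have hu : Odd u := (List.mem_append.1 hu).elim (hp u)
        fun hu => (List.eq_of_mem_replicate hu) ▸ odd_one
      exact ⟨hu.pos, fun h => absurd h hne, fun _ => hu⟩
  · intro o ho
    rcases List.mem_append.1 ho with ho | ho
    · obtain ⟨u, hu, rfl⟩ := List.mem_map.1 ho
      exact ⟨(hE' u hu).1, fun _ => (hE' u hu).2, fun h => absurd rfl h⟩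
    · rcases List.mem_append.1 ho with ho | ho
      · obtain ⟨u, hu, rfl⟩ := List.mem_map.1 ho
        have hu : Odd u := (List.mem_append.1 hu).elim (hp' u)
          fun hu => (List.eq_of_mem_replicate hu) ▸ odd_one
        exact ⟨hu.pos, fun h => absurd h hne, fun _ => hu⟩
      · obtain ⟨u, hu, rfl⟩ := List.mem_map.1 ho
        have hu : Odd u := (List.eq_of_mem_replicate hu) ▸ odd_one
        exact ⟨hu.pos, fun h => absurd h hne', fun _ => hu⟩
  -- `hN` and `hc` force `0 < N`, so the left block contains a fork.
  · intro h
    have := congrArg List.length h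
    simp at this
    omega
  · intro h
    have := congrArg List.length h
    simp [linkPairs] at this
    omega
  · intro a ha
    rcases List.mem_append.1 ha with ha | ha
    · obtain ⟨u, hu, rfl⟩ := List.mem_map.1 ha
      exact ⟨odd_one, hz u hu⟩
    · rcases List.mem_append.1 ha with ha | ha
      · obtain ⟨u, hu, rfl⟩ := List.mem_map.1 ha
        exact ⟨hz' u hu, odd_one⟩
      · rw [List.eq_of_mem_replicate ha]
        exact ⟨odd_one, odd_one⟩
  · have h1 : (((List.replicate N 1).map (TailOp.mk false .fork)).map TailOp.wt).sum = 2 * N := by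
      have h0 : (TailOp.mk false .fork 1).wt = 2 := rfl
      rw [List.map_replicate, List.map_replicate, h0, List.sum_replicate, smul_eq_mul, mul_comm]
    rw [linkPairs_fst, List.map_append, List.map_append, List.map_append, List.sum_append,
      List.sum_append, List.sum_append, List.sum_append, List.sum_replicate, List.sum_replicate, h1]
    simp only [smul_eq_mul, mul_one]
    omega
  · change _ = lam.parts + Multiset.replicate m 1
    rw [Multiset.nsmul_pair_one]
    simp only [List.map_append, List.sum_append, TailOp.sum_leftEnds_single,
      linkOps_leftEnds, linkPairs_snd, TailOp.sum_leftEnds_out,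
      TailOp.sum_leftEnds_of_ne_single hne, hlam, hm, two_mul,
      Multiset.replicate_add, ← Multiset.coe_add, Multiset.coe_replicate, hone]
    abel
  · change _ = mu.parts + Multiset.replicate m 1
    rw [Multiset.nsmul_pair_one]
    simp only [List.map_append, List.sum_append, TailOp.sum_rightEnds_single,
      linkOps_rightEnds, linkPairs_fst, TailOp.sum_rightEnds_in,
      TailOp.sum_rightEnds_of_ne_single hne, TailOp.sum_rightEnds_of_ne_single hne',
      hmu, hm', two_mul, Multiset.replicate_add, ← Multiset.coe_add,
      Multiset.coe_replicate, hone]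
    abel
  · simp only [List.map_append, List.sum_append, linkOps_numCyc, TailOp.sum_numCyc_cyc,
      List.length_replicate, TailOp.sum_numCyc_of_ne_cyc _ (TailKind.noConfusion : TailKind.single ≠ .cyc),
      TailOp.sum_numCyc_of_ne_cyc _ (TailKind.noConfusion : TailKind.fork ≠ .cyc), zero_add]

theorem mainTheorem4 (g d : ℕ) (lam mu : Nat.Partition d) :
    ∃ m₀ : ℕ, ∀ m : ℕ, 2 * m₀ < m →
      (2 ≤ lam.zeroPart.card + mu.zeroPart.card ∨
        (lam.zeroPart.card + mu.zeroPart.card = 0 ∧ Odd m)) →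
      ∀ x : Fin (branchCount g (lam.addOnes m) (mu.addOnes m)) → ℝ, StrictMono x →
        Nat.factorial (m / 2 - m₀) ^ 4 ≤ effectiveNonZigzagNumber g (lam.addOnes m) (mu.addOnes m) x := by
  obtain ⟨E, p, z, hlam, hE, hp, hz⟩ := lam.exists_lists
  obtain ⟨E', p', z', hmu, hE', hp', hz'⟩ := mu.exists_lists
  -- Both partitions have the same degree, so `z` and `z'` have lengths of the same parity. Hence
  -- one choice of `c` makes the numbers of ones left for `N` and for `N'` even at the same time.
  have hpar := (Nat.Partition.mod_two_eq hlam hE hz).symm.trans (Nat.Partition.mod_two_eq hmu hE' hz')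
  -- `2W` ones per side, up to one more for odd `m`, are kept out of the zigzag. They have to
  -- suffice for the links, for the `g` cycle tails and for the forks of the first block which keep
  -- the flow positive.
  obtain ⟨W, hW⟩ : ∃ W, W = 2 * z.length + z'.length + z'.sum + g + 5 := ⟨_, rfl⟩
  -- Since the branch count is `2m` plus a constant and `8K` is about `4m - 8W`, the bound `8K` is
  -- met once `2m` exceeds `8W` plus a constant; hence the `2W` in `m₀`. Moreover `m₀ ≥ W` gives `m
  -- / 2 - m₀ ≤ K`.
  refine ⟨2 * W + lam.parts.card + mu.parts.card + 2 * g + 1, fun m hm _ x hx => ?_⟩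
  have hbr : branchCount g (lam.addOnes m) (mu.addOnes m) =
      lam.parts.card + m + (mu.parts.card + m) + 2 * g - 2 := by
    simp [branchCount, Nat.Partition.addOnes]
  have key := factorial_pow_le_of_tailDecomposition (g := g) (m := m) hlam hmu hE hp hz hE' hp' hz'
    (N := (m - 1 - z'.length - (1 + (m + z'.length) % 2) - 2 * (m / 2 - W)) / 2)
    (N' := (m - 1 - z.length - (1 + (m + z'.length) % 2) - 2 * g - 2 * (m / 2 - W)) / 2)
    -- `c` is 1 or 2: positive, so that at least one link exists, and of the parity that makes the
    -- divisions by 2 in `N` and `N'` exact.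
    (c := 1 + (m + z'.length) % 2) (K := m / 2 - W) (by omega) (by omega) (by omega) (by omega)
    (by omega) (by omega) hx
  exact le_trans (Nat.pow_le_pow_left (Nat.factorial_le (by omega)) 4) key
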